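/- There is an algorithm that, given a finite simple graph $G$ on $n$ vertices and a set $R\subseteq V(G)$ of size $r$ such that $G-R$ has exactly two connected components and each of them is a complete graph, runs in time $O(2^{O(r^2)}n^6)$ and outputs a Grundy colouring of $G$ that uses the maximum number of colours. That is, there are one algorithm and a constant $c$ such that the algorithm halts on every such input $(G,R)$ after at most $c\cdot 2^{c r^2}\cdot n^6$ steps with such a colouring. Here a Grundy colouring of $G$ is an ordered partition $(C_1,\dots,C_\ell)$ of $V(G)$ into nonempty independent sets such that, for all $1\le j<i\le \ell$, every vertex of $C_i$ has a neighbour in $C_j$; it uses the maximum number of colours if no Grundy colouring of $G$ has more than $\ell$ classes. The model of computation is a random access machine with words of $O(\log n)$ bits, in which reading a constant, register or array entry, writing one, a test, and an arithmetic operation or comparison of words each count as one step; $G$ is given by $n$ and its adjacency matrix, $R$ by its characteristic vector. -/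

import Mathlib

/-! ### Cluster modulators and Grundy colourings -/

namespace SimpleGraph

/-- Every connected component is a complete graph. -/
def IsClusterGraph {V : Type*} (G : SimpleGraph V) : Prop :=
  ∀ K : G.ConnectedComponent, G.IsClique K.supp

/-- A cluster graph with exactly `k` connected components. -/
def IsKClusterGraph {V : Type*} (G : SimpleGraph V) (k : ℕ) : Prop :=
  G.IsClusterGraph ∧ Finite G.ConnectedComponent ∧ Nat.card G.ConnectedComponent = k

/-- `R` is a `k`-cluster modulator of `G`: the graph `G - R` is a `k`-cluster graph. -/
def IsKClusterModulator {V : Type*} (G : SimpleGraph V) (k : ℕ) (R : Set V) : Prop :=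
  (G.induce Rᶜ).IsKClusterGraph k

/-- The sequence `C` of `ℓ` vertex sets is an ordered partition of the vertex set into (nonempty)
independent sets such that every vertex of a class has a neighbour in each earlier class. -/
structure IsGrundyColoring {V : Type*} (G : SimpleGraph V) {ℓ : ℕ} (C : Fin ℓ → Set V) : Prop where
  nonempty : ∀ i, (C i).Nonempty
  disjoint : ∀ i j, i ≠ j → Disjoint (C i) (C j)
  cover : ∀ v, ∃ i, v ∈ C i
  independent : ∀ i, G.IsIndepSet (C i)
  neighbor : ∀ i, ∀ v ∈ C i, ∀ j, j < i → ∃ u ∈ C j, G.Adj v u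

/-- A Grundy colouring that uses the maximum number of colours among all Grundy colourings. -/
def IsMaximumGrundyColoring {V : Type*} (G : SimpleGraph V) {ℓ : ℕ} (C : Fin ℓ → Set V) : Prop :=
  G.IsGrundyColoring C ∧
    ∀ (m : ℕ) (D : Fin m → Set V), G.IsGrundyColoring D → m ≤ ℓ

end SimpleGraph

/-! ### A random access machine with bounded words and a step count -/

namespace RAM

/-- Contents of the machine: registers, and arrays. A program names the registers and arrays that it
uses by constants, so that it uses finitely many of them; array indices are computed. -/
structure State where
  reg : ℕ → ℕ
  arr : ℕ → ℕ → ℕ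

/-- Word operations. -/
inductive Op
  | add
  | sub
  | mul
  | div
  | lt
  | eq

/-- Subtraction is truncated at `0`, division rounds down (and gives `0` for the divisor `0`),
comparisons return `1` for true and `0` for false. -/
def Op.eval : Op → ℕ → ℕ → ℕ
  | add, a, b => a + b
  | sub, a, b => a - b
  | mul, a, b => a * b
  | div, a, b => a / b
  | lt, a, b => if a < b then 1 else 0
  | eq, a, b => if a = b then 1 else 0

/-- Expressions: constants, register contents, array entries, results of operations. -/
inductive Expr
  | lit (k : ℕ)
  | reg (x : ℕ)
  | get (a : ℕ) (i : Expr)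
  | op (o : Op) (e₁ e₂ : Expr)

def Expr.eval (s : State) : Expr → ℕ
  | lit k => k
  | reg x => s.reg x
  | get a i => s.arr a (i.eval s)
  | op o e₁ e₂ => o.eval (e₁.eval s) (e₂.eval s)

/-- The number of elementary operations in an evaluation of the expression: one for each constant,
register access, array access and arithmetic or comparison operation. -/
def Expr.cost : Expr → ℕ
  | lit _ => 1
  | reg _ => 1
  | get _ i => i.cost + 1
  | op _ e₁ e₂ => e₁.cost + e₂.cost + 1

/-- All the values that occur in the evaluation of the expression (array indices and intermediate
results included) are smaller than the word bound `B`. -/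
def Expr.Fits (B : ℕ) (s : State) : Expr → Prop
  | lit k => k < B
  | reg x => s.reg x < B
  | get a i => i.Fits B s ∧ s.arr a (i.eval s) < B
  | op o e₁ e₂ => e₁.Fits B s ∧ e₂.Fits B s ∧ o.eval (e₁.eval s) (e₂.eval s) < B

/-- Programs: `set x e` is the assignment of `e` to the register `x`, `put a i e` the assignment of
`e` to the entry `i` of the array `a`; a test succeeds if its value is not `0`. -/
inductive Prog
  | skip
  | set (x : ℕ) (e : Expr)
  | put (a : ℕ) (i e : Expr)
  | seq (p q : Prog)
  | cond (b : Expr) (p q : Prog)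
  | loop (b : Expr) (p : Prog)

def State.setReg (s : State) (x v : ℕ) : State :=
  { s with reg := Function.update s.reg x v }

def State.setArr (s : State) (a i v : ℕ) : State :=
  { s with arr := Function.update s.arr a (Function.update (s.arr a) i v) }

/-- `Exec B p s t s'`: started in the state `s`, the program `p` halts after exactly `t` steps in
the state `s'`, and all the values computed in the run are smaller than `B`. -/
inductive Exec (B : ℕ) : Prog → State → ℕ → State → Prop
  | skip (s : State) : Exec B .skip s 1 s
  | set (s : State) (x : ℕ) (e : Expr) (he : e.Fits B s) :
      Exec B (.set x e) s (e.cost + 1) (s.setReg x (e.eval s))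
  | put (s : State) (a : ℕ) (i e : Expr) (hi : i.Fits B s) (he : e.Fits B s) :
      Exec B (.put a i e) s (i.cost + e.cost + 1) (s.setArr a (i.eval s) (e.eval s))
  | seq (p q : Prog) (s s' s'' : State) (t t' : ℕ) (hp : Exec B p s t s')
      (hq : Exec B q s' t' s'') : Exec B (.seq p q) s (t + t') s''
  | cond_true (b : Expr) (p q : Prog) (s s' : State) (t : ℕ) (hb : b.Fits B s)
      (hb' : b.eval s ≠ 0) (hp : Exec B p s t s') :
      Exec B (.cond b p q) s (b.cost + 1 + t) s'
  | cond_false (b : Expr) (p q : Prog) (s s' : State) (t : ℕ) (hb : b.Fits B s)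
      (hb' : b.eval s = 0) (hq : Exec B q s t s') :
      Exec B (.cond b p q) s (b.cost + 1 + t) s'
  | loop_true (b : Expr) (p : Prog) (s s' s'' : State) (t t' : ℕ) (hb : b.Fits B s)
      (hb' : b.eval s ≠ 0) (hp : Exec B p s t s') (hl : Exec B (.loop b p) s' t' s'') :
      Exec B (.loop b p) s (b.cost + 1 + t + t') s''
  | loop_false (b : Expr) (p : Prog) (s : State) (hb : b.Fits B s) (hb' : b.eval s = 0) :
      Exec B (.loop b p) s (b.cost + 1) s

open Classical in
/-- The initial state for a graph `G` with the vertices `0, …, n - 1` and a set `R` of vertices: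
register `0` holds `n`, array `0` holds the adjacency matrix of `G` row by row, array `1` holds the
characteristic vector of `R`, and everything else is `0`. -/
noncomputable def inputState {n : ℕ} (G : SimpleGraph (Fin n)) (R : Finset (Fin n)) : State where
  reg x := if x = 0 then n else 0
  arr a k :=
    if a = 0 then (if ∃ u v : Fin n, k = u * n + v ∧ G.Adj u v then 1 else 0)
    else if a = 1 then (if ∃ v ∈ R, k = v then 1 else 0)
    else 0

/-- The number of colours is read off from register `1`, and the colour of the vertex `v`, a number
from `1` up to the number of colours, from entry `v` of array `2`; the result is the sequence of the
colour classes. -/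
def outputClasses (n : ℕ) (s : State) : Fin (s.reg 1) → Set (Fin n) :=
  fun i => {v | s.arr 2 v = i + 1}

end RAM

/-! Fix a Grundy colouring with `ℓ` colours, and call a class a modulator class if it meets `R`;
there are at most `r` of these. Any other class is independent in a union of two cliques, so it is a
single vertex or a pair with one vertex in each clique. Single classes in different cliques cannot
coexist: the later vertex would have no neighbour in the earlier class. Hence one clique, A, meets
every class without modulator vertices (`Guess.exists_oriented`); the other clique is B. Let the
level of a class be the number of modulator classes before it. A vertex of B has no neighbour in a
single class, so all of B is coloured before every single class (`Guess.lt_single`). Therefore some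
threshold level is at least the level of each pair and at most the level of each single class
(`Guess.exists_describes`).

The algorithm tries all values of the following data: the distribution of `R` over the modulator
classes, the modulator classes that meet A or B and the adjacency of those members to `R` (`O(r ^
2)` bits), a vertex `v₀` of A, the number `d` of single classes, and the threshold. For a correct
guess the rest is bipartite matching. Whether a pair or a single vertex fits at a level, or a vertex
can fill the place of A or B in a modulator class, depends on the guess and on adjacency to `R`
only. So vertices with the same neighbours in `R` are interchangeable, and all classes can choose
their levels independently. The colouring yields a matching of all nodes that have an edge
(`Guess.Mate`, `Guess.feasible`); by counting, any matching that saturates the left nodes with an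
edge saturates the right ones too (`Guess.full_right`). Any such matching gives independent classes
(`Guess.lab_independent`), at least `ℓ` of them (`Guess.le_card_labels`), and, ordered by level,
each class dominates the later ones (`Guess.lab_dominates`).

The program need not know this order. It repeatedly takes any class that dominates all uncoloured
vertices outside it; a remaining class that is first in the order always qualifies
(`Greedy.Orderable.exists_eligible`). Whatever this procedure colours completely is a Grundy
colouring, even for a wrong guess, so keeping the best complete result is sound, and the correct
guess makes it optimal (`process_spec`, `le_of_processed`).

The matching is found by an auction. As long as a left node is free it has a neighbour of price
below `N = 3 n` (`Auction.Inv.exists_cheap`), so prices stay at most `N` and `N ^ 2 + 1` bids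
suffice. A bid costs `O(N ^ 2)` steps, which gives `n ^ 4` for one guess; the choices of `v₀` and
`d` raise this to `n ^ 6`. The `2 ^ (6 r ^ 2)` bit patterns and the powers of `r + 1` are absorbed
by `2 ^ (O(r ^ 2))`.

To count steps on the machine, the program is written in a small language with bounded search and is
compiled (`Tm.comp_yields`, `Stmt.comp_simulates`). The exponent of `n` is computed from the syntax
(`Stmt.time_polyBound`), and truncation of assignments at `n ^ 8` makes the word bound a structural
fact too (`Stmt.run_below`). -/

namespace RAM

/-! ### A language of terms and statements on top of the machine -/

/-- The least `i < m` with `P i`, and `m` if there is none. -/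
noncomputable def least (m : ℕ) (P : ℕ → Prop) : ℕ := sInf {i | i = m ∨ (i < m ∧ P i)}

theorem least_mem (m : ℕ) (P : ℕ → Prop) : least m P = m ∨ (least m P < m ∧ P (least m P)) :=
  Nat.sInf_mem (s := {i | i = m ∨ (i < m ∧ P i)}) ⟨m, Or.inl rfl⟩

theorem least_le (m : ℕ) (P : ℕ → Prop) : least m P ≤ m := by
  rcases least_mem m P with h | h <;> omega

theorem least_le_of (m : ℕ) (P : ℕ → Prop) {i : ℕ} (hi : i < m) (h : P i) : least m P ≤ i :=
  Nat.sInf_le (Or.inr ⟨hi, h⟩)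

theorem least_spec {m : ℕ} {P : ℕ → Prop} (h : least m P < m) : P (least m P) := by
  rcases least_mem m P with h' | h'
  · omega
  · exact h'.2

theorem least_lt_iff {m : ℕ} {P : ℕ → Prop} : least m P < m ↔ ∃ i < m, P i :=
  ⟨fun h => ⟨_, h, least_spec h⟩, fun ⟨_, hi, h⟩ => (least_le_of m P hi h).trans_lt hi⟩

theorem least_eq_self_iff {m : ℕ} {P : ℕ → Prop} : least m P = m ↔ ∀ i < m, ¬ P i := by
  have h1 := least_le m P
  have h2 := @least_lt_iff m P
  constructor
  · intro h i hi hP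
    have := h2.2 ⟨i, hi, hP⟩
    omega
  · intro h
    by_contra h3
    obtain ⟨i, hi, hP⟩ := h2.1 (by omega)
    exact h i hi hP

theorem least_eq_of {m : ℕ} {P : ℕ → Prop} {i : ℕ} (hi : i < m) (h : P i) (h' : ∀ k < i, ¬ P k) :
    least m P = i := by
  have h1 := least_le_of m P hi h
  by_contra h2
  exact h' _ (by omega) (least_spec (m := m) (by omega))

/-- Terms: machine expressions with a bounded search operator. -/
inductive Tm
  | lit (k : ℕ)
  | var (x : ℕ)
  | get (a : ℕ) (i : Tm)
  | op (o : Op) (e₁ e₂ : Tm)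
  | find (x c : ℕ) (φ : Tm)

noncomputable def Tm.eval : Tm → State → ℕ
  | lit k, _ => k
  | var x, s => s.reg x
  | get a i, s => s.arr a (i.eval s)
  | op o e₁ e₂, s => o.eval (e₁.eval s) (e₂.eval s)
  | find x c φ, s => least (s.reg c) fun i => φ.eval (s.setReg x i) ≠ 0

/-- Every value in an evaluation of the term in a state with entries below `M` is below
`M ^ e.size`. -/
def Tm.size : Tm → ℕ
  | lit k => k + 1
  | var _ => 1
  | get _ i => i.size + 1
  | op _ e₁ e₂ => e₁.size + e₂.size
  | find _ _ φ => φ.size + 1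

/-- A strict upper bound for the variables of the term. -/
def Tm.names : Tm → ℕ
  | lit _ => 0
  | var x => x + 1
  | get _ i => i.names
  | op _ e₁ e₂ => max e₁.names e₂.names
  | find _ c φ => max (c + 1) φ.names

/-- Search bounds are taken from the variables in `Q`, and these are not bound. -/
def Tm.ok (Q : ℕ → Bool) : Tm → Bool
  | lit _ => true
  | var _ => true
  | get _ i => i.ok Q
  | op _ e₁ e₂ => e₁.ok Q && e₂.ok Q
  | find x c φ => Q c && !Q x && φ.ok Q

/-- A bound for the running time when `κ` bounds the search bounds. -/
def Tm.time (κ : ℕ → ℕ) : Tm → ℕ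
  | lit _ => 2
  | var _ => 2
  | get _ i => i.time κ + 3
  | op _ e₁ e₂ => e₁.time κ + e₂.time κ + 4
  | find _ c φ => κ c * (φ.time κ + 12) + 10

/-- The program that evaluates the term into the register `d`, with `d, d + 1, …` for scratch and
the variable `x` in the register `ρ x`. -/
def Tm.comp : Tm → (ℕ → ℕ) → ℕ → Prog
  | lit k, _, d => .set d (.lit k)
  | var x, ρ, d => .set d (.reg (ρ x))
  | get a i, ρ, d => .seq (i.comp ρ d) (.set d (.get a (.reg d)))
  | op o e₁ e₂, ρ, d =>
      .seq (e₁.comp ρ d) (.seq (e₂.comp ρ (d + 1)) (.set d (.op o (.reg d) (.reg (d + 1)))))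
  | find x c φ, ρ, d =>
      .seq (.set d (.lit 0)) (.seq (.set (d + 1) (.lit 0))
        (.loop (.op .lt (.reg (d + 1)) (.op .lt (.reg d) (.reg (ρ c))))
          (.seq (φ.comp (Function.update ρ x d) (d + 1))
            (.cond (.reg (d + 1)) .skip (.set d (.op .add (.reg d) (.lit 1)))))))

theorem setReg_reg (s : State) (x v y : ℕ) :
    (s.setReg x v).reg y = if y = x then v else s.reg y := by
  simp [State.setReg, Function.update_apply]

@[simp] theorem setReg_arr (s : State) (x v : ℕ) : (s.setReg x v).arr = s.arr := rfl

@[simp] theorem setArr_reg (s : State) (a i v : ℕ) : (s.setArr a i v).reg = s.reg := rfl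

theorem setArr_arr (s : State) (a i v b j : ℕ) :
    (s.setArr a i v).arr b j = if b = a ∧ j = i then v else s.arr b j := by
  by_cases h : b = a
  · subst h
    simp [State.setArr, Function.update_apply]
  · simp [State.setArr, h]

/-- All entries of the state are below `M`. -/
def State.Below (M : ℕ) (s : State) : Prop := (∀ x, s.reg x < M) ∧ ∀ a i, s.arr a i < M

theorem State.Below.setReg {M : ℕ} {s : State} (h : s.Below M) (x : ℕ) {v : ℕ} (hv : v < M) :
    (s.setReg x v).Below M := by
  refine ⟨fun y => ?_, h.2⟩
  rw [setReg_reg]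
  split_ifs
  · exact hv
  · exact h.1 y

theorem State.Below.setArr {M : ℕ} {s : State} (h : s.Below M) (a i : ℕ) {v : ℕ} (hv : v < M) :
    (s.setArr a i v).Below M := by
  refine ⟨h.1, fun b j => ?_⟩
  rw [setArr_arr]
  split_ifs
  · exact hv
  · exact h.2 b j

/-- Multiplication is the worst case and makes the exponents add. A sum is covered because both
bounds are at least `2`. -/
theorem Op.eval_lt {M a b m k : ℕ} (hM : 2 ≤ M) (ha : a < M ^ m) (hb : b < M ^ k) (o : Op)
    (hm : 0 < m) (hk : 0 < k) : o.eval a b < M ^ (m + k) := by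
  have h1 : M ^ (m + k) = M ^ m * M ^ k := pow_add _ _ _
  have hm1 : M ≤ M ^ m := Nat.le_self_pow hm.ne' M
  have hk1 : M ≤ M ^ k := Nat.le_self_pow hk.ne' M
  rw [h1]
  generalize M ^ m = X at *
  generalize M ^ k = Y at *
  have hX : X ≤ X * Y := Nat.le_mul_of_pos_right _ (by omega)
  have h2 : 2 ≤ X := by omega
  cases o
  · simp only [Op.eval]; nlinarith
  · simp only [Op.eval]; omega
  · simp only [Op.eval]; exact Nat.mul_lt_mul'' ha hb
  · simp only [Op.eval]; exact (Nat.div_le_self a b).trans_lt (by omega)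
  · simp only [Op.eval]; split_ifs <;> omega
  · simp only [Op.eval]; split_ifs <;> omega

theorem Tm.size_pos (e : Tm) : 0 < e.size := by
  induction e <;> simp only [Tm.size] <;> omega

theorem Tm.eval_lt {M : ℕ} (hM : 2 ≤ M) (e : Tm) :
    ∀ s : State, s.Below M → e.eval s < M ^ e.size := by
  induction e with
  | lit k =>
      intro s _
      simp only [Tm.eval, Tm.size]
      calc k < 2 ^ (k + 1) := by
            have := Nat.lt_two_pow_self (n := k)
            rw [pow_succ]; omega
        _ ≤ M ^ (k + 1) := Nat.pow_le_pow_left hM _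
  | var x => intro s h; simpa [Tm.eval, Tm.size] using h.1 x
  | get a i ih =>
      intro s h
      exact (h.2 _ _).trans_le (Nat.le_self_pow (by simp [Tm.size]) M)
  | op o e₁ e₂ ih₁ ih₂ =>
      intro s h
      exact Op.eval_lt hM (ih₁ s h) (ih₂ s h) o e₁.size_pos e₂.size_pos
  | find x c φ ih =>
      intro s h
      exact (least_le _ _).trans_lt ((h.1 c).trans_le (Nat.le_self_pow (by simp [Tm.size]) M))

/-- The machine state `s` represents the state `σ`, with the variables below `K` in the registers
below `d` given by `ρ`. -/
structure Repr (K : ℕ) (ρ : ℕ → ℕ) (d : ℕ) (s σ : State) : Prop where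
  lt : ∀ x < K, ρ x < d
  reg : ∀ x < K, s.reg (ρ x) = σ.reg x
  arr : s.arr = σ.arr

theorem Repr.congr {K : ℕ} {ρ : ℕ → ℕ} {d : ℕ} {s σ s' : State} (h : Repr K ρ d s σ)
    (h1 : ∀ y < d, s'.reg y = s.reg y) (h2 : s'.arr = s.arr) {d' : ℕ} (hd : d ≤ d') :
    Repr K ρ d' s' σ :=
  ⟨fun x hx => (h.lt x hx).trans_le hd, fun x hx => by rw [h1 _ (h.lt x hx), h.reg x hx],
    by rw [h2, h.arr]⟩

/-- The search counter already sits in the register `d`, so binding a variable to it changes the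
renaming and not the machine state. -/
theorem Repr.bind {K : ℕ} {ρ : ℕ → ℕ} {d : ℕ} {s σ : State} (h : Repr K ρ d s σ) {i : ℕ} (x : ℕ)
    (hi : s.reg d = i) : Repr K (Function.update ρ x d) (d + 1) s (σ.setReg x i) := by
  refine ⟨fun y hy => ?_, fun y hy => ?_, h.arr⟩
  · have := h.lt y hy
    rw [Function.update_apply]
    split_ifs <;> omega
  · rw [Function.update_apply, setReg_reg]
    split_ifs with hxy
    · exact hi
    · exact h.reg y hy

/-- The program `p` evaluates to `v` in the register `d` within `t` steps. -/
def Yields (B : ℕ) (p : Prog) (s : State) (d v t : ℕ) : Prop :=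
  ∃ t' s', Exec B p s t' s' ∧ t' ≤ t ∧ s'.reg d = v ∧ (∀ y < d, s'.reg y = s.reg y) ∧
    s'.arr = s.arr

theorem yields_set {B : ℕ} {s : State} {d v : ℕ} {e : Expr} (he : e.Fits B s)
    (hv : e.eval s = v) : Yields B (.set d e) s d v (e.cost + 1) :=
  ⟨_, _, Exec.set s d e he, le_rfl, by simp [setReg_reg, hv],
    fun y hy => by rw [setReg_reg, if_neg (by omega)], rfl⟩

/-- The test compares the flag in `d + 1` with the truth value of `counter < bound`. It succeeds
exactly while the counter is in range and the flag, which is the last value of the body, is `0`. The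
number `k` counts the candidates left. -/
theorem Tm.find_loop {B K M : ℕ} {ρ : ℕ → ℕ} {d c τ m : ℕ} {body : Prog} {σ : State} {P : ℕ → Prop}
    (hc : c < K) (hm : σ.reg c = m) (hmM : m < M) (hB : M ≤ B) (hM : 2 ≤ M)
    (hbody : ∀ i < m, ∀ s, Repr K ρ d s σ → s.reg d = i → ∃ v, v < B ∧ (v ≠ 0 ↔ P i) ∧
      Yields B body s (d + 1) v τ) (k : ℕ) :
    ∀ i, i + k = m → (∀ i' < i, ¬ P i') → ∀ s, Repr K ρ d s σ → s.reg d = i → s.reg (d + 1) = 0 →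
      ∃ t s', Exec B (.loop (.op .lt (.reg (d + 1)) (.op .lt (.reg d) (.reg (ρ c))))
          (.seq body (.cond (.reg (d + 1)) .skip (.set d (.op .add (.reg d) (.lit 1)))))) s t s' ∧
        t ≤ k * (τ + 12) + 6 ∧ s'.reg d = least m P ∧ (∀ y < d, s'.reg y = s.reg y) ∧
        s'.arr = s.arr := by
  induction k with
  | zero =>
      intro i hi hP s hs hd hd1
      have hc' : s.reg (ρ c) = m := by rw [hs.reg c hc, hm]
      refine ⟨_, s, Exec.loop_false _ _ _ ?_ ?_, ?_, ?_, fun _ _ => rfl, rfl⟩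
      · simp only [Expr.Fits, Expr.eval, Op.eval, hd, hd1, hc']
        refine ⟨by omega, ⟨by omega, by omega, ?_⟩, ?_⟩ <;> split_ifs <;> omega
      · simp [Expr.eval, Op.eval, hd, hd1, hc']; omega
      · simp [Expr.cost]
      · have := (least_eq_self_iff (m := m)).2 fun j hj => hP j (by omega)
        omega
  | succ k ih =>
      intro i hi hP s hs hd hd1
      have hc' : s.reg (ρ c) = m := by rw [hs.reg c hc, hm]
      have hfits : (Expr.op .lt (.reg (d + 1)) (.op .lt (.reg d) (.reg (ρ c)))).Fits B s := by
        simp only [Expr.Fits, Expr.eval, Op.eval, hd, hd1, hc']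
        refine ⟨by omega, ⟨by omega, by omega, ?_⟩, ?_⟩ <;> split_ifs <;> omega
      have htest : (Expr.op .lt (.reg (d + 1)) (.op .lt (.reg d) (.reg (ρ c)))).eval s ≠ 0 := by
        simp [Expr.eval, Op.eval, hd, hd1, hc']; omega
      obtain ⟨v, hvB, hv, t1, s1, he1, ht1, hr1, hf1, ha1⟩ := hbody i (by omega) s hs hd
      have hd' : s1.reg d = i := by rw [hf1 d (by omega), hd]
      by_cases hPi : P i
      · have hv0 : v ≠ 0 := hv.2 hPi
        have e2 : Exec B (.cond (.reg (d + 1)) .skip (.set d (.op .add (.reg d) (.lit 1)))) s1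
            _ s1 :=
          Exec.cond_true _ _ _ _ _ _ (by simp [Expr.Fits, hr1, hvB])
            (by simpa [Expr.eval, hr1] using hv0) (Exec.skip s1)
        have hc1 : s1.reg (ρ c) = m := by rw [hf1 _ ((hs.lt c hc).trans (by omega)), hc']
        have e3 : Exec B (.loop (.op .lt (.reg (d + 1)) (.op .lt (.reg d) (.reg (ρ c))))
          (.seq body (.cond (.reg (d + 1)) .skip (.set d (.op .add (.reg d) (.lit 1)))))) s1 6 s1 := by
          refine Exec.loop_false _ _ _ ?_ ?_
          · simp only [Expr.Fits, Expr.eval, Op.eval, hr1, hd', hc1]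
            refine ⟨by omega, ⟨by omega, by omega, ?_⟩, ?_⟩ <;> split_ifs <;> omega
          · simp only [Expr.eval, Op.eval, hr1, hd', hc1]
            split_ifs <;> omega
        refine ⟨_, s1, Exec.loop_true _ _ _ _ _ _ _ hfits htest (Exec.seq _ _ _ _ _ _ _ he1 e2) e3,
          ?_, ?_, fun y hy => hf1 y (by omega), ha1⟩
        · simp only [Expr.cost]; nlinarith
        · rw [hd', least_eq_of (by omega) hPi hP]
      · have hv0 : v = 0 := by
          by_contra h; exact hPi (hv.1 h)
        have e2 : Exec B (.cond (.reg (d + 1)) .skip (.set d (.op .add (.reg d) (.lit 1)))) s1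
            6 (s1.setReg d (i + 1)) := by
          refine Exec.cond_false (.reg (d + 1)) _ _ _ _ 4 (by simp [Expr.Fits, hr1, hvB])
            (by simpa [Expr.eval, hr1] using hv0) ?_
          have := Exec.set (B := B) s1 d (.op .add (.reg d) (.lit 1))
            (by simp only [Expr.Fits, Expr.eval, Op.eval, hd']; omega)
          simpa [Expr.eval, Op.eval, hd', Expr.cost] using this
        obtain ⟨t3, s3, e3, ht3, hr3, hf3, ha3⟩ := ih (i + 1) (by omega)
          (fun i' hi' => by
            rcases Nat.lt_succ_iff_lt_or_eq.1 hi' with h | h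
            · exact hP i' h
            · rwa [h]) (s1.setReg d (i + 1))
          (hs.congr (s' := s1.setReg d (i + 1))
            (fun y hy => by rw [setReg_reg, if_neg (by omega), hf1 y (by omega)]) ha1 le_rfl)
          (by simp [setReg_reg]) (by rw [setReg_reg, if_neg (by omega), hr1, hv0])
        refine ⟨_, s3, Exec.loop_true _ _ _ _ _ _ _ hfits htest (Exec.seq _ _ _ _ _ _ _ he1 e2) e3,
          ?_, hr3, fun y hy => ?_, ?_⟩
        · simp only [Expr.cost]; nlinarith
        · rw [hf3 y hy, setReg_reg, if_neg (by omega), hf1 y (by omega)]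
        · rw [ha3]; exact ha1

/-- Sizes of subterms are at most the size of the term, so a single bound on `M ^ e.size` makes all
intermediate values fit. The renaming and the machine state vary in the induction, because a search
evaluates its body with one more variable in a scratch register. -/
theorem Tm.comp_yields {B K M : ℕ} (hM : 2 ≤ M) {Q : ℕ → Bool} {κ : ℕ → ℕ} (e : Tm) :
    ∀ (ρ : ℕ → ℕ) (d : ℕ) (s σ : State), Repr K ρ d s σ → σ.Below M → e.names ≤ K →
      M ^ e.size ≤ B → e.ok Q = true → (∀ c, Q c = true → σ.reg c ≤ κ c) →
      Yields B (e.comp ρ d) s d (e.eval σ) (e.time κ) := by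
  induction e with
  | lit k =>
      intro ρ d s σ hs hσ hK hB _ _
      exact yields_set (((Tm.lit k).eval_lt hM σ hσ).trans_le hB) rfl
  | var x =>
      intro ρ d s σ hs hσ hK hB _ _
      have hx := hs.reg x hK
      exact yields_set (by
        have := ((Tm.var x).eval_lt hM σ hσ).trans_le hB
        simpa [Expr.Fits, hx, Tm.eval] using this) hx
  | get a i ih =>
      intro ρ d s σ hs hσ hK hB hQ hκ
      have hle : M ^ i.size ≤ B := (Nat.pow_le_pow_right (by omega) (by simp [Tm.size])).trans hB
      obtain ⟨t1, s1, e1, ht1, hr1, hf1, ha1⟩ := ih ρ d s σ hs hσ hK hle hQ hκ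
      obtain ⟨t2, s2, e2, ht2, hr2, hf2, ha2⟩ :
          Yields B (.set d (.get a (.reg d))) s1 d ((Tm.get a i).eval σ) 3 := by
        refine yields_set (e := .get a (.reg d)) ?_ ?_
        · simp only [Expr.Fits, Expr.eval, hr1, ha1, hs.arr]
          exact ⟨(i.eval_lt hM σ hσ).trans_le hle, ((Tm.get a i).eval_lt hM σ hσ).trans_le hB⟩
        · simp only [Expr.eval, hr1, ha1, hs.arr, Tm.eval]
      exact ⟨_, s2, Exec.seq _ _ _ _ _ _ _ e1 e2, by simp only [Tm.time]; omega, hr2,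
        fun y hy => by rw [hf2 y hy, hf1 y hy], by rw [ha2, ha1]⟩
  | op o e₁ e₂ ih₁ ih₂ =>
      intro ρ d s σ hs hσ hK hB hQ hκ
      simp only [Tm.ok, Bool.and_eq_true] at hQ
      simp only [Tm.names, max_le_iff] at hK
      have hle1 : M ^ e₁.size ≤ B := (Nat.pow_le_pow_right (by omega) (by simp [Tm.size])).trans hB
      have hle2 : M ^ e₂.size ≤ B := (Nat.pow_le_pow_right (by omega) (by simp [Tm.size])).trans hB
      obtain ⟨t1, s1, x1, ht1, hr1, hf1, ha1⟩ := ih₁ ρ d s σ hs hσ hK.1 hle1 hQ.1 hκ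
      obtain ⟨t2, s2, x2, ht2, hr2, hf2, ha2⟩ :=
        ih₂ ρ (d + 1) s1 σ (hs.congr hf1 ha1 (by omega)) hσ hK.2 hle2 hQ.2 hκ
      have hr1' : s2.reg d = e₁.eval σ := by rw [hf2 d (by omega), hr1]
      obtain ⟨t3, s3, x3, ht3, hr3, hf3, ha3⟩ :
          Yields B (.set d (.op o (.reg d) (.reg (d + 1)))) s2 d ((Tm.op o e₁ e₂).eval σ) 4 := by
        refine yields_set (e := .op o (.reg d) (.reg (d + 1))) ?_ ?_
        · simp only [Expr.Fits, Expr.eval, hr1', hr2]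
          exact ⟨(e₁.eval_lt hM σ hσ).trans_le hle1, (e₂.eval_lt hM σ hσ).trans_le hle2,
            ((Tm.op o e₁ e₂).eval_lt hM σ hσ).trans_le hB⟩
        · simp only [Expr.eval, hr1', hr2, Tm.eval]
      exact ⟨_, s3, Exec.seq _ _ _ _ _ _ _ x1 (Exec.seq _ _ _ _ _ _ _ x2 x3),
        by simp only [Tm.time]; omega, hr3,
        fun y hy => by rw [hf3 y hy, hf2 y (by omega), hf1 y hy], by rw [ha3, ha2, ha1]⟩
  | find x c φ ih =>
      intro ρ d s σ hs hσ hK hB hQ hκ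
      simp only [Tm.ok, Bool.and_eq_true, Bool.not_eq_true'] at hQ
      simp only [Tm.names, max_le_iff] at hK
      have hle : M ^ φ.size ≤ B := (Nat.pow_le_pow_right (by omega) (by simp [Tm.size])).trans hB
      have hMB : M ≤ B := (Nat.le_self_pow (by simp [Tm.size]) M).trans hB
      obtain ⟨t1, s1, x1, ht1, hr1, hf1, ha1⟩ :=
        yields_set (B := B) (s := s) (d := d) (e := .lit 0) (v := 0) (by simp [Expr.Fits]; omega) rfl
      obtain ⟨t2, s2, x2, ht2, hr2, hf2, ha2⟩ :=
        yields_set (B := B) (s := s1) (d := d + 1) (e := .lit 0) (v := 0)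
          (by simp [Expr.Fits]; omega) rfl
      have hd : s2.reg d = 0 := by rw [hf2 d (by omega), hr1]
      obtain ⟨t3, s3, x3, ht3, hr3, hf3, ha3⟩ := Tm.find_loop (B := B) (K := K) (M := M) (ρ := ρ)
        (d := d) (c := c) (τ := φ.time κ) (σ := σ)
        (body := φ.comp (Function.update ρ x d) (d + 1))
        (P := fun i => φ.eval (σ.setReg x i) ≠ 0)
        hK.1 rfl (hσ.1 c) hMB hM (by
          intro i hi s' hs' hsi
          have hσ' : (σ.setReg x i).Below M := hσ.setReg x (hi.trans (hσ.1 c))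
          refine ⟨φ.eval (σ.setReg x i), (φ.eval_lt hM _ hσ').trans_le hle, Iff.rfl, ?_⟩
          refine ih _ _ _ _ (hs'.bind x hsi) hσ' hK.2 hle hQ.2 ?_
          intro c' hc'
          rw [setReg_reg, if_neg]
          · exact hκ c' hc'
          · rintro rfl
            rw [hQ.1.2] at hc'
            exact Bool.false_ne_true hc')
        (σ.reg c) 0 (by omega) (by simp) s2
        ((hs.congr hf1 ha1 le_rfl).congr (fun y hy => hf2 y (by omega)) ha2 le_rfl) hd hr2
      refine ⟨_, s3, Exec.seq _ _ _ _ _ _ _ x1 (Exec.seq _ _ _ _ _ _ _ x2 x3), ?_, hr3,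
        fun y hy => by rw [hf3 y hy, hf2 y (by omega), hf1 y hy], by rw [ha3, ha2, ha1]⟩
      have := Nat.mul_le_mul_right (φ.time κ + 12) (hκ c hQ.1.1)
      simp only [Tm.time, Expr.cost] at *
      omega

end RAM

/-! ### Statements with guarded assignments and their compilation -/

namespace RAM

/-- Assignments are guarded: values that are not below `n ^ 8` are replaced by `0`. -/
def clamp (n v : ℕ) : ℕ := if v < n ^ 8 then v else 0

theorem clamp_of_lt {n v : ℕ} (h : v < n ^ 8) : clamp n v = v := if_pos h

theorem clamp_lt {n : ℕ} (hn : 2 ≤ n) (v : ℕ) : clamp n v < n ^ 8 := by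
  unfold clamp
  split_ifs with h
  · exact h
  · positivity

/-- Statements; `loop x c p` runs `p` for `x = 0, …, m - 1`, where `m` is the value of `c`. -/
inductive Stmt
  | set (x : ℕ) (e : Tm)
  | put (a : ℕ) (i e : Tm)
  | seq (p q : Stmt)
  | ite (b : Tm) (p q : Stmt)
  | loop (x c : ℕ) (p : Stmt)

/-- `f (m - 1)` after … after `f 0`. -/
def iter {α : Type*} (f : ℕ → α → α) : ℕ → α → α
  | 0, s => s
  | k + 1, s => f k (iter f k s)

noncomputable def Stmt.run : Stmt → State → State
  | set x e, σ => σ.setReg x (clamp (σ.reg 0) (e.eval σ))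
  | put a i e, σ => σ.setArr a (i.eval σ) (clamp (σ.reg 0) (e.eval σ))
  | seq p q, σ => q.run (p.run σ)
  | ite b p q, σ => open Classical in if b.eval σ ≠ 0 then p.run σ else q.run σ
  | loop x c p, σ => iter (fun k τ => p.run (τ.setReg x k)) (σ.reg c) σ

def Stmt.size : Stmt → ℕ
  | set _ e => e.size + 2
  | put _ i e => i.size + e.size + 2
  | seq p q => p.size + q.size
  | ite b p q => b.size + p.size + q.size
  | loop _ _ p => p.size + 2

def Stmt.names : Stmt → ℕ
  | set x e => max (x + 1) e.names
  | put _ i e => max i.names e.names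
  | seq p q => max p.names q.names
  | ite b p q => max b.names (max p.names q.names)
  | loop x c p => max (max (x + 1) (c + 1)) p.names

/-- Loop and search bounds are taken from the variables in `Q`, and these are not assigned. -/
def Stmt.ok (Q : ℕ → Bool) : Stmt → Bool
  | set x e => !Q x && e.ok Q
  | put _ i e => i.ok Q && e.ok Q
  | seq p q => p.ok Q && q.ok Q
  | ite b p q => b.ok Q && p.ok Q && q.ok Q
  | loop x c p => Q c && !Q x && p.ok Q

def Stmt.time (κ : ℕ → ℕ) : Stmt → ℕ
  | set _ e => e.time κ + 20
  | put _ i e => i.time κ + e.time κ + 21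
  | seq p q => p.time κ + q.time κ
  | ite b p q => b.time κ + p.time κ + q.time κ + 2
  | loop _ c p => κ c * (p.time κ + 10) + 6

/-- The eighth power of the register `0`. -/
def eighth : Expr :=
  let e₂ := Expr.op .mul (.reg 0) (.reg 0)
  let e₄ := Expr.op .mul e₂ e₂
  .op .mul e₄ e₄

def Stmt.comp : Stmt → ℕ → Prog
  | set x e, d => .seq (e.comp id d)
      (.cond (.op .lt (.reg d) eighth) (.set x (.reg d)) (.set x (.lit 0)))
  | put a i e, d => .seq (i.comp id d) (.seq (e.comp id (d + 1))
      (.cond (.op .lt (.reg (d + 1)) eighth) (.put a (.reg d) (.reg (d + 1)))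
        (.put a (.reg d) (.lit 0))))
  | seq p q, d => .seq (p.comp d) (q.comp d)
  | ite b p q, d => .seq (b.comp id d) (.cond (.reg d) (p.comp d) (q.comp d))
  | loop x c p, d => .seq (.set d (.lit 0)) (.loop (.op .lt (.reg d) (.reg c))
      (.seq (.set x (.reg d)) (.seq (p.comp (d + 1)) (.set d (.op .add (.reg d) (.lit 1))))))

theorem Stmt.run_const {Q : ℕ → Bool} (p : Stmt) :
    ∀ σ, p.ok Q = true → ∀ c, Q c = true → (p.run σ).reg c = σ.reg c := by
  have key : ∀ {x c : ℕ}, Q x = false → Q c = true → c ≠ x := by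
    rintro x c hx hc rfl
    exact Bool.false_ne_true (hx.symm.trans hc)
  induction p with
  | set x e =>
      intro σ h c hc
      simp only [Stmt.ok, Bool.and_eq_true, Bool.not_eq_true'] at h
      rw [Stmt.run, setReg_reg, if_neg (key h.1 hc)]
  | put a i e => intro σ h c hc; rfl
  | seq p q ihp ihq =>
      intro σ h c hc
      simp only [Stmt.ok, Bool.and_eq_true] at h
      rw [Stmt.run, ihq _ h.2 c hc, ihp _ h.1 c hc]
  | ite b p q ihp ihq =>
      intro σ h c hc
      simp only [Stmt.ok, Bool.and_eq_true] at h
      rw [Stmt.run]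
      split_ifs
      · exact ihp _ h.1.2 c hc
      · exact ihq _ h.2 c hc
  | loop x c' p ih =>
      intro σ h c hc
      simp only [Stmt.ok, Bool.and_eq_true, Bool.not_eq_true'] at h
      rw [Stmt.run]
      generalize σ.reg c' = m
      induction m with
      | zero => rfl
      | succ m ihm => rw [iter, ih _ h.2 c hc, setReg_reg, if_neg (key h.1.2 hc), ihm]

/-- The guard in the assignments suffices, and a loop counter is below its bound, which is itself an
entry of the state. So the word bound needs no knowledge of what the program computes. -/
theorem Stmt.run_below {Q : ℕ → Bool} {n : ℕ} (hn : 2 ≤ n) (hQ : Q 0 = true) (p : Stmt) :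
    ∀ σ, p.ok Q = true → σ.reg 0 = n → σ.Below (n ^ 8) → (p.run σ).Below (n ^ 8) := by
  induction p with
  | set x e => intro σ h h0 hσ; exact hσ.setReg x (by rw [h0]; exact clamp_lt hn _)
  | put a i e => intro σ h h0 hσ; exact hσ.setArr a _ (by rw [h0]; exact clamp_lt hn _)
  | seq p q ihp ihq =>
      intro σ h h0 hσ
      simp only [Stmt.ok, Bool.and_eq_true] at h
      exact ihq _ h.2 (by rw [p.run_const σ h.1 0 hQ, h0]) (ihp _ h.1 h0 hσ)
  | ite b p q ihp ihq =>
      intro σ h h0 hσ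
      simp only [Stmt.ok, Bool.and_eq_true] at h
      rw [Stmt.run]
      split_ifs
      · exact ihp _ h.1.2 h0 hσ
      · exact ihq _ h.2 h0 hσ
  | loop x c p ih =>
      intro σ h h0 hσ
      simp only [Stmt.ok, Bool.and_eq_true, Bool.not_eq_true'] at h
      rw [Stmt.run]
      have hx : 0 ≠ x := by
        rintro rfl
        exact Bool.false_ne_true (h.1.2.symm.trans hQ)
      have aux : ∀ m, m ≤ σ.reg c →
          (iter (fun k τ => p.run (τ.setReg x k)) m σ).reg 0 = n ∧
          (iter (fun k τ => p.run (τ.setReg x k)) m σ).Below (n ^ 8) := by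
        intro m
        induction m with
        | zero => exact fun _ => ⟨h0, hσ⟩
        | succ m ihm =>
            intro hm
            obtain ⟨h1, h2⟩ := ihm (by omega)
            have h3 : ((iter (fun k τ => p.run (τ.setReg x k)) m σ).setReg x m).reg 0 = n := by
              rw [setReg_reg, if_neg hx, h1]
            refine ⟨?_, ih _ h.2 h3 (h2.setReg x (lt_trans hm (hσ.1 c)))⟩
            rw [iter, p.run_const _ h.2 0 hQ, h3]
      exact (aux _ le_rfl).2

theorem eighth_eval (s : State) : eighth.eval s = s.reg 0 ^ 8 := by
  simp only [eighth, Expr.eval, Op.eval]; ring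

theorem eighth_fits {B n : ℕ} {s : State} (hn : 2 ≤ n) (h0 : s.reg 0 = n) (hB : n ^ 8 < B) :
    eighth.Fits B s := by
  have h1 : n ≤ n ^ 8 := Nat.le_self_pow (by norm_num) n
  have h2 : n * n ≤ n ^ 8 := by
    calc n * n = n ^ 2 := by ring
      _ ≤ n ^ 8 := Nat.pow_le_pow_right (by omega) (by norm_num)
  have h4 : n * n * (n * n) ≤ n ^ 8 := by
    calc n * n * (n * n) = n ^ 4 := by ring
      _ ≤ n ^ 8 := Nat.pow_le_pow_right (by omega) (by norm_num)
  have h8 : n * n * (n * n) * (n * n * (n * n)) = n ^ 8 := by ring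
  simp only [eighth, Expr.Fits, Expr.eval, Op.eval, h0]
  refine ⟨⟨⟨?_, ?_, ?_⟩, ⟨?_, ?_, ?_⟩, ?_⟩, ⟨⟨?_, ?_, ?_⟩, ⟨?_, ?_, ?_⟩, ?_⟩, ?_⟩ <;> omega

theorem Repr.setReg {K d : ℕ} {s σ : State} (h : Repr K id d s σ) (x v : ℕ) :
    Repr K id d (s.setReg x v) (σ.setReg x v) :=
  ⟨h.lt, fun y hy => by
    have := h.reg y hy
    simp only [id] at this ⊢
    rw [setReg_reg, setReg_reg, this], h.arr⟩

theorem Repr.setArr {K d : ℕ} {s σ : State} (h : Repr K id d s σ) (a i v : ℕ) :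
    Repr K id d (s.setArr a i v) (σ.setArr a i v) :=
  ⟨h.lt, h.reg, by simp only [State.setArr, h.arr]⟩

/-- The program simulates a transition from `σ` to `σ'` within `t` steps, and does not change the
registers from `K` on that are below `d`. -/
def Simulates (B K : ℕ) (p : Prog) (d : ℕ) (s σ' : State) (t : ℕ) : Prop :=
  ∃ t' s', Exec B p s t' s' ∧ t' ≤ t ∧ Repr K id d s' σ' ∧ ∀ y, K ≤ y → y < d → s'.reg y = s.reg y

/-- The counter lives in the scratch register `d` and is copied to `x` in each round, so the body
may even overwrite `x`. -/
theorem Stmt.iter_loop {B K M d x c m τ : ℕ} {p : Stmt} {σ : State} (hd : K ≤ d) (hx : x < K)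
    (hc : c < K) (hcm : σ.reg c = m) (hm : m < M) (hMB : M ≤ B) (hM : 2 ≤ M)
    (hcon : ∀ k ≤ m, (iter (fun k τ => p.run (τ.setReg x k)) k σ).reg c = m)
    (hbody : ∀ k < m, ∀ s,
      Repr K id (d + 1) s ((iter (fun k τ => p.run (τ.setReg x k)) k σ).setReg x k) →
      Simulates B K (p.comp (d + 1)) (d + 1) s
        (iter (fun k τ => p.run (τ.setReg x k)) (k + 1) σ) τ) (j : ℕ) :
    ∀ k, k + j = m → ∀ s, s.reg d = k →
      Repr K id d s (iter (fun k τ => p.run (τ.setReg x k)) k σ) →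
      Simulates B K (.loop (.op .lt (.reg d) (.reg c)) (.seq (.set x (.reg d))
        (.seq (p.comp (d + 1)) (.set d (.op .add (.reg d) (.lit 1)))))) d s
        (iter (fun k τ => p.run (τ.setReg x k)) m σ) (j * (τ + 10) + 4) := by
  induction j with
  | zero =>
      intro k hk s hsd hs
      have hk' : k = m := by omega
      subst hk'
      have hcs : s.reg c = k := (hs.reg c hc).trans (hcon k le_rfl)
      refine ⟨_, s, Exec.loop_false _ _ _ ?_ ?_, ?_, hs, fun _ _ _ => rfl⟩
      · simp only [Expr.Fits, Expr.eval, Op.eval, hcs, hsd]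
        refine ⟨by omega, by omega, ?_⟩
        split_ifs <;> omega
      · simp [Expr.eval, Op.eval, hsd, hcs]
      · simp [Expr.cost]
  | succ j ih =>
      intro k hk s hsd hs
      have hcs : s.reg c = m := (hs.reg c hc).trans (hcon k (by omega))
      have hfit : (Expr.op .lt (.reg d) (.reg c)).Fits B s := by
        simp only [Expr.Fits, Expr.eval, Op.eval, hcs, hsd]
        refine ⟨by omega, by omega, ?_⟩
        split_ifs <;> omega
      have htest : (Expr.op .lt (.reg d) (.reg c)).eval s ≠ 0 := by
        simp [Expr.eval, Op.eval, hsd, hcs]; omega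
      have e1 : Exec B (.set x (.reg d)) s 2 (s.setReg x k) := by
        have := Exec.set (B := B) s x (.reg d) (by simp only [Expr.Fits, hsd]; omega)
        simpa [Expr.eval, Expr.cost, hsd] using this
      have hs1 := hs.setReg x k
      obtain ⟨t2, s2, e2, ht2, hs2, hf2⟩ := hbody k (by omega) (s.setReg x k)
        (hs1.congr (fun _ _ => rfl) rfl (by omega))
      have hd2 : s2.reg d = k := by
        rw [hf2 d hd (by omega), setReg_reg, if_neg (by omega), hsd]
      have e3 : Exec B (.set d (.op .add (.reg d) (.lit 1))) s2 4 (s2.setReg d (k + 1)) := by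
        have := Exec.set (B := B) s2 d (.op .add (.reg d) (.lit 1))
          (by simp only [Expr.Fits, Expr.eval, Op.eval, hd2]; omega)
        simpa [Expr.eval, Expr.cost, Op.eval, hd2] using this
      have hs3 : Repr K id d (s2.setReg d (k + 1))
          (iter (fun k τ => p.run (τ.setReg x k)) (k + 1) σ) :=
        ⟨fun y hy => hs.lt y hy, fun y hy => by
          have := hs2.reg y hy
          simp only [id] at this ⊢
          rw [setReg_reg, if_neg (by omega), this], hs2.arr⟩
      obtain ⟨t4, s4, e4, ht4, hs4, hf4⟩ := ih (k + 1) (by omega) (s2.setReg d (k + 1))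
        (by simp [setReg_reg]) hs3
      refine ⟨_, s4, Exec.loop_true _ _ _ _ _ _ _ hfit htest
        (Exec.seq _ _ _ _ _ _ _ e1 (Exec.seq _ _ _ _ _ _ _ e2 e3)) e4, ?_, hs4, fun y hy hy' => ?_⟩
      · simp only [Expr.cost]; nlinarith
      · rw [hf4 y hy hy', setReg_reg, if_neg (by omega), hf2 y hy (by omega), setReg_reg,
          if_neg (by omega)]

/-- Registers in `Q` are never assigned, so the bounds `κ` on loop lengths stay valid throughout the
run and the time bound depends on the syntax and `κ` only. -/
theorem Stmt.comp_simulates {B K n : ℕ} (hn : 2 ≤ n) {Q : ℕ → Bool} (hQ0 : Q 0 = true)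
    {κ : ℕ → ℕ} (hK : 0 < K) (p : Stmt) :
    ∀ (d : ℕ) (s σ : State), K ≤ d → Repr K id d s σ → σ.reg 0 = n → σ.Below (n ^ 8) →
      p.names ≤ K → (n ^ 8) ^ p.size ≤ B → p.ok Q = true → (∀ c, Q c = true → σ.reg c ≤ κ c) →
      Simulates B K (p.comp d) d s (p.run σ) (p.time κ) := by
  have hM : 2 ≤ n ^ 8 := hn.trans (Nat.le_self_pow (by norm_num) n)
  -- Strictness is needed because the guard computes `n ^ 8` itself as a word. The summand `2` in
  -- the sizes of assignments provides it.
  have hMlt : ∀ {m}, 3 ≤ m → (n ^ 8) ^ m ≤ B → n ^ 8 < B := fun {m} hm hB =>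
    (lt_self_pow₀ (by omega) (by omega : 1 < m)).trans_le hB
  have hMle : ∀ {m k}, m ≤ k → (n ^ 8) ^ k ≤ B → (n ^ 8) ^ m ≤ B := fun hm hB =>
    (Nat.pow_le_pow_right (by omega) hm).trans hB
  induction p with
  | set x e =>
      intro d s σ hd hs h0 hσ hN hB hQ hκ
      simp only [Stmt.names, max_le_iff] at hN
      simp only [Stmt.ok, Bool.and_eq_true] at hQ
      have hB8 : n ^ 8 < B := hMlt (by have := e.size_pos; simp only [Stmt.size]; omega) hB
      have hBe : (n ^ 8) ^ e.size ≤ B := hMle (by simp [Stmt.size]) hB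
      obtain ⟨t1, s1, e1, ht1, hr1, hf1, ha1⟩ :=
        e.comp_yields (B := B) (κ := κ) hM id d s σ hs hσ hN.2 hBe hQ.2 hκ
      have hs1 : Repr K id d s1 σ := hs.congr hf1 ha1 le_rfl
      have h01 : s1.reg 0 = n := (hs1.reg 0 hK).trans h0
      have hv : e.eval σ < B := (e.eval_lt hM σ hσ).trans_le hBe
      have hfit : (Expr.op .lt (.reg d) eighth).Fits B s1 := by
        refine ⟨by simpa [Expr.Fits, hr1] using hv, eighth_fits hn h01 hB8, ?_⟩
        simp only [Op.eval]
        split_ifs <;> omega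
      have hev : (Expr.op .lt (.reg d) eighth).eval s1 = if e.eval σ < n ^ 8 then 1 else 0 := by
        simp only [Expr.eval, eighth_eval, Op.eval, hr1, h01]
      have hfin : ∀ w, Repr K id d (s1.setReg x w) (σ.setReg x w) := fun w => hs1.setReg x w
      have hfr : ∀ w y, K ≤ y → y < d → (s1.setReg x w).reg y = s.reg y := fun w y hy hy' => by
        rw [setReg_reg, if_neg (by omega), hf1 y hy']
      by_cases hlt : e.eval σ < n ^ 8
      · have e2 : Exec B (.set x (.reg d)) s1 2 (s1.setReg x (e.eval σ)) := by
          have := Exec.set (B := B) s1 x (.reg d) (by simpa [Expr.Fits, hr1] using hv)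
          simpa [Expr.eval, Expr.cost, hr1] using this
        refine ⟨_, _, Exec.seq _ _ _ _ _ _ _ e1 (Exec.cond_true _ _ _ _ _ _ hfit
          (by rw [hev, if_pos hlt]; exact one_ne_zero) e2), ?_, ?_, hfr _⟩
        · simp only [Stmt.time, Expr.cost, eighth]; omega
        · rw [Stmt.run, h0, clamp_of_lt hlt]; exact hfin _
      · have e2 : Exec B (.set x (.lit 0)) s1 2 (s1.setReg x 0) :=
          Exec.set (B := B) s1 x (.lit 0) (by simp only [Expr.Fits]; omega)
        refine ⟨_, _, Exec.seq _ _ _ _ _ _ _ e1 (Exec.cond_false _ _ _ _ _ _ hfit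
          (by rw [hev, if_neg hlt]) e2), ?_, ?_, hfr _⟩
        · simp only [Stmt.time, Expr.cost, eighth]; omega
        · rw [Stmt.run, h0, clamp, if_neg hlt]; exact hfin _
  | put a i e =>
      intro d s σ hd hs h0 hσ hN hB hQ hκ
      simp only [Stmt.names, max_le_iff] at hN
      simp only [Stmt.ok, Bool.and_eq_true] at hQ
      have hB8 : n ^ 8 < B :=
        hMlt (by have := e.size_pos; simp only [Stmt.size]; omega) hB
      have hBi : (n ^ 8) ^ i.size ≤ B := hMle (by simp only [Stmt.size]; omega) hB
      have hBe : (n ^ 8) ^ e.size ≤ B := hMle (by simp only [Stmt.size]; omega) hB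
      obtain ⟨t0, s0, e0, ht0, hr0, hf0, ha0⟩ :=
        i.comp_yields (B := B) (κ := κ) hM id d s σ hs hσ hN.1 hBi hQ.1 hκ
      have hs0 : Repr K id d s0 σ := hs.congr hf0 ha0 le_rfl
      obtain ⟨t1, s1, e1, ht1, hr1, hf1, ha1⟩ :=
        e.comp_yields (B := B) (κ := κ) hM id (d + 1) s0 σ
          (hs0.congr (fun _ _ => rfl) rfl (by omega)) hσ hN.2 hBe hQ.2 hκ
      have hs1 : Repr K id d s1 σ := hs0.congr (fun y hy => hf1 y (by omega)) ha1 le_rfl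
      have h01 : s1.reg 0 = n := (hs1.reg 0 hK).trans h0
      have hrd : s1.reg d = i.eval σ := by rw [hf1 d (by omega), hr0]
      have hv : e.eval σ < B := (e.eval_lt hM σ hσ).trans_le hBe
      have hvi : i.eval σ < B := (i.eval_lt hM σ hσ).trans_le hBi
      have hfit : (Expr.op .lt (.reg (d + 1)) eighth).Fits B s1 := by
        refine ⟨by simpa [Expr.Fits, hr1] using hv, eighth_fits hn h01 hB8, ?_⟩
        simp only [Op.eval]
        split_ifs <;> omega
      have hev : (Expr.op .lt (.reg (d + 1)) eighth).eval s1 =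
          if e.eval σ < n ^ 8 then 1 else 0 := by
        simp only [Expr.eval, eighth_eval, Op.eval, hr1, h01]
      have hfr : ∀ w y, K ≤ y → y < d → (s1.setArr a (i.eval σ) w).reg y = s.reg y :=
        fun w y hy hy' => by rw [setArr_reg, hf1 y (by omega), hf0 y hy']
      by_cases hlt : e.eval σ < n ^ 8
      · have e2 : Exec B (.put a (.reg d) (.reg (d + 1))) s1 3
            (s1.setArr a (i.eval σ) (e.eval σ)) := by
          have := Exec.put (B := B) s1 a (.reg d) (.reg (d + 1))
            (by simpa [Expr.Fits, hrd] using hvi) (by simpa [Expr.Fits, hr1] using hv)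
          simpa [Expr.eval, Expr.cost, hr1, hrd] using this
        refine ⟨_, _, Exec.seq _ _ _ _ _ _ _ e0 (Exec.seq _ _ _ _ _ _ _ e1
          (Exec.cond_true _ _ _ _ _ _ hfit
            (by rw [hev, if_pos hlt]; exact one_ne_zero) e2)), ?_, ?_, hfr _⟩
        · simp only [Stmt.time, Expr.cost, eighth]; omega
        · rw [Stmt.run, h0, clamp_of_lt hlt]; exact hs1.setArr _ _ _
      · have e2 : Exec B (.put a (.reg d) (.lit 0)) s1 3 (s1.setArr a (i.eval σ) 0) := by
          have := Exec.put (B := B) s1 a (.reg d) (.lit 0)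
            (by simpa [Expr.Fits, hrd] using hvi) (by simp only [Expr.Fits]; omega)
          simpa [Expr.eval, Expr.cost, hrd] using this
        refine ⟨_, _, Exec.seq _ _ _ _ _ _ _ e0 (Exec.seq _ _ _ _ _ _ _ e1
          (Exec.cond_false _ _ _ _ _ _ hfit (by rw [hev, if_neg hlt]) e2)), ?_, ?_, hfr _⟩
        · simp only [Stmt.time, Expr.cost, eighth]; omega
        · rw [Stmt.run, h0, clamp, if_neg hlt]; exact hs1.setArr _ _ _
  | seq p q ihp ihq =>
      intro d s σ hd hs h0 hσ hN hB hQ hκ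
      simp only [Stmt.names, max_le_iff] at hN
      simp only [Stmt.ok, Bool.and_eq_true] at hQ
      obtain ⟨t1, s1, e1, ht1, hs1, hf1⟩ :=
        ihp d s σ hd hs h0 hσ hN.1 (hMle (by simp [Stmt.size]) hB) hQ.1 hκ
      obtain ⟨t2, s2, e2, ht2, hs2, hf2⟩ :=
        ihq d s1 (p.run σ) hd hs1 (by rw [p.run_const σ hQ.1 0 hQ0, h0])
          (p.run_below hn hQ0 σ hQ.1 h0 hσ) hN.2 (hMle (by simp [Stmt.size]) hB) hQ.2
          (fun c hc => by rw [p.run_const σ hQ.1 c hc]; exact hκ c hc)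
      exact ⟨_, s2, Exec.seq _ _ _ _ _ _ _ e1 e2, by simp only [Stmt.time]; omega, hs2,
        fun y hy hy' => by rw [hf2 y hy hy', hf1 y hy hy']⟩
  | ite b p q ihp ihq =>
      intro d s σ hd hs h0 hσ hN hB hQ hκ
      simp only [Stmt.names, max_le_iff] at hN
      simp only [Stmt.ok, Bool.and_eq_true] at hQ
      have hBb : (n ^ 8) ^ b.size ≤ B := hMle (by simp only [Stmt.size]; omega) hB
      obtain ⟨t1, s1, e1, ht1, hr1, hf1, ha1⟩ :=
        b.comp_yields (B := B) (κ := κ) hM id d s σ hs hσ hN.1 hBb hQ.1.1 hκ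
      have hs1 : Repr K id d s1 σ := hs.congr hf1 ha1 le_rfl
      have hfit : (Expr.reg d).Fits B s1 := by
        simpa [Expr.Fits, hr1] using (b.eval_lt hM σ hσ).trans_le hBb
      by_cases hb : b.eval σ ≠ 0
      · obtain ⟨t2, s2, e2, ht2, hs2, hf2⟩ := ihp d s1 σ hd hs1 h0 hσ hN.2.1
          (hMle (by simp only [Stmt.size]; omega) hB) hQ.1.2 hκ
        refine ⟨_, s2, Exec.seq _ _ _ _ _ _ _ e1 (Exec.cond_true _ _ _ _ _ _ hfit
          (by simpa [Expr.eval, hr1] using hb) e2), by simp only [Stmt.time, Expr.cost]; omega, ?_,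
          fun y hy hy' => by rw [hf2 y hy hy', hf1 y hy']⟩
        rw [Stmt.run, if_pos hb]; exact hs2
      · obtain ⟨t2, s2, e2, ht2, hs2, hf2⟩ := ihq d s1 σ hd hs1 h0 hσ hN.2.2
          (hMle (by simp only [Stmt.size]; omega) hB) hQ.2 hκ
        refine ⟨_, s2, Exec.seq _ _ _ _ _ _ _ e1 (Exec.cond_false _ _ _ _ _ _ hfit
          (by simpa [Expr.eval, hr1] using hb) e2), by simp only [Stmt.time, Expr.cost]; omega, ?_,
          fun y hy hy' => by rw [hf2 y hy hy', hf1 y hy']⟩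
        rw [Stmt.run, if_neg hb]; exact hs2
  | loop x c p ih =>
      intro d s σ hd hs h0 hσ hN hB hQ hκ
      simp only [Stmt.names, max_le_iff] at hN
      simp only [Stmt.ok, Bool.and_eq_true, Bool.not_eq_true'] at hQ
      have hMB : n ^ 8 ≤ B :=
        (Nat.le_self_pow (by simp [Stmt.size]) _).trans hB
      have hne : ∀ c', Q c' = true → c' ≠ x := by
        rintro c' hc' rfl
        exact Bool.false_ne_true (hQ.1.2.symm.trans hc')
      have hok : ∀ k ≤ σ.reg c, ∀ c', Q c' = true →
          (iter (fun k τ => p.run (τ.setReg x k)) k σ).reg c' = σ.reg c' := by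
        intro k
        induction k with
        | zero => exact fun _ _ _ => rfl
        | succ k ihk =>
            intro hk c' hc'
            rw [iter, p.run_const _ hQ.2 c' hc', setReg_reg, if_neg (hne c' hc'),
              ihk (by omega) c' hc']
      have hbel : ∀ k ≤ σ.reg c,
          (iter (fun k τ => p.run (τ.setReg x k)) k σ).Below (n ^ 8) := by
        intro k
        induction k with
        | zero => exact fun _ => hσ
        | succ k ihk =>
            intro hk
            refine p.run_below hn hQ0 _ hQ.2 ?_ ((ihk (by omega)).setReg x (lt_trans hk (hσ.1 c)))
            rw [setReg_reg, if_neg (hne 0 hQ0), hok k (by omega) 0 hQ0, h0]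
      have e1 : Exec B (.set d (.lit 0)) s 2 (s.setReg d 0) :=
        Exec.set (B := B) s d (.lit 0) (by simp only [Expr.Fits]; omega)
      have hs1 : Repr K id d (s.setReg d 0) σ :=
        hs.congr (s' := s.setReg d 0)
          (fun y hy => by rw [setReg_reg, if_neg (by omega)]) rfl le_rfl
      obtain ⟨t2, s2, e2, ht2, hs2, hf2⟩ := Stmt.iter_loop (B := B) (K := K) (M := n ^ 8) (d := d)
        (x := x) (c := c) (m := σ.reg c) (τ := p.time κ) (p := p) (σ := σ) hd (by omega) (by omega)
        rfl (hσ.1 c) hMB hM (fun k hk => hok k hk c hQ.1.1) (by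
          intro k hk s' hs'
          refine ih (d + 1) s' _ (by omega) hs' ?_ ((hbel k hk.le).setReg x (hk.trans (hσ.1 c))) hN.2
            (hMle (by simp [Stmt.size]) hB) hQ.2 ?_
          · rw [setReg_reg, if_neg (hne 0 hQ0), hok k hk.le 0 hQ0, h0]
          · intro c' hc'
            rw [setReg_reg, if_neg (hne c' hc'), hok k hk.le c' hc']
            exact hκ c' hc')
        (σ.reg c) 0 (by omega) (s.setReg d 0) (by simp [setReg_reg]) hs1
      refine ⟨_, s2, Exec.seq _ _ _ _ _ _ _ e1 e2, ?_, hs2, fun y hy hy' => ?_⟩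
      · have := Nat.mul_le_mul_right (p.time κ + 10) (hκ c hQ.1.1)
        simp only [Stmt.time]; omega
      · rw [hf2 y hy hy', setReg_reg, if_neg (by omega)]

end RAM

namespace RAM

/-! ### Degrees of running times -/

def Tm.deg (a : ℕ → ℕ) : Tm → ℕ
  | lit _ => 0
  | var _ => 0
  | get _ i => i.deg a
  | op _ e₁ e₂ => max (e₁.deg a) (e₂.deg a)
  | find _ c φ => a c + φ.deg a

def Stmt.deg (a : ℕ → ℕ) : Stmt → ℕ
  | set _ e => e.deg a
  | put _ i e => max (i.deg a) (e.deg a)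
  | seq p q => max (p.deg a) (q.deg a)
  | ite b p q => max (b.deg a) (max (p.deg a) (q.deg a))
  | loop _ c p => a c + p.deg a

/-- `f ≤ C n ^ i w ^ j`, with `C` independent of `n`, `w` and of the search bounds `κ`, provided that
`κ c ≤ k n ^ a c w ^ b c`. -/
def PolyBound (k : ℕ) (Q : ℕ → Bool) (a b : ℕ → ℕ) (f : (ℕ → ℕ) → ℕ) (i j : ℕ) : Prop :=
  ∃ C, ∀ (n w : ℕ) (κ : ℕ → ℕ), 0 < n → 0 < w →
    (∀ c, Q c = true → κ c ≤ k * (n ^ a c * w ^ b c)) → f κ ≤ C * (n ^ i * w ^ j)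

section PolyBound

variable {k : ℕ} {Q : ℕ → Bool} {a b : ℕ → ℕ}

theorem polyBound_const (C i j : ℕ) : PolyBound k Q a b (fun _ => C) i j :=
  ⟨C, fun n w _ hn hw _ => Nat.le_mul_of_pos_right _ (by positivity)⟩

theorem PolyBound.add {f g : (ℕ → ℕ) → ℕ} {i i' j j' : ℕ} (hf : PolyBound k Q a b f i j)
    (hg : PolyBound k Q a b g i' j') :
    PolyBound k Q a b (fun κ => f κ + g κ) (max i i') (max j j') := by
  obtain ⟨C, hC⟩ := hf
  obtain ⟨D, hD⟩ := hg
  refine ⟨C + D, fun n w κ hn hw hκ => ?_⟩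
  have h1 : n ^ i * w ^ j ≤ n ^ max i i' * w ^ max j j' :=
    Nat.mul_le_mul (Nat.pow_le_pow_right hn (le_max_left _ _))
      (Nat.pow_le_pow_right hw (le_max_left _ _))
  have h2 : n ^ i' * w ^ j' ≤ n ^ max i i' * w ^ max j j' :=
    Nat.mul_le_mul (Nat.pow_le_pow_right hn (le_max_right _ _))
      (Nat.pow_le_pow_right hw (le_max_right _ _))
  calc f κ + g κ ≤ C * (n ^ i * w ^ j) + D * (n ^ i' * w ^ j') :=
        add_le_add (hC n w κ hn hw hκ) (hD n w κ hn hw hκ)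
    _ ≤ C * (n ^ max i i' * w ^ max j j') + D * (n ^ max i i' * w ^ max j j') :=
        add_le_add (Nat.mul_le_mul_left _ h1) (Nat.mul_le_mul_left _ h2)
    _ = _ := by ring

theorem PolyBound.add_const {f : (ℕ → ℕ) → ℕ} {i j : ℕ} (hf : PolyBound k Q a b f i j) (C : ℕ) :
    PolyBound k Q a b (fun κ => f κ + C) i j := by
  simpa using hf.add (polyBound_const C i j)

theorem PolyBound.mul {f : (ℕ → ℕ) → ℕ} {i j c : ℕ} (hf : PolyBound k Q a b f i j)
    (hc : Q c = true) : PolyBound k Q a b (fun κ => κ c * f κ) (a c + i) (b c + j) := by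
  obtain ⟨C, hC⟩ := hf
  refine ⟨k * C, fun n w κ hn hw hκ => ?_⟩
  calc κ c * f κ ≤ (k * (n ^ a c * w ^ b c)) * (C * (n ^ i * w ^ j)) :=
        Nat.mul_le_mul (hκ c hc) (hC n w κ hn hw hκ)
    _ = _ := by ring

/-- The recursion of `deg` follows that of `time`: a sum of times becomes a maximum of exponents,
and a search adds the exponent of its bound. Hence the degree of a concrete program is found by
evaluation. -/
theorem Tm.time_polyBound (e : Tm) (h : e.ok Q = true) :
    PolyBound k Q a b (fun κ => e.time κ) (e.deg a) (e.deg b) := by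
  induction e with
  | lit _ => exact polyBound_const 2 _ _
  | var _ => exact polyBound_const 2 _ _
  | get _ i ih => exact (ih h).add_const 3
  | op o e₁ e₂ ih₁ ih₂ =>
      simp only [Tm.ok, Bool.and_eq_true] at h
      exact ((ih₁ h.1).add (ih₂ h.2)).add_const 4
  | find x c φ ih =>
      simp only [Tm.ok, Bool.and_eq_true] at h
      exact (((ih h.2).add_const 12).mul h.1.1).add_const 10

theorem Stmt.time_polyBound (p : Stmt) (h : p.ok Q = true) :
    PolyBound k Q a b (fun κ => p.time κ) (p.deg a) (p.deg b) := by
  induction p with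
  | set x e =>
      simp only [Stmt.ok, Bool.and_eq_true] at h
      exact (e.time_polyBound h.2).add_const 20
  | put _ i e =>
      simp only [Stmt.ok, Bool.and_eq_true] at h
      exact ((i.time_polyBound h.1).add (e.time_polyBound h.2)).add_const 21
  | seq p q ihp ihq =>
      simp only [Stmt.ok, Bool.and_eq_true] at h
      exact (ihp h.1).add (ihq h.2)
  | ite e p q ihp ihq =>
      simp only [Stmt.ok, Bool.and_eq_true] at h
      have := ((e.time_polyBound h.1.1).add ((ihp h.1.2).add (ihq h.2))).add_const 2
      simpa only [Stmt.time, Stmt.deg, add_assoc] using this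
  | loop x c p ih =>
      simp only [Stmt.ok, Bool.and_eq_true] at h
      exact (((ih h.2).add_const 10).mul h.1.1).add_const 6

end PolyBound

/-! ### Frames and invariants -/

/-- Whether the statement assigns to the variable `x`. -/
def Stmt.assigns (x : ℕ) : Stmt → Bool
  | set y _ => x == y
  | put _ _ _ => false
  | seq p q => p.assigns x || q.assigns x
  | ite _ p q => p.assigns x || q.assigns x
  | loop y _ p => x == y || p.assigns x

/-- Whether the statement writes to the array `a`. -/
def Stmt.writes (a : ℕ) : Stmt → Bool
  | set _ _ => false
  | put b _ _ => a == b
  | seq p q => p.writes a || q.writes a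
  | ite _ p q => p.writes a || q.writes a
  | loop _ _ p => p.writes a

theorem iter_inv {α : Type*} {f : ℕ → α → α} {I : ℕ → α → Prop} {m : ℕ} {s : α} (h0 : I 0 s)
    (step : ∀ k < m, ∀ t, I k t → I (k + 1) (f k t)) : I m (iter f m s) := by
  have : ∀ k ≤ m, I k (iter f k s) := by
    intro k
    induction k with
    | zero => exact fun _ => h0
    | succ k ih => exact fun hk => step k hk _ (ih (by omega))
  exact this m le_rfl

theorem Stmt.run_reg {x : ℕ} (p : Stmt) :
    ∀ σ, p.assigns x = false → (p.run σ).reg x = σ.reg x := by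
  induction p with
  | set y e =>
      intro σ h
      simp only [Stmt.assigns, beq_eq_false_iff_ne] at h
      rw [Stmt.run, setReg_reg, if_neg h]
  | put a i e => exact fun σ h => rfl
  | seq p q ihp ihq =>
      intro σ h
      simp only [Stmt.assigns, Bool.or_eq_false_iff] at h
      rw [Stmt.run, ihq _ h.2, ihp _ h.1]
  | ite b p q ihp ihq =>
      intro σ h
      simp only [Stmt.assigns, Bool.or_eq_false_iff] at h
      rw [Stmt.run]
      split_ifs
      · exact ihp _ h.1
      · exact ihq _ h.2
  | loop y c p ih =>
      intro σ h
      simp only [Stmt.assigns, Bool.or_eq_false_iff, beq_eq_false_iff_ne] at h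
      exact iter_inv (I := fun _ (τ : State) => τ.reg x = σ.reg x) rfl fun k _ τ hτ => by
        rw [ih _ h.2, setReg_reg, if_neg h.1, hτ]

theorem Stmt.run_arr {a : ℕ} (p : Stmt) :
    ∀ σ, p.writes a = false → (p.run σ).arr a = σ.arr a := by
  induction p with
  | set y e => exact fun σ h => rfl
  | put b i e =>
      intro σ h
      simp only [Stmt.writes, beq_eq_false_iff_ne] at h
      funext j
      rw [Stmt.run, setArr_arr, if_neg fun h' => h h'.1]
  | seq p q ihp ihq =>
      intro σ h
      simp only [Stmt.writes, Bool.or_eq_false_iff] at h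
      rw [Stmt.run, ihq _ h.2, ihp _ h.1]
  | ite b p q ihp ihq =>
      intro σ h
      simp only [Stmt.writes, Bool.or_eq_false_iff] at h
      rw [Stmt.run]
      split_ifs
      · exact ihp _ h.1
      · exact ihq _ h.2
  | loop y c p ih =>
      intro σ h
      exact iter_inv (I := fun _ (τ : State) => τ.arr a = σ.arr a) rfl fun k _ τ hτ => by
        rw [ih _ h, setReg_arr, hτ]

/-- The states `τ` and `σ` differ only in what `p` assigns and writes. -/
structure Stmt.Frame (p : Stmt) (σ τ : State) : Prop where
  reg : ∀ x, p.assigns x = false → τ.reg x = σ.reg x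
  arr : ∀ a, p.writes a = false → τ.arr a = σ.arr a

theorem Stmt.frame (p : Stmt) (σ : State) : p.Frame σ (p.run σ) :=
  ⟨fun _ => p.run_reg σ, fun _ => p.run_arr σ⟩

/-- The step receives the frame of the whole loop, so an invariant has to mention only what the loop
changes. -/
theorem Stmt.loop_inv {x c : ℕ} {p : Stmt} {σ : State} (I : ℕ → State → Prop) (h0 : I 0 σ)
    (step : ∀ k < σ.reg c, ∀ τ, (Stmt.loop x c p).Frame σ τ → I k τ →
      I (k + 1) (p.run (τ.setReg x k))) : I (σ.reg c) ((Stmt.loop x c p).run σ) := by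
  refine (iter_inv (I := fun k τ => (Stmt.loop x c p).Frame σ τ ∧ I k τ)
    ⟨⟨fun _ _ => rfl, fun _ _ => rfl⟩, h0⟩ fun k hk τ hτ => ⟨⟨fun y hy => ?_, fun a ha => ?_⟩,
      step k hk τ hτ.1 hτ.2⟩).2
  · have hy' := hy
    simp only [Stmt.assigns, Bool.or_eq_false_iff, beq_eq_false_iff_ne] at hy'
    rw [p.run_reg _ hy'.2, setReg_reg, if_neg hy'.1, hτ.1.reg y hy]
  · rw [p.run_arr _ ha, setReg_arr, hτ.1.arr a ha]

/-! ### Formulas -/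

namespace Tm

/-- A term counts as true if its value is not `0`. -/
def Holds (φ : Tm) (s : State) : Prop := φ.eval s ≠ 0

def add (e₁ e₂ : Tm) : Tm := .op .add e₁ e₂
def mul (e₁ e₂ : Tm) : Tm := .op .mul e₁ e₂
def sub (e₁ e₂ : Tm) : Tm := .op .sub e₁ e₂
def lt (e₁ e₂ : Tm) : Tm := .op .lt e₁ e₂
def eq (e₁ e₂ : Tm) : Tm := .op .eq e₁ e₂
def not (φ : Tm) : Tm := .op .eq φ (.lit 0)
def and (φ ψ : Tm) : Tm := .op .mul φ ψ
def or (φ ψ : Tm) : Tm := .op .lt (.lit 0) (.op .add φ ψ)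
def imp (φ ψ : Tm) : Tm := or (not φ) ψ
def le (e₁ e₂ : Tm) : Tm := not (lt e₂ e₁)
def iff (φ ψ : Tm) : Tm := eq (not φ) (not ψ)
-- An unsuccessful search returns its bound, so comparison with the bound decides whether there is a
-- witness.
def ex (x c : ℕ) (φ : Tm) : Tm := lt (.find x c φ) (.var c)
def all (x c : ℕ) (φ : Tm) : Tm := not (ex x c (not φ))

variable {e₁ e₂ φ ψ : Tm} {s : State}

@[simp] theorem eval_lit (k : ℕ) : (Tm.lit k).eval s = k := rfl
@[simp] theorem eval_var (x : ℕ) : (Tm.var x).eval s = s.reg x := rfl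
@[simp] theorem eval_get (a : ℕ) : (Tm.get a e₁).eval s = s.arr a (e₁.eval s) := rfl
@[simp] theorem eval_add : (add e₁ e₂).eval s = e₁.eval s + e₂.eval s := rfl
@[simp] theorem eval_mul : (mul e₁ e₂).eval s = e₁.eval s * e₂.eval s := rfl
@[simp] theorem eval_sub : (sub e₁ e₂).eval s = e₁.eval s - e₂.eval s := rfl
@[simp] theorem eval_find (x c : ℕ) :
    (Tm.find x c φ).eval s = least (s.reg c) fun i => φ.Holds (s.setReg x i) := rfl

@[simp] theorem holds_lt : (lt e₁ e₂).Holds s ↔ e₁.eval s < e₂.eval s := by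
  simp [Holds, lt, eval, Op.eval]
@[simp] theorem holds_eq : (eq e₁ e₂).Holds s ↔ e₁.eval s = e₂.eval s := by
  simp [Holds, eq, eval, Op.eval]
@[simp] theorem holds_not : (not φ).Holds s ↔ ¬ φ.Holds s := by
  simp only [Holds, not, eval, Op.eval]
  split_ifs with h <;> simp [h]
@[simp] theorem holds_and : (and φ ψ).Holds s ↔ φ.Holds s ∧ ψ.Holds s := by
  simp [Holds, and, eval, Op.eval]
@[simp] theorem holds_or : (or φ ψ).Holds s ↔ φ.Holds s ∨ ψ.Holds s := by
  simp [Holds, or, eval, Op.eval]; omega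
@[simp] theorem holds_imp : (imp φ ψ).Holds s ↔ (φ.Holds s → ψ.Holds s) := by
  rw [imp, holds_or, holds_not]; tauto
@[simp] theorem holds_le : (le e₁ e₂).Holds s ↔ e₁.eval s ≤ e₂.eval s := by
  rw [le, holds_not, holds_lt, not_lt]
@[simp] theorem holds_iff : (iff φ ψ).Holds s ↔ (φ.Holds s ↔ ψ.Holds s) := by
  rw [iff, holds_eq]
  simp only [Holds, not, eval, Op.eval]
  by_cases h₁ : φ.eval s = 0 <;> by_cases h₂ : ψ.eval s = 0 <;> simp [h₁, h₂]
@[simp] theorem holds_ex (x c : ℕ) :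
    (ex x c φ).Holds s ↔ ∃ i < s.reg c, φ.Holds (s.setReg x i) := by
  rw [ex, holds_lt]; exact least_lt_iff
@[simp] theorem holds_all (x c : ℕ) :
    (all x c φ).Holds s ↔ ∀ i < s.reg c, φ.Holds (s.setReg x i) := by
  simp [all]
@[simp] theorem holds_get (a : ℕ) : (Tm.get a e₁).Holds s ↔ s.arr a (e₁.eval s) ≠ 0 := Iff.rfl

end Tm

end RAM

namespace RAM

/-! ### The program

Constant registers: `0` number `n` of vertices, `2` size `r` of the modulator, `3` `r + 1`,
`4` `N = 3 n`, `5` `N ^ 2 + 1`, `6` `6 r ^ 2`, `7` `n + 1`.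

Arrays: `0` adjacency matrix, `1` modulator, `2` best colouring, `3` enumeration of the modulator,
`4` guessed bits, `5` edges of the auxiliary bipartite graph, `6` and `7` owners and prices of its
right nodes, `8` labels of the vertices, `9` colours. -/

namespace Program

open Tm Stmt

/-- For each `k` there are six blocks of `r` bits. Blocks `3` and `4` use their first bit only and
block `5` is spare. -/
def bit (q : ℕ) (k j : Tm) : Tm :=
  get 4 (add (mul (add (mul k (lit 6)) (lit q)) (var 2)) j)

def adj (u w : Tm) : Tm := get 0 (add (mul u (var 0)) w)

/-- Adjacency of a vertex and the `j`-th modulator vertex. -/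
def adjR (j w : Tm) : Tm := adj (get 3 j) w

/-- The vertex is in the clique of the vertex in register `10`. -/
def inA (x : Tm) : Tm :=
  and (lt x (var 0)) (and (not (get 1 x)) (or (eq x (var 10)) (adj (var 10) x)))

def inB (x : Tm) : Tm :=
  and (lt x (var 0)) (and (not (get 1 x)) (not (or (eq x (var 10)) (adj (var 10) x))))

/-- The vertex has a neighbour in each of the first `i` modulator classes; `q` selects the bits
that tell whether these classes have a member in the clique of the vertex. -/
def reaches (q : ℕ) (x i : Tm) : Tm :=
  all 20 2 (imp (lt (var 20) i)
    (or (bit q (var 20) (lit 0)) (ex 21 2 (and (bit 0 (var 20) (var 21)) (adjR (var 21) x)))))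

/-- The `j`-th modulator vertex is in one of the first `i` modulator classes. -/
def early (j i : Tm) : Tm := ex 23 2 (and (lt (var 23) i) (bit 0 (var 23) j))

/-- The connectives and quantifiers follow `Guess.Edge`, so that the two are identified by
simplification alone (`holds_edge`). -/
def edge (x y : Tm) : Tm :=
  or (or
    (and (inA x) (and (inB y) (ex 24 3 (and (le (var 24) (var 12)) (and (reaches 3 x (var 24))
      (and (reaches 4 y (var 24)) (all 22 2 (or (early (var 22) (var 24))
        (or (adjR (var 22) x) (adjR (var 22) y))))))))))
    (and (inA x) (ex 25 2 (and (eq y (add (var 0) (var 25))) (and (bit 3 (var 25) (lit 0))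
      (all 22 2 (iff (adjR (var 22) x) (bit 1 (var 25) (var 22)))))))))
  (or
    (and (inA x) (and (le (add (var 0) (var 0)) y) (and (lt y (add (add (var 0) (var 0)) (var 11)))
      (ex 24 3 (and (le (var 12) (var 24)) (and (reaches 3 x (var 24))
        (all 22 2 (or (early (var 22) (var 24)) (adjR (var 22) x)))))))))
    (and (inB y) (ex 25 2 (and (eq x (add (var 0) (var 25))) (and (bit 4 (var 25) (lit 0))
      (all 22 2 (iff (adjR (var 22) y) (bit 2 (var 25) (var 22)))))))))

def fillEdges : Stmt :=
  loop 13 4 (loop 14 4 (put 5 (add (mul (var 13) (var 4)) (var 14)) (edge (var 13) (var 14))))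

def edgeAt (x y : Tm) : Tm := get 5 (add (mul x (var 4)) y)

/-- One bid: a free left node claims a cheapest neighbour and raises its price. -/
def bid : Stmt :=
  seq (set 13 (find 20 4 (and (ex 21 4 (edgeAt (var 20) (var 21)))
    (all 21 4 (not (eq (get 6 (var 21)) (add (var 20) (lit 1))))))))
  (ite (lt (var 13) (var 4))
    (seq (set 14 (find 21 4 (and (edgeAt (var 13) (var 21)) (all 22 4
        (imp (edgeAt (var 13) (var 22)) (le (get 7 (var 21)) (get 7 (var 22))))))))
      (seq (put 6 (var 14) (add (var 13) (lit 1))) (put 7 (var 14) (add (get 7 (var 14)) (lit 1)))))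
    (set 14 (lit 0)))

def auction : Stmt :=
  seq (loop 14 4 (seq (put 6 (var 14) (lit 0)) (put 7 (var 14) (lit 0)))) (loop 15 5 bid)

/-- Labels the vertex in register `18`. -/
def label : Stmt :=
  ite (get 1 (var 18))
    (put 8 (var 18) (add (var 0)
      (find 20 2 (ex 21 2 (and (eq (get 3 (var 21)) (var 18)) (bit 0 (var 20) (var 21)))))))
    (ite (inA (var 18))
      (seq (set 14 (find 20 2 (eq (get 6 (add (var 0) (var 20))) (add (var 18) (lit 1)))))
        (ite (lt (var 14) (var 2)) (put 8 (var 18) (add (var 0) (var 14)))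
          (put 8 (var 18) (var 18))))
      (put 8 (var 18) (sub (get 6 (var 18)) (lit 1))))

def labels : Stmt := loop 18 0 label

/-- The vertices with the label in register `13` or `20` may get the next colour. -/
def eligible : Tm :=
  and (ex 21 0 (and (not (get 9 (var 21))) (eq (get 8 (var 21)) (var 20))))
    (all 21 0 (imp (not (get 9 (var 21)))
      (iff (ex 22 0 (and (eq (get 8 (var 22)) (var 20)) (adj (var 21) (var 22))))
        (not (eq (get 8 (var 21)) (var 20))))))

def greedyStep : Stmt :=
  seq (set 13 (find 20 4 eligible))
  (ite (lt (var 13) (var 4))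
    (seq (set 17 (add (var 17) (lit 1)))
      (loop 18 0 (ite (eq (get 8 (var 18)) (var 13)) (put 9 (var 18) (var 17)) (set 14 (lit 0)))))
    (set 14 (lit 0)))

def greedy : Stmt :=
  seq (set 17 (lit 0)) (seq (loop 18 0 (put 9 (var 18) (lit 0))) (loop 15 0 greedyStep))

def record : Stmt :=
  ite (and (all 20 0 (get 9 (var 20))) (lt (var 1) (var 17)))
    (seq (set 1 (var 17)) (loop 18 0 (put 2 (var 18) (get 9 (var 18))))) (set 14 (lit 0))

def process : Stmt :=
  seq fillEdges (seq auction (seq labels (seq greedy record)))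

def processAll : Stmt := loop 10 0 (loop 11 7 (loop 12 3 process))

/-- Binary increment of the guessed bits; register `8` becomes `0` on overflow. -/
def increment : Stmt :=
  seq (set 9 (lit 1)) (seq
    (loop 18 6 (ite (var 9) (ite (get 4 (var 18)) (put 4 (var 18) (lit 0))
      (seq (put 4 (var 18) (lit 1)) (set 9 (lit 0)))) (set 14 (lit 0))))
    (set 8 (not (var 9))))

def body : Stmt := seq processAll increment

def init : Stmt :=
  seq (loop 18 0 (ite (get 1 (var 18))
      (seq (put 3 (var 2) (var 18)) (set 2 (add (var 2) (lit 1)))) (set 14 (lit 0))))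
  (seq (set 3 (add (var 2) (lit 1))) (seq (set 4 (add (add (var 0) (var 0)) (var 0)))
  (seq (set 5 (add (mul (var 4) (var 4)) (lit 1))) (seq (set 6 (mul (lit 6) (mul (var 2) (var 2))))
  (seq (set 7 (add (var 0) (lit 1))) (set 8 (lit 1)))))))

/-- The registers `0, 2, 3, 4, 5, 6, 7`. -/
def consts (x : ℕ) : Bool := x < 8 && x != 1

/-- Exponents of `n` in bounds for the constant registers; `degR` gives the exponents of `r + 1`
(see `Initial.le_deg`). -/
def degN : ℕ → ℕ
  | 0 => 1
  | 4 => 1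
  | 5 => 2
  | 7 => 1
  | _ => 0

def degR : ℕ → ℕ
  | 2 => 1
  | 3 => 1
  | 6 => 2
  | _ => 0

theorem body_ok : body.ok consts = true := by rfl

theorem init_ok : init.ok (fun x => x == 0) = true := by rfl

/-- The vertex `v₀` and the number `d` contribute one factor `n` each, the `N ^ 2 + 1` bids
contribute `n ^ 2`, and the nested searches in a bid another `n ^ 2`. The greedy colouring also
takes degree `4`: `n` rounds, each with three nested searches. -/
theorem body_degN : body.deg degN = 6 := by rfl

theorem init_degN : init.deg degN = 1 := by rfl

/-- The whole program. -/
def main (d : ℕ) : Prog := .seq (init.comp d) (.loop (.reg 8) (body.comp d))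

end Program

end RAM

/-! ### The auction algorithm for bipartite matchings -/

namespace Auction

variable {N : ℕ} {E : ℕ → ℕ → Prop} {k : ℕ} {m p : ℕ → ℕ}

/-- The left node `x` has a neighbour and owns no right node. -/
def Free (N : ℕ) (E : ℕ → ℕ → Prop) (m : ℕ → ℕ) (x : ℕ) : Prop :=
  x < N ∧ (∃ y < N, E x y) ∧ ∀ y < N, m y ≠ x + 1

/-- The invariant after `k` bids: the owner of `y` is `m y - 1`, and `m y = 0` if there is none. -/
structure Inv (N : ℕ) (E : ℕ → ℕ → Prop) (k : ℕ) (m p : ℕ → ℕ) : Prop where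
  owner : ∀ y < N, ∀ x, m y = x + 1 → x < N ∧ E x y ∧ ∀ y' < N, E x y' → p y ≤ p y' + 1
  inj : ∀ y < N, ∀ y' < N, m y ≠ 0 → m y = m y' → y = y'
  pos : ∀ y < N, p y ≠ 0 → m y ≠ 0
  le : ∀ y < N, p y ≤ N
  sum : (∀ x, ¬ Free N E m x) ∨ ∑ y ∈ Finset.range N, p y = k

/-- All left nodes that have a neighbour can be matched simultaneously. -/
def Feasible (N : ℕ) (E : ℕ → ℕ → Prop) : Prop :=
  ∃ f : ℕ → ℕ, (∀ x < N, (∃ y < N, E x y) → f x < N ∧ E x (f x)) ∧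
    ∀ x < N, ∀ x' < N, (∃ y < N, E x y) → (∃ y < N, E x' y) → f x = f x' → x = x'

/-- A gap argument. If all neighbours of a free node were expensive, some price `t` would not occur,
and the owners of the nodes dearer than `t`, together with the free node, would violate Hall's
condition. -/
theorem Inv.exists_cheap (h : Inv N E k m p) (hE : Feasible N E) {x : ℕ} (hx : Free N E m x) :
    ∃ y < N, E x y ∧ p y < N := by
  classical
  obtain ⟨f, hf, hfi⟩ := hE
  by_contra! hcon
  obtain ⟨hxN, hxE, hxm⟩ := hx
  set A := (Finset.range N).filter fun y => m y ≠ 0 with hA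
  have hAcard : A.card < N := by
    have h1 : A.card ≤ ((Finset.range N).erase x).card := by
      refine Finset.card_le_card_of_injOn (fun y => m y - 1) ?_ ?_
      · intro y hy
        simp only [hA, Finset.coe_filter, Finset.mem_range, Set.mem_ofPred_eq] at hy
        simp only [Finset.coe_erase, Finset.coe_range, Set.mem_sdiff, Set.mem_Iio,
          Set.mem_singleton_iff]
        have h2 := h.owner y hy.1 (m y - 1) (by omega)
        have h3 := hxm y hy.1
        exact ⟨h2.1, by omega⟩
      · intro y hy y' hy' heq
        simp only [hA, Finset.coe_filter, Finset.mem_range, Set.mem_ofPred_eq] at hy hy' heq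
        exact h.inj y hy.1 y' hy'.1 hy.2 (by omega)
    rw [Finset.card_erase_of_mem (Finset.mem_range.2 hxN), Finset.card_range] at h1
    omega
  -- Fewer than `N` right nodes are owned, and positive prices occur only at owned nodes, so one of
  -- the `N` prices `1, …, N` is missing.
  obtain ⟨t, ht, htp⟩ : ∃ t ∈ Finset.Icc 1 N, ∀ y < N, p y ≠ t := by
    by_contra! hall
    have h1 : Finset.Icc 1 N ⊆ A.image p := by
      intro t ht
      obtain ⟨y, hy, rfl⟩ := hall t ht
      rw [Finset.mem_Icc] at ht
      exact Finset.mem_image_of_mem p (Finset.mem_filter.2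
        ⟨Finset.mem_range.2 hy, h.pos y hy (by omega)⟩)
    have h2 := (Finset.card_le_card h1).trans Finset.card_image_le
    rw [Nat.card_Icc] at h2
    omega
  rw [Finset.mem_Icc] at ht
  set Q := (Finset.range N).filter fun y => t < p y with hQ
  have hQm : ∀ y ∈ Q, y < N ∧ t < p y ∧ m y ≠ 0 := fun y hy => by
    rw [hQ, Finset.mem_filter, Finset.mem_range] at hy
    exact ⟨hy.1, hy.2, h.pos y hy.1 (by omega)⟩
  -- All neighbours of these `Q.card + 1` left nodes cost more than `t`: a node is at most `1`
  -- dearer than any neighbour of its owner, and no node costs exactly `t`. So a feasible matching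
  -- would inject `S` into `Q`.
  set S := insert x (Q.image fun y => m y - 1) with hS
  have hScard : S.card = Q.card + 1 := by
    rw [hS, Finset.card_insert_of_notMem, Finset.card_image_of_injOn]
    · intro y hy y' hy' heq
      have h1 := hQm y hy
      have h2 := hQm y' hy'
      simp only at heq
      exact h.inj y h1.1 y' h2.1 h1.2.2 (by omega)
    · intro hmem
      obtain ⟨y, hy, heq⟩ := Finset.mem_image.1 hmem
      have h1 := hQm y hy
      have := hxm y h1.1
      omega
  have hSp : ∀ z ∈ S, z < N ∧ (∃ y < N, E z y) ∧ (∀ y < N, E z y → t < p y) := by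
    intro z hz
    rw [hS, Finset.mem_insert, Finset.mem_image] at hz
    rcases hz with rfl | ⟨y, hy, rfl⟩
    · refine ⟨hxN, hxE, fun y hy hE => ?_⟩
      have := hcon y hy hE
      have := htp y hy
      omega
    · obtain ⟨hyN, hyt, hym⟩ := hQm y hy
      obtain ⟨h1, h2, h3⟩ := h.owner y hyN (m y - 1) (by omega)
      refine ⟨h1, ⟨y, hyN, h2⟩, fun y' hy' hE => ?_⟩
      have := h3 y' hy' hE
      have := htp y' hy'
      omega
  have hle : S.card ≤ Q.card := by
    refine Finset.card_le_card_of_injOn f ?_ ?_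
    · intro z hz
      obtain ⟨h1, h2, h3⟩ := hSp z hz
      obtain ⟨h4, h5⟩ := hf z h1 h2
      exact Finset.mem_coe.2 (Finset.mem_filter.2 ⟨Finset.mem_range.2 h4, h3 _ h4 h5⟩)
    · intro z hz z' hz' heq
      exact hfi z (hSp z hz).1 z' (hSp z' hz').1 (hSp z hz).2.1 (hSp z' hz').2.1 heq
  omega

theorem inv_zero (hm : ∀ y < N, m y = 0) (hp : ∀ y < N, p y = 0) : Inv N E 0 m p where
  owner y hy x h := by rw [hm y hy] at h; omega
  inj y hy y' _ h := absurd (hm y hy) h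
  pos y hy h := absurd (hp y hy) h
  le y hy := by rw [hp y hy]; exact Nat.zero_le _
  sum := Or.inr (Finset.sum_eq_zero fun y hy => hp y (Finset.mem_range.1 hy))

theorem Inv.stable (h : Inv N E k m p) (hfree : ∀ x, ¬ Free N E m x) (k' : ℕ) : Inv N E k' m p :=
  { h with sum := Or.inl hfree }

/-- The claimed node was cheapest for the bidder, so after a raise by `1` it is still within `1` of
all its neighbours. For the other owners a higher price elsewhere only weakens the condition. -/
theorem Inv.bid (h : Inv N E k m p) {x y : ℕ} (hx : Free N E m x) (hy : y < N) (hxy : E x y)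
    (hmin : ∀ y' < N, E x y' → p y ≤ p y') (hpy : p y < N) :
    Inv N E (k + 1) (Function.update m y (x + 1)) (Function.update p y (p y + 1)) where
  owner z hz w hw := by
    simp only [Function.update_apply] at hw ⊢
    by_cases hzy : z = y
    · subst hzy
      rw [if_pos rfl] at hw
      obtain rfl : x = w := by omega
      refine ⟨hx.1, hxy, fun y' hy' hE => ?_⟩
      have := hmin y' hy' hE
      split_ifs <;> omega
    · rw [if_neg hzy] at hw ⊢
      obtain ⟨h1, h2, h3⟩ := h.owner z hz w hw
      refine ⟨h1, h2, fun y' hy' hE => ?_⟩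
      have := h3 y' hy' hE
      split_ifs with h4
      · subst h4; omega
      · exact this
  inj z hz z' hz' h0 heq := by
    simp only [Function.update_apply] at h0 heq
    have h1 := hx.2.2 z hz
    have h2 := hx.2.2 z' hz'
    split_ifs at h0 heq with h3 h4 h4
    · rw [h3, h4]
    · omega
    · omega
    · exact h.inj z hz z' hz' h0 heq
  pos z hz h0 := by
    simp only [Function.update_apply] at h0 ⊢
    split_ifs at h0 ⊢
    · omega
    · exact h.pos z hz h0
  le z hz := by
    simp only [Function.update_apply]
    split_ifs
    · omega
    · exact h.le z hz
  sum := by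
    rcases h.sum with h1 | h1
    · exact absurd hx (h1 x)
    · right
      rw [Finset.sum_update_of_mem (Finset.mem_range.2 hy), ← h1,
        ← Finset.add_sum_erase _ _ (Finset.mem_range.2 hy), Finset.sdiff_singleton_eq_erase]
      omega

/-- With a free node left, every bid so far would have raised the sum of the `N` prices by `1`,
beyond the maximum `N * N`. -/
theorem Inv.not_free (h : Inv N E (N * N + 1) m p) (x : ℕ) : ¬ Free N E m x := by
  rcases h.sum with h1 | h1
  · exact h1 x
  · have : ∑ y ∈ Finset.range N, p y ≤ N * N := by
      calc ∑ y ∈ Finset.range N, p y ≤ ∑ _y ∈ Finset.range N, N :=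
            Finset.sum_le_sum fun y hy => h.le y (Finset.mem_range.1 hy)
        _ = N * N := by simp
    omega

/-- The right nodes are owned by neighbours, injectively, and every left node with a neighbour owns
one. -/
structure Matched (N : ℕ) (E : ℕ → ℕ → Prop) (m : ℕ → ℕ) : Prop where
  edge : ∀ y < N, ∀ x, m y = x + 1 → x < N ∧ E x y
  inj : ∀ y < N, ∀ y' < N, m y ≠ 0 → m y = m y' → y = y'
  full : ∀ x < N, (∃ y < N, E x y) → ∃ y < N, m y = x + 1

theorem Inv.matched (h : Inv N E (N * N + 1) m p) : Matched N E m where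
  edge y hy x hx := ⟨(h.owner y hy x hx).1, (h.owner y hy x hx).2.1⟩
  inj := h.inj
  full x hx hE := by
    by_contra! hcon
    exact h.not_free x ⟨hx, hE, hcon⟩

/-- If the right nodes with a neighbour are at most as many as the left nodes with a neighbour, then
all of them are owned. -/
theorem Matched.full_right (h : Matched N E m) {f : ℕ → ℕ}
    (hf : ∀ y < N, (∃ x < N, E x y) → f y < N ∧ ∃ y' < N, E (f y) y')
    (hfi : ∀ y < N, ∀ y' < N, (∃ x < N, E x y) → (∃ x < N, E x y') → f y = f y' → y = y')
    {y : ℕ} (hy : y < N) (hE : ∃ x < N, E x y) : ∃ x < N, E x y ∧ m y = x + 1 := by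
  classical
  suffices h0 : m y ≠ 0 by
    obtain ⟨h1, h2⟩ := h.edge y hy (m y - 1) (by omega)
    exact ⟨m y - 1, h1, h2, by omega⟩
  set L := (Finset.range N).filter fun x => ∃ y < N, E x y with hL
  set A := (Finset.range N).filter fun y => ∃ x < N, E x y with hA
  set O := (Finset.range N).filter fun y => m y ≠ 0 with hO
  have hOA : O ⊆ A := by
    intro y hy
    rw [hO, Finset.mem_filter, Finset.mem_range] at hy
    obtain ⟨h1, h2⟩ := h.edge y hy.1 (m y - 1) (by omega)
    exact Finset.mem_filter.2 ⟨Finset.mem_range.2 hy.1, _, h1, h2⟩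
  have hAL : A.card ≤ L.card := by
    refine Finset.card_le_card_of_injOn f (fun y hy => ?_) fun y hy y' hy' heq => ?_
    · have hy := Finset.mem_filter.1 (Finset.mem_coe.1 hy)
      obtain ⟨h1, h2⟩ := hf y (Finset.mem_range.1 hy.1) hy.2
      exact Finset.mem_coe.2 (Finset.mem_filter.2 ⟨Finset.mem_range.2 h1, h2⟩)
    · have hy := Finset.mem_filter.1 (Finset.mem_coe.1 hy)
      have hy' := Finset.mem_filter.1 (Finset.mem_coe.1 hy')
      exact hfi y (Finset.mem_range.1 hy.1) y' (Finset.mem_range.1 hy'.1) hy.2 hy'.2 heq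
  have hLO : L.card ≤ O.card := by
    have : L ⊆ O.image fun y => m y - 1 := by
      intro x hx
      rw [hL, Finset.mem_filter, Finset.mem_range] at hx
      obtain ⟨y, hy, hyx⟩ := h.full x hx.1 hx.2
      exact Finset.mem_image.2 ⟨y, Finset.mem_filter.2 ⟨Finset.mem_range.2 hy, by omega⟩, by omega⟩
    exact (Finset.card_le_card this).trans Finset.card_image_le
  have hmem : y ∈ O := by
    rw [Finset.eq_of_subset_of_card_le hOA (hAL.trans hLO)]
    exact Finset.mem_filter.2 ⟨Finset.mem_range.2 hy, hE⟩
  exact (Finset.mem_filter.1 hmem).2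

end Auction

/-! ### Guesses and the auxiliary bipartite graph -/

/-- A graph on the vertices below `n`, an enumeration `ρ` of its modulator, and a guess of the
structure of a Grundy colouring. -/
structure Guess where
  n : ℕ
  r : ℕ
  Aj : ℕ → ℕ → Prop
  InR : ℕ → Prop
  ρ : ℕ → ℕ
  W : ℕ → ℕ → Prop
  TA : ℕ → ℕ → Prop
  TB : ℕ → ℕ → Prop
  α : ℕ → Prop
  β : ℕ → Prop
  v₀ : ℕ
  d : ℕ
  th : ℕ

namespace Guess

variable (g : Guess)

def InA (x : ℕ) : Prop := x < g.n ∧ ¬ g.InR x ∧ (x = g.v₀ ∨ g.Aj g.v₀ x)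

def InB (x : ℕ) : Prop := x < g.n ∧ ¬ g.InR x ∧ ¬ (x = g.v₀ ∨ g.Aj g.v₀ x)

/-- `γ` tells which modulator classes have a member in the clique of `x`. -/
def Reaches (γ : ℕ → Prop) (x i : ℕ) : Prop :=
  ∀ k < g.r, k < i → γ k ∨ ∃ j < g.r, g.W k j ∧ g.Aj (g.ρ j) x

def Early (j i : ℕ) : Prop := ∃ k < g.r, k < i ∧ g.W k j

/-- The pair can stand between the modulator classes `i - 1` and `i`: both vertices see the earlier
modulator classes, and each modulator vertex in a later one sees the pair. The threshold keeps pairs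
before single vertices. -/
def PairAt (x y i : ℕ) : Prop :=
  i ≤ g.th ∧ g.Reaches g.α x i ∧ g.Reaches g.β y i ∧
    ∀ j < g.r, g.Early j i ∨ g.Aj (g.ρ j) x ∨ g.Aj (g.ρ j) y

def SingleAt (x i : ℕ) : Prop :=
  g.th ≤ i ∧ g.Reaches g.α x i ∧ ∀ j < g.r, g.Early j i ∨ g.Aj (g.ρ j) x

/-- Left nodes are the vertices of A and, as `n + k`, the place of B in the modulator class `k`.
Right nodes are the vertices of B, the place `n + k` of A in the class `k`, and `d` dummies from `2
n` on, the partners of single vertices. The disjuncts are, in order: pairs, places of A, single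
vertices, places of B. -/
def Edge (x y : ℕ) : Prop :=
  ((g.InA x ∧ g.InB y ∧ ∃ i < g.r + 1, g.PairAt x y i) ∨
    (g.InA x ∧ ∃ k < g.r, y = g.n + k ∧ g.α k ∧ ∀ j < g.r, g.Aj (g.ρ j) x ↔ g.TA k j)) ∨
  ((g.InA x ∧ g.n + g.n ≤ y ∧ y < g.n + g.n + g.d ∧ ∃ i < g.r + 1, g.SingleAt x i) ∨
    (g.InB y ∧ ∃ k < g.r, x = g.n + k ∧ g.β k ∧ ∀ j < g.r, g.Aj (g.ρ j) y ↔ g.TB k j))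

/-- The graph without the modulator consists of the two cliques `InA` and `InB`. -/
structure IsTwoCluster : Prop where
  symm : ∀ u < g.n, ∀ v < g.n, g.Aj u v → g.Aj v u
  irrefl : ∀ v < g.n, ¬ g.Aj v v
  clique_A : ∀ u v, g.InA u → g.InA v → u ≠ v → g.Aj u v
  clique_B : ∀ u v, g.InB u → g.InB v → u ≠ v → g.Aj u v
  cross : ∀ u v, g.InA u → g.InB v → ¬ g.Aj u v
  ρ_mem : ∀ j < g.r, g.ρ j < g.n ∧ g.InR (g.ρ j)
  ρ_surj : ∀ v < g.n, g.InR v → ∃ j < g.r, g.ρ j = v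
  r_le : g.r ≤ g.n

/-- `col` is a Grundy colouring with the colours below `ℓ`. -/
structure IsGrundy (col : ℕ → ℕ) (ℓ : ℕ) : Prop where
  lt : ∀ v < g.n, col v < ℓ
  surj : ∀ t < ℓ, ∃ v < g.n, col v = t
  proper : ∀ u < g.n, ∀ v < g.n, g.Aj u v → col u ≠ col v
  nbr : ∀ v < g.n, ∀ t < col v, ∃ u < g.n, col u = t ∧ g.Aj v u

/-- Some modulator vertex has the colour `t`. -/
def RCol (col : ℕ → ℕ) (t : ℕ) : Prop := ∃ j < g.r, col (g.ρ j) = t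

open Classical in
/-- The number of colours below `t` of modulator vertices. -/
noncomputable def lev (col : ℕ → ℕ) (t : ℕ) : ℕ := Nat.count (g.RCol col) t

/-- The colour class of `x` consists of `x` alone, in the clique `InA`. -/
def Single (col : ℕ → ℕ) (x : ℕ) : Prop :=
  g.InA x ∧ ¬ g.RCol col (col x) ∧ ∀ b, g.InB b → col b ≠ col x

open Classical in
/-- The guess describes the colouring. -/
structure Describes (col : ℕ → ℕ) : Prop where
  W_iff : ∀ k < g.r, ∀ j < g.r, g.W k j ↔ g.lev col (col (g.ρ j)) = k
  α_iff : ∀ k < g.r, g.α k ↔ ∃ a, g.InA a ∧ g.RCol col (col a) ∧ g.lev col (col a) = k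
  β_iff : ∀ k < g.r, g.β k ↔ ∃ a, g.InB a ∧ g.RCol col (col a) ∧ g.lev col (col a) = k
  TA_iff : ∀ k < g.r, ∀ j < g.r, g.TA k j ↔
    ∃ a, g.InA a ∧ g.RCol col (col a) ∧ g.lev col (col a) = k ∧ g.Aj (g.ρ j) a
  TB_iff : ∀ k < g.r, ∀ j < g.r, g.TB k j ↔
    ∃ a, g.InB a ∧ g.RCol col (col a) ∧ g.lev col (col a) = k ∧ g.Aj (g.ρ j) a
  d_eq : g.d = Nat.count (g.Single col) g.n
  th_single : ∀ a, g.Single col a → g.th ≤ g.lev col (col a)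
  th_pair : ∀ b, g.InB b → ¬ g.RCol col (col b) → g.lev col (col b) ≤ g.th
  th_slot : ∀ a b, g.Single col a → g.InB b → g.RCol col (col b) → g.lev col (col b) < g.th
  oriented : ∀ b, g.InB b → ¬ g.RCol col (col b) → ∃ a, g.InA a ∧ col a = col b

variable {g} {col : ℕ → ℕ} {ℓ : ℕ}

theorem lev_le (t : ℕ) : g.lev col t ≤ g.r := by
  classical
  rw [lev, Nat.count_eq_card_filter_range]
  have : (Finset.range t).filter (g.RCol col) ⊆ (Finset.range g.r).image fun j => col (g.ρ j) := by
    intro x hx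
    obtain ⟨j, hj, h⟩ := (Finset.mem_filter.1 hx).2
    exact Finset.mem_image.2 ⟨j, Finset.mem_range.2 hj, h⟩
  simpa using (Finset.card_le_card this).trans Finset.card_image_le

theorem lev_mono {t t' : ℕ} (h : t ≤ t') : g.lev col t ≤ g.lev col t' := by
  classical
  unfold lev
  exact Nat.count_monotone _ h

theorem lev_strict {t t' : ℕ} (ht : g.RCol col t) (h : t < t') : g.lev col t < g.lev col t' := by
  classical
  unfold lev
  exact Nat.count_strict_mono ht h

theorem lev_lt {t : ℕ} (ht : g.RCol col t) : g.lev col t < g.r :=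
  (lev_strict ht t.lt_succ_self).trans_le (lev_le _)

theorem lev_inj {t t' : ℕ} (ht : g.RCol col t) (ht' : g.RCol col t')
    (h : g.lev col t = g.lev col t') : t = t' := by
  rcases lt_trichotomy t t' with h' | h' | h'
  · have := lev_strict ht h'; omega
  · exact h'
  · have := lev_strict ht' h'; omega

/-- The level grows by one exactly after a modulator colour, so each smaller level is the level of
such a colour. -/
theorem exists_lev {t k : ℕ} (h : k < g.lev col t) :
    ∃ t' < t, g.RCol col t' ∧ g.lev col t' = k := by
  classical
  induction t with
  | zero => simp [lev] at h
  | succ t ih =>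
      by_cases hk : k < g.lev col t
      · obtain ⟨t', h1, h2⟩ := ih hk
        exact ⟨t', by omega, h2⟩
      · by_cases hR : g.RCol col t
        · refine ⟨t, by omega, hR, ?_⟩
          rw [lev, Nat.count_succ, if_pos hR] at h
          rw [lev] at hk ⊢
          omega
        · rw [lev, Nat.count_succ, if_neg hR] at h
          rw [lev] at hk
          omega

theorem RCol_of_InR (hc : g.IsTwoCluster) {v : ℕ} (hv : v < g.n) (h : g.InR v) :
    g.RCol col (col v) := by
  obtain ⟨j, hj, rfl⟩ := hc.ρ_surj v hv h
  exact ⟨j, hj, rfl⟩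

theorem cases (v : ℕ) (hv : v < g.n) : g.InR v ∨ g.InA v ∨ g.InB v := by
  unfold InA InB; tauto

section Colouring

variable (hc : g.IsTwoCluster) (hg : g.IsGrundy col ℓ) (hd : g.Describes col)

include hc hg

theorem A_inj {a a' : ℕ} (h : g.InA a) (h' : g.InA a') (heq : col a = col a') : a = a' := by
  by_contra hne
  exact hg.proper a h.1 a' h'.1 (hc.clique_A _ _ h h' hne) heq

theorem B_inj {a a' : ℕ} (h : g.InB a) (h' : g.InB a') (heq : col a = col a') : a = a' := by
  by_contra hne
  exact hg.proper a h.1 a' h'.1 (hc.clique_B _ _ h h' hne) heq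

include hd

/-- The neighbour that `a` has in the `k`-th modulator class lies in `R` or in A, because no edge
leads to B. -/
theorem reaches_A {a : ℕ} (ha : g.InA a) : g.Reaches g.α a (g.lev col (col a)) := by
  intro k hk hki
  obtain ⟨t, ht, hRt, rfl⟩ := exists_lev hki
  obtain ⟨u, hu, rfl, hau⟩ := hg.nbr a ha.1 t ht
  rcases cases u hu with hR | hA | hB
  · obtain ⟨j, hj, rfl⟩ := hc.ρ_surj u hu hR
    exact Or.inr ⟨j, hj, (hd.W_iff _ hk j hj).2 rfl, hc.symm _ ha.1 _ hu hau⟩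
  · exact Or.inl ((hd.α_iff _ hk).2 ⟨u, hA, hRt, rfl⟩)
  · exact absurd hau (hc.cross _ _ ha hB)

theorem reaches_B {a : ℕ} (ha : g.InB a) : g.Reaches g.β a (g.lev col (col a)) := by
  intro k hk hki
  obtain ⟨t, ht, hRt, rfl⟩ := exists_lev hki
  obtain ⟨u, hu, rfl, hau⟩ := hg.nbr a ha.1 t ht
  rcases cases u hu with hR | hA | hB
  · obtain ⟨j, hj, rfl⟩ := hc.ρ_surj u hu hR
    exact Or.inr ⟨j, hj, (hd.W_iff _ hk j hj).2 rfl, hc.symm _ ha.1 _ hu hau⟩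
  · exact absurd (hc.symm _ ha.1 _ hu hau) (hc.cross _ _ hA ha)
  · exact Or.inl ((hd.β_iff _ hk).2 ⟨u, hB, hRt, rfl⟩)

/-- A modulator vertex that is not early has a neighbour in the class of the colour `t`. -/
theorem early_or {t : ℕ} (ht : ¬ g.RCol col t) {j : ℕ} (hj : j < g.r) :
    g.Early j (g.lev col t) ∨ ∃ u < g.n, col u = t ∧ g.Aj (g.ρ j) u := by
  have hRj : g.RCol col (col (g.ρ j)) := ⟨j, hj, rfl⟩
  rcases lt_trichotomy (col (g.ρ j)) t with h | h | h
  · exact Or.inl ⟨_, lev_lt hRj, lev_strict hRj h, (hd.W_iff _ (lev_lt hRj) j hj).2 rfl⟩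
  · exact absurd (h ▸ hRj) ht
  · exact Or.inr (hg.nbr _ (hc.ρ_mem j hj).1 t h)

/-- A colour class has at most one vertex in a clique, so the guessed row `TA` describes precisely
this vertex. -/
theorem type_A {a : ℕ} (ha : g.InA a) (hR : g.RCol col (col a)) {j : ℕ} (hj : j < g.r) :
    g.Aj (g.ρ j) a ↔ g.TA (g.lev col (col a)) j := by
  rw [hd.TA_iff _ (lev_lt hR) j hj]
  refine ⟨fun h => ⟨a, ha, hR, rfl, h⟩, ?_⟩
  rintro ⟨a', ha', hR', hl, h⟩
  rwa [A_inj hc hg ha ha' (lev_inj hR hR' hl.symm)]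

theorem type_B {a : ℕ} (ha : g.InB a) (hR : g.RCol col (col a)) {j : ℕ} (hj : j < g.r) :
    g.Aj (g.ρ j) a ↔ g.TB (g.lev col (col a)) j := by
  rw [hd.TB_iff _ (lev_lt hR) j hj]
  refine ⟨fun h => ⟨a, ha, hR, rfl, h⟩, ?_⟩
  rintro ⟨a', ha', hR', hl, h⟩
  rwa [B_inj hc hg ha ha' (lev_inj hR hR' hl.symm)]

/-- For a given guess, reaching depends on a vertex only through its neighbours in `R`. So any
vertex of the right type inherits it from the vertex that fills the place in the colouring. -/
theorem slot_reaches_A {a k : ℕ} (hk : k < g.r) (hα : g.α k)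
    (ht : ∀ j < g.r, g.Aj (g.ρ j) a ↔ g.TA k j) : g.Reaches g.α a k := by
  obtain ⟨a₀, ha₀, hR, rfl⟩ := (hd.α_iff k hk).1 hα
  intro k' hk' hlt
  refine (reaches_A hc hg hd ha₀ k' hk' hlt).imp id fun ⟨j, hj, hW, h⟩ => ⟨j, hj, hW, ?_⟩
  rwa [ht j hj, ← type_A hc hg hd ha₀ hR hj]

theorem slot_reaches_B {b k : ℕ} (hk : k < g.r) (hβ : g.β k)
    (ht : ∀ j < g.r, g.Aj (g.ρ j) b ↔ g.TB k j) : g.Reaches g.β b k := by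
  obtain ⟨b₀, hb₀, hR, rfl⟩ := (hd.β_iff k hk).1 hβ
  intro k' hk' hlt
  refine (reaches_B hc hg hd hb₀ k' hk' hlt).imp id fun ⟨j, hj, hW, h⟩ => ⟨j, hj, hW, ?_⟩
  rwa [ht j hj, ← type_B hc hg hd hb₀ hR hj]

end Colouring

open Classical in
/-- The matching of the auxiliary graph that a colouring gives. -/
def Mate (g : Guess) (col : ℕ → ℕ) (x y : ℕ) : Prop :=
  ((g.InA x ∧ g.InB y ∧ ¬ g.RCol col (col x) ∧ col y = col x) ∨
    (g.InA x ∧ g.RCol col (col x) ∧ y = g.n + g.lev col (col x))) ∨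
  ((g.Single col x ∧ y = g.n + g.n + Nat.count (g.Single col) x) ∨
    (g.InB y ∧ g.RCol col (col y) ∧ x = g.n + g.lev col (col y)))

theorem Mate.exists_of_InA {x : ℕ} (hA : g.InA x) : ∃ y, g.Mate col x y := by
  classical
  by_cases hR : g.RCol col (col x)
  · exact ⟨_, Or.inl (Or.inr ⟨hA, hR, rfl⟩)⟩
  · by_cases hB : ∃ b, g.InB b ∧ col b = col x
    · obtain ⟨b, hb, hbc⟩ := hB
      exact ⟨b, Or.inl (Or.inl ⟨hA, hb, hR, hbc⟩)⟩
    · push Not at hB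
      exact ⟨_, Or.inr (Or.inl ⟨⟨hA, hR, hB⟩, rfl⟩)⟩

theorem Mate.exists_of_InB (hd : g.Describes col) {y : ℕ} (hB : g.InB y) :
    ∃ x, g.Mate col x y := by
  by_cases hR : g.RCol col (col y)
  · exact ⟨_, Or.inr (Or.inr ⟨hB, hR, rfl⟩)⟩
  · obtain ⟨a, ha, hac⟩ := hd.oriented y hB hR
    exact ⟨a, Or.inl (Or.inl ⟨ha, hB, hac ▸ hR, hac.symm⟩)⟩

/-- The edge may be unrelated to the colouring. But a place has an edge only if its bit is guessed,
and then the colouring fills this place. -/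
theorem Mate.exists_right (hd : g.Describes col) {x y : ℕ} (h : g.Edge x y) :
    ∃ y, g.Mate col x y := by
  rcases h with (⟨hA, _⟩ | ⟨hA, _⟩) | (⟨hA, _⟩ | ⟨hB, k, hk, rfl, hβ, _⟩)
  · exact exists_of_InA hA
  · exact exists_of_InA hA
  · exact exists_of_InA hA
  · obtain ⟨b, hb, hR, rfl⟩ := (hd.β_iff k hk).1 hβ
    exact ⟨b, Or.inr (Or.inr ⟨hb, hR, rfl⟩)⟩

theorem Mate.exists_left (hd : g.Describes col) {x y : ℕ} (h : g.Edge x y) : ∃ x, g.Mate col x y := by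
  classical
  rcases h with (⟨_, hB, _⟩ | ⟨_, k, hk, rfl, hα, _⟩) | (⟨_, h1, h2, _⟩ | ⟨hB, _⟩)
  · exact exists_of_InB hd hB
  · obtain ⟨a, ha, hR, rfl⟩ := (hd.α_iff k hk).1 hα
    exact ⟨a, Or.inl (Or.inr ⟨ha, hR, rfl⟩)⟩
  · rw [hd.d_eq] at h2
    have h3 : y - (g.n + g.n) < Nat.count (g.Single col) g.n := by omega
    have h4 : ∀ hf : (Set.ofPred (g.Single col)).Finite, y - (g.n + g.n) < hf.toFinset.card := by
      intro hf
      refine h3.trans_le ?_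
      rw [Nat.count_eq_card_filter_range]
      refine Finset.card_le_card fun z hz => ?_
      rw [Set.Finite.mem_toFinset]
      exact (Finset.mem_filter.1 hz).2
    -- The dummy with index `i` is mated with the `i`-th single vertex in increasing order.
    refine ⟨Nat.nth (g.Single col) (y - (g.n + g.n)), Or.inr (Or.inl ⟨Nat.nth_mem _ h4, ?_⟩)⟩
    rw [Nat.count_nth h4]
    omega
  · exact exists_of_InB hd hB

section Mate

variable (hc : g.IsTwoCluster) (hg : g.IsGrundy col ℓ) (hd : g.Describes col)

include hc

theorem Mate.lt {x y : ℕ} (h : g.Mate col x y) : x < g.n + g.n + g.n ∧ y < g.n + g.n + g.n := by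
  classical
  have hr := hc.r_le
  rcases h with (⟨hA, hB, hR, heq⟩ | ⟨hA, hR, rfl⟩) | (⟨hS, rfl⟩ | ⟨hB, hR, rfl⟩)
  · have := hA.1; have := hB.1; omega
  · have := hA.1; have := lev_lt hR; omega
  · have h1 := hS.1.1
    have h2 : Nat.count (g.Single col) x ≤ x := Nat.count_le _
    omega
  · have := hB.1; have := lev_lt hR; omega

include hg

/-- As `r ≤ n`, the ranges for vertices, places and dummies are disjoint, so only mates of the same
kind compete, apart from a vertex of B, whose kind is decided by whether its colour is a modulator
colour. Within a kind, a clique has at most one vertex of each colour and modulator colours have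
distinct levels. -/
theorem Mate.left_unique {x x' y : ℕ} (h : g.Mate col x y) (h' : g.Mate col x' y) : x = x' := by
  classical
  have hr := hc.r_le
  rcases h with (⟨hA, hB, hR, heq⟩ | ⟨hA, hR, hy⟩) | (⟨hS, hy⟩ | ⟨hB, hR, hx⟩) <;>
  rcases h' with (⟨hA', hB', hR', heq'⟩ | ⟨hA', hR', hy'⟩) | (⟨hS', hy'⟩ | ⟨hB', hR', hx'⟩)
  · exact A_inj hc hg hA hA' (heq.symm.trans heq')
  · have := hB.1; omega
  · have := hB.1; omega
  · exact absurd (heq ▸ hR') hR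
  · have := hB'.1; omega
  · exact A_inj hc hg hA hA' (lev_inj hR hR' (by omega))
  · have := lev_lt hR; omega
  · have := hB'.1; omega
  · have := hB'.1; omega
  · have := lev_lt hR'; omega
  · exact Nat.count_injective hS hS' (by omega)
  · have := hB'.1; omega
  · exact absurd (heq' ▸ hR) hR'
  · have := hB.1; omega
  · have := hB.1; omega
  · omega

theorem Mate.right_unique {x y y' : ℕ} (h : g.Mate col x y) (h' : g.Mate col x y') : y = y' := by
  classical
  have hr := hc.r_le
  rcases h with (⟨hA, hB, hR, heq⟩ | ⟨hA, hR, hy⟩) | (⟨hS, hy⟩ | ⟨hB, hR, hx⟩) <;>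
  rcases h' with (⟨hA', hB', hR', heq'⟩ | ⟨hA', hR', hy'⟩) | (⟨hS', hy'⟩ | ⟨hB', hR', hx'⟩)
  · exact B_inj hc hg hB hB' (heq.trans heq'.symm)
  · exact absurd hR' hR
  · exact absurd heq (hS'.2.2 y hB)
  · have := hA.1; omega
  · exact absurd hR hR'
  · omega
  · exact absurd hR hS'.2.1
  · have := hA.1; omega
  · exact absurd heq' (hS.2.2 y' hB')
  · exact absurd hR' hS.2.1
  · omega
  · have := hS.1.1; omega
  · have := hA'.1; omega
  · have := hA'.1; omega
  · have := hS'.1.1; omega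
  · exact B_inj hc hg hB hB' (lev_inj hR hR' (by omega))

include hd

/-- The level that the class has in the colouring witnesses that the pair or the single vertex fits.
-/
theorem Mate.edge {x y : ℕ} (h : g.Mate col x y) : g.Edge x y := by
  classical
  rcases h with (⟨hA, hB, hR, heq⟩ | ⟨hA, hR, rfl⟩) | (⟨hS, rfl⟩ | ⟨hB, hR, rfl⟩)
  · refine Or.inl (Or.inl ⟨hA, hB, g.lev col (col x), Nat.lt_succ_of_le (lev_le _), ?_, ?_, ?_, ?_⟩)
    · rw [← heq]; exact hd.th_pair y hB (heq ▸ hR)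
    · exact reaches_A hc hg hd hA
    · rw [← heq]; exact reaches_B hc hg hd hB
    · intro j hj
      rcases early_or hc hg hd hR hj with h | ⟨u, hu, huc, h⟩
      · exact Or.inl h
      · right
        rcases cases u hu with hR' | hA' | hB'
        · exact absurd (huc ▸ RCol_of_InR hc hu hR') hR
        · left; rwa [← A_inj hc hg hA' hA huc]
        · right; rwa [← B_inj hc hg hB' hB (huc.trans heq.symm)]
  · exact Or.inl (Or.inr ⟨hA, _, lev_lt hR, rfl, (hd.α_iff _ (lev_lt hR)).2 ⟨x, hA, hR, rfl⟩,
      fun j hj => type_A hc hg hd hA hR hj⟩)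
  · obtain ⟨hA, hR, hne⟩ := hS
    refine Or.inr (Or.inl ⟨hA, by omega, ?_, g.lev col (col x), Nat.lt_succ_of_le (lev_le _),
      hd.th_single x ⟨hA, hR, hne⟩, reaches_A hc hg hd hA, ?_⟩)
    · rw [hd.d_eq]
      exact Nat.add_lt_add_left (Nat.count_strict_mono ⟨hA, hR, hne⟩ hA.1) _
    · intro j hj
      rcases early_or hc hg hd hR hj with h | ⟨u, hu, huc, h⟩
      · exact Or.inl h
      · right
        rcases cases u hu with hR' | hA' | hB'
        · exact absurd (huc ▸ RCol_of_InR hc hu hR') hR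
        · rwa [← A_inj hc hg hA' hA huc]
        · exact absurd huc (hne u hB')
  · exact Or.inr (Or.inr ⟨hB, _, lev_lt hR, rfl, (hd.β_iff _ (lev_lt hR)).2 ⟨y, hB, hR, rfl⟩,
      fun j hj => type_B hc hg hd hB hR hj⟩)

theorem feasible : Auction.Feasible (g.n + g.n + g.n) g.Edge := by
  classical
  have hch : ∀ x, ∃ y, (∃ y', g.Edge x y') → g.Mate col x y := by
    intro x
    by_cases h : ∃ y', g.Edge x y'
    · obtain ⟨y', hy'⟩ := h
      obtain ⟨y, hy⟩ := Mate.exists_right hd hy'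
      exact ⟨y, fun _ => hy⟩
    · exact ⟨0, fun h' => absurd h' h⟩
  choose f hf using hch
  refine ⟨f, fun x _ ⟨y, _, hE⟩ => ?_, fun x _ x' _ ⟨y, _, hE⟩ ⟨y', _, hE'⟩ heq => ?_⟩
  · have := hf x ⟨y, hE⟩
    exact ⟨(this.lt hc).2, this.edge hc hg hd⟩
  · have h1 := hf x ⟨y, hE⟩
    have h2 := hf x' ⟨y', hE'⟩
    rw [← heq] at h2
    exact h1.left_unique hc hg h2

/-- Mates inject the right nodes that have an edge into the left nodes that have an edge, so
saturating the left side saturates the right side as well. -/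
theorem full_right {m : ℕ → ℕ} (hm : Auction.Matched (g.n + g.n + g.n) g.Edge m) {x y : ℕ}
    (hE : g.Edge x y) : ∃ x, x < g.n + g.n + g.n ∧ g.Edge x y ∧ m y = x + 1 := by
  classical
  have hch : ∀ y, ∃ x, (∃ x', g.Edge x' y) → g.Mate col x y := by
    intro y
    by_cases h : ∃ x', g.Edge x' y
    · obtain ⟨x', hx'⟩ := h
      obtain ⟨x, hx⟩ := Mate.exists_left hd hx'
      exact ⟨x, fun _ => hx⟩
    · exact ⟨0, fun h' => absurd h' h⟩
  choose f hf using hch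
  have h0 := hf y ⟨x, hE⟩
  refine hm.full_right (f := f) (fun y _ ⟨x, _, hE⟩ => ?_)
    (fun y _ y' _ ⟨x, _, hE⟩ ⟨x', _, hE'⟩ heq => ?_) (h0.lt hc).2
    ⟨f y, (h0.lt hc).1, h0.edge hc hg hd⟩
  · have := hf y ⟨x, hE⟩
    exact ⟨(this.lt hc).1, y, (this.lt hc).2, this.edge hc hg hd⟩
  · have h1 := hf y ⟨x, hE⟩
    have h2 := hf y' ⟨x', hE'⟩
    rw [← heq] at h2
    exact h1.right_unique hc hg h2

end Mate

end Guess

/-! ### Classes from a matching, and their independence -/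

namespace Guess

variable {g : Guess} {col : ℕ → ℕ} {ℓ : ℕ} {m lab : ℕ → ℕ}

/-- The labels of the vertices that a matching gives: `n + k` for the members of the `k`-th modulator
class, and the vertex in `InA` for the other classes. -/
structure IsLabelling (g : Guess) (m lab : ℕ → ℕ) : Prop where
  modulator : ∀ v < g.n, g.InR v →
    (∃ k < g.r, (∃ j < g.r, g.ρ j = v ∧ g.W k j) ∧ lab v = g.n + k) ∨
      ∀ k < g.r, ∀ j < g.r, g.ρ j = v → ¬ g.W k j
  left : ∀ v, g.InA v → (∃ k < g.r, m (g.n + k) = v + 1 ∧ lab v = g.n + k) ∨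
    ((∀ k < g.r, m (g.n + k) ≠ v + 1) ∧ lab v = v)
  right : ∀ v, g.InB v → lab v = m v - 1

section Labels

variable (hc : g.IsTwoCluster) (hg : g.IsGrundy col ℓ) (hd : g.Describes col)
  (hm : Auction.Matched (g.n + g.n + g.n) g.Edge m) (hl : g.IsLabelling m lab)

include hc hd hl

theorem lab_modulator {v : ℕ} (hv : v < g.n) (hR : g.InR v) :
    lab v = g.n + g.lev col (col v) := by
  obtain ⟨j, hj, rfl⟩ := hc.ρ_surj v hv hR
  rcases hl.modulator _ hv hR with ⟨k, hk, ⟨j', hj', heq, hW⟩, h⟩ | h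
  · rw [h, ← (hd.W_iff k hk j' hj').1 hW, heq]
  · exact absurd ((hd.W_iff _ (lev_lt ⟨j, hj, rfl⟩) j hj).2 rfl)
      (h _ (lev_lt ⟨j, hj, rfl⟩) j hj rfl)

theorem lab_of_W {k j : ℕ} (hk : k < g.r) (hj : j < g.r) (hW : g.W k j) :
    lab (g.ρ j) = g.n + k := by
  obtain ⟨h1, h2⟩ := hc.ρ_mem j hj
  rw [lab_modulator hc hd hl h1 h2, (hd.W_iff k hk j hj).1 hW]

include hm hg

/-- A vertex of A has a mate, hence an edge, hence owns exactly one right node. The cases are the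
kinds of this node: a place, a vertex of B, or a dummy, whose existence makes `d` positive. -/
theorem lab_A {a : ℕ} (ha : g.InA a) :
    (∃ k < g.r, lab a = g.n + k ∧ m (g.n + k) = a + 1 ∧ g.α k ∧
      ∀ j < g.r, g.Aj (g.ρ j) a ↔ g.TA k j) ∨
    (lab a = a ∧ ∃ b i, g.InB b ∧ m b = a + 1 ∧ g.PairAt a b i) ∨
    (lab a = a ∧ 0 < g.d ∧ (∀ b, g.InB b → m b ≠ a + 1) ∧ ∃ i, g.SingleAt a i) := by
  have hr := hc.r_le
  have haN : a < g.n + g.n + g.n := by have := ha.1; omega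
  obtain ⟨y₀, hy₀⟩ := Mate.exists_of_InA (col := col) ha
  obtain ⟨y, hy, hym⟩ := hm.full a haN ⟨y₀, (hy₀.lt hc).2, hy₀.edge hc hg hd⟩
  have huniq : ∀ y' < g.n + g.n + g.n, m y' = a + 1 → y' = y := fun y' hy' h =>
    hm.inj y' hy' y hy (by omega) (by omega)
  have hlab : (g.n + g.r ≤ y ∨ y < g.n) → lab a = a := by
    intro hy'
    rcases hl.left a ha with ⟨k, hk, h, _⟩ | h
    · have := huniq _ (by omega) h; omega
    · exact h.2
  rcases (hm.edge y hy a hym).2 with (⟨_, hB, i, _, hi⟩ | ⟨_, k, hk, rfl, hα, ht⟩) |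
    (⟨_, h1, h2, i, _, hi⟩ | ⟨hB, k, hk, rfl, _⟩)
  · exact Or.inr (Or.inl ⟨hlab (Or.inr hB.1), y, i, hB, hym, hi⟩)
  · refine Or.inl ⟨k, hk, ?_, hym, hα, ht⟩
    rcases hl.left a ha with ⟨k', hk', h, h'⟩ | h
    · have := huniq _ (by omega) h
      rw [h']; omega
    · exact absurd hym (h.1 k hk)
  · refine Or.inr (Or.inr ⟨hlab (Or.inl (by omega)), by omega, fun b hb h => ?_, i, hi⟩)
    have := huniq b (by have := hb.1; omega) h
    have := hb.1
    omega
  · have := ha.1; omega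

/-- By `full_right` every vertex of B has an owner, and the owner is its label: a vertex of A, or a
place `n + k`, which has the same number as the label of the modulator class `k`. -/
theorem lab_B {b : ℕ} (hb : g.InB b) : m b ≠ 0 ∧
    ((∃ k < g.r, lab b = g.n + k ∧ g.β k ∧ ∀ j < g.r, g.Aj (g.ρ j) b ↔ g.TB k j) ∨
    (∃ a i, g.InA a ∧ lab b = a ∧ lab a = a ∧ m b = a + 1 ∧ g.PairAt a b i)) := by
  have hr := hc.r_le
  obtain ⟨x₀, hx₀⟩ := Mate.exists_of_InB hd hb
  obtain ⟨x, hx, hE, hmx⟩ := full_right hc hg hd hm (hx₀.edge hc hg hd)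
  have hlb := hl.right b hb
  have hbn := hb.1
  refine ⟨by omega, ?_⟩
  rcases hE with (⟨hA, hB, i, _, hi⟩ | ⟨_, k, hk, rfl, hα, ht⟩) |
    (⟨_, h1, h2, i, _, hi⟩ | ⟨hB, k, hk, rfl, hβ, ht⟩)
  · refine Or.inr ⟨x, i, hA, by omega, ?_, hmx, hi⟩
    rcases hl.left x hA with ⟨k, hk, h, h'⟩ | h
    · have := hm.inj (g.n + k) (by omega) b (by omega) (by omega) (by omega)
      omega
    · exact h.2
  · omega
  · omega
  · exact Or.inl ⟨k, hk, by omega, hβ, ht⟩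

/-- The colouring fills the place, so its node has an edge and is owned, possibly by a different
vertex, but one of the same type. -/
theorem slot_A {k : ℕ} (hk : k < g.r) (hα : g.α k) :
    ∃ a, g.InA a ∧ lab a = g.n + k ∧ ∀ j < g.r, g.Aj (g.ρ j) a ↔ g.TA k j := by
  have hr := hc.r_le
  obtain ⟨a₀, ha₀, hR, hlev⟩ := (hd.α_iff k hk).1 hα
  have hM : g.Mate col a₀ (g.n + k) := Or.inl (Or.inr ⟨ha₀, hR, by rw [hlev]⟩)
  obtain ⟨a, _, hE, hma⟩ := full_right hc hg hd hm (hM.edge hc hg hd)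
  rcases hE with (⟨_, hB, _⟩ | ⟨hA, k', hk', heq, _, ht⟩) | (⟨_, h1, _⟩ | ⟨hB, _⟩)
  · have := hB.1; omega
  · obtain rfl : k = k' := by omega
    refine ⟨a, hA, ?_, ht⟩
    rcases hl.left a hA with ⟨k', hk', h, h'⟩ | h
    · have := hm.inj (g.n + k') (by omega) (g.n + k) (by omega) (by omega) (by omega)
      rw [h', this]
    · exact absurd hma (h.1 k hk)
  · omega
  · have := hB.1; omega

theorem slot_B {k : ℕ} (hk : k < g.r) (hβ : g.β k) :
    ∃ b, g.InB b ∧ lab b = g.n + k ∧ ∀ j < g.r, g.Aj (g.ρ j) b ↔ g.TB k j := by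
  have hr := hc.r_le
  obtain ⟨b₀, hb₀, hR, hlev⟩ := (hd.β_iff k hk).1 hβ
  have hM : g.Mate col (g.n + k) b₀ := Or.inr (Or.inr ⟨hb₀, hR, by rw [hlev]⟩)
  obtain ⟨b, hb, hmb⟩ := hm.full (g.n + k) (by omega) ⟨b₀, (hM.lt hc).2, hM.edge hc hg hd⟩
  rcases (hm.edge b hb _ hmb).2 with (⟨hA, _⟩ | ⟨hA, _⟩) | (⟨hA, _⟩ | ⟨hB, k', hk', heq, _, ht⟩)
  · have := hA.1; omega
  · have := hA.1; omega
  · have := hA.1; omega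
  · obtain rfl : k = k' := by omega
    exact ⟨b, hB, by rw [hl.right b hB, hmb]; omega, ht⟩

/-- Vertices with the same label are not adjacent. -/
theorem lab_independent {v w : ℕ} (hv : v < g.n) (hw : w < g.n) (heq : lab v = lab w) :
    ¬ g.Aj v w := by
  -- The vertex `w` has the type of the vertex that fills this place in the colouring, so an edge
  -- from `v` to `w` would yield an edge inside a colour class.
  have hRA : ∀ v w, v < g.n → g.InR v → g.InA w → lab v = lab w → ¬ g.Aj v w := by
    intro v w hv hR hA heq hvw
    rw [lab_modulator hc hd hl hv hR] at heq
    have hw := hA.1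
    rcases lab_A hc hg hd hm hl hA with ⟨k, hk, h1, _, hα, ht⟩ | ⟨h1, _⟩ | ⟨h1, _⟩
    · obtain ⟨j, hj, rfl⟩ := hc.ρ_surj v hv hR
      obtain ⟨a, ha, hRa, hlev, haj⟩ := (hd.TA_iff k hk j hj).1 ((ht j hj).1 hvw)
      exact hg.proper _ hv _ ha.1 haj
        (lev_inj (RCol_of_InR hc hv hR) hRa (by omega))
    · omega
    · omega
  have hRB : ∀ v w, v < g.n → g.InR v → g.InB w → lab v = lab w → ¬ g.Aj v w := by
    intro v w hv hR hB heq hvw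
    rw [lab_modulator hc hd hl hv hR] at heq
    rcases (lab_B hc hg hd hm hl hB).2 with ⟨k, hk, h1, hβ, ht⟩ | ⟨a, _, hA, h1, _⟩
    · obtain ⟨j, hj, rfl⟩ := hc.ρ_surj v hv hR
      obtain ⟨a, ha, hRa, hlev, haj⟩ := (hd.TB_iff k hk j hj).1 ((ht j hj).1 hvw)
      exact hg.proper _ hv _ ha.1 haj
        (lev_inj (RCol_of_InR hc hv hR) hRa (by omega))
    · have := hA.1; omega
  have hAA : ∀ v w, g.InA v → g.InA w → lab v = lab w → v = w := by
    intro v w hA hA' heq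
    have hvn := hA.1
    have hwn := hA'.1
    have h1 := lab_A hc hg hd hm hl hA
    have h2 := lab_A hc hg hd hm hl hA'
    rcases h1 with ⟨k, hk, h1, h3, _⟩ | ⟨h1, _⟩ | ⟨h1, _⟩ <;>
      rcases h2 with ⟨k', hk', h2, h4, _⟩ | ⟨h2, _⟩ | ⟨h2, _⟩ <;> try omega
    obtain rfl : k = k' := by omega
    omega
  intro hvw
  have hwv := hc.symm v hv w hw hvw
  rcases cases v hv with hR | hA | hB <;> rcases cases w hw with hR' | hA' | hB'
  · rw [lab_modulator hc hd hl hv hR, lab_modulator hc hd hl hw hR'] at heq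
    exact hg.proper v hv w hw hvw
      (lev_inj (RCol_of_InR hc hv hR) (RCol_of_InR hc hw hR') (by omega))
  · exact hRA v w hv hR hA' heq hvw
  · exact hRB v w hv hR hB' heq hvw
  · exact hRA w v hw hR' hA heq.symm hwv
  · rw [hAA v w hA hA' heq] at hvw
    exact hc.irrefl w hw hvw
  · exact hc.cross v w hA hB' hvw
  · exact hRB w v hw hR' hB heq.symm hwv
  · exact hc.cross w v hA' hB hwv
  · have h1 := (lab_B hc hg hd hm hl hB).1
    have h2 := (lab_B hc hg hd hm hl hB').1
    rw [hl.right v hB, hl.right w hB'] at heq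
    have := hm.inj v (by omega) w (by omega) h1 (by omega)
    rw [this] at hvw
    exact hc.irrefl w hw hvw

end Labels

end Guess

/-! ### The order of the classes, domination and counting -/

namespace Guess

variable {g : Guess} {col : ℕ → ℕ} {ℓ : ℕ} {m lab key : ℕ → ℕ}

/-- An order of the labels: the pairs at level `i`, then the single vertices at level `i`, then the
modulator class `i`. -/
structure IsKey (g : Guess) (m lab key : ℕ → ℕ) : Prop where
  modulator : ∀ k, key (g.n + k) = 3 * k + 2
  other : ∀ a, g.InA a → lab a = a →
    (∃ b i, g.InB b ∧ m b = a + 1 ∧ g.PairAt a b i ∧ key a = 3 * i) ∨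
    (0 < g.d ∧ (∀ b, g.InB b → m b ≠ a + 1) ∧ ∃ i, g.SingleAt a i ∧ key a = 3 * i + 1)

theorem key_pair (hm : Auction.Matched (g.n + g.n + g.n) g.Edge m) (hk : g.IsKey m lab key)
    {a b : ℕ} (ha : g.InA a) (hla : lab a = a) (hb : g.InB b) (hmb : m b = a + 1) :
    ∃ i, g.PairAt a b i ∧ key a = 3 * i := by
  rcases hk.other a ha hla with ⟨b', i, hb', hmb', hp, hi⟩ | ⟨_, h, _⟩
  · have h1 := hb.1
    have h2 := hb'.1
    rw [hm.inj b (by omega) b' (by omega) (by omega) (by omega)]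
    exact ⟨i, hp, hi⟩
  · exact absurd hmb (h b hb)

section Order

variable (hc : g.IsTwoCluster) (hg : g.IsGrundy col ℓ) (hd : g.Describes col)
  (hm : Auction.Matched (g.n + g.n + g.n) g.Edge m) (hl : g.IsLabelling m lab)

include hc hg hd hm hl

/-- Each pair or single vertex takes any level at which it fits. These choices are independent and
need not agree with the levels in the colouring. -/
theorem exists_key : ∃ key, g.IsKey m lab key := by
  classical
  have h : ∀ a, ∃ q, g.InA a → lab a = a →
      (∃ b i, g.InB b ∧ m b = a + 1 ∧ g.PairAt a b i ∧ q = 3 * i) ∨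
      (0 < g.d ∧ (∀ b, g.InB b → m b ≠ a + 1) ∧ ∃ i, g.SingleAt a i ∧ q = 3 * i + 1) := by
    intro a
    by_cases ha : g.InA a
    · rcases lab_A hc hg hd hm hl ha with ⟨k, hk, h, _⟩ | ⟨_, b, i, hB, hmb, hp⟩ |
        ⟨_, h0, hb, i, hs⟩
      · exact ⟨0, fun _ h' => by have := ha.1; omega⟩
      · exact ⟨3 * i, fun _ _ => Or.inl ⟨b, i, hB, hmb, hp, rfl⟩⟩
      · exact ⟨3 * i + 1, fun _ _ => Or.inr ⟨h0, hb, i, hs, rfl⟩⟩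
    · exact ⟨0, fun h => absurd h ha⟩
  choose q hq using h
  refine ⟨fun X => if g.n ≤ X then 3 * (X - g.n) + 2 else q X, fun k => ?_, fun a ha hla => ?_⟩
  · simp
  · have := ha.1
    rw [if_neg (by omega)]
    exact hq a ha hla

theorem lab_cases {v : ℕ} (hv : v < g.n) :
    (∃ t, g.RCol col t ∧ lab v = g.n + g.lev col t) ∨ ∃ a, g.InA a ∧ lab a = a ∧ lab v = a := by
  rcases cases v hv with hR | hA | hB
  · exact Or.inl ⟨_, RCol_of_InR hc hv hR, lab_modulator hc hd hl hv hR⟩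
  · rcases lab_A hc hg hd hm hl hA with ⟨k', hk', h, _, hα, ht⟩ | ⟨h, _⟩ | ⟨h, _⟩
    · obtain ⟨a, _, hR, rfl⟩ := (hd.α_iff k' hk').1 hα
      exact Or.inl ⟨_, hR, h⟩
    · exact Or.inr ⟨v, hA, h, h⟩
    · exact Or.inr ⟨v, hA, h, h⟩
  · rcases (lab_B hc hg hd hm hl hB).2 with ⟨k', hk', h, hβ, _⟩ | ⟨a', _, ha', h, hla', hmw, _⟩
    · obtain ⟨a, _, hR, rfl⟩ := (hd.β_iff k' hk').1 hβ
      exact Or.inl ⟨_, hR, h⟩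
    · exact Or.inr ⟨a', ha', hla', h⟩

variable (hk : g.IsKey m lab key)

include hk

/-- Keys at level `i` are `3 i`, `3 i + 1` and `3 i + 2`. So a key of at least `3 k + 2` outside the
modulator class `k` means a level above `k`. -/
theorem key_reaches_A {w k : ℕ} (hw : g.InA w) (hne : lab w ≠ g.n + k)
    (hle : 3 * k + 2 ≤ key (lab w)) : ∃ i, k < i ∧ g.Reaches g.α w i := by
  have other : lab w = w → ∃ i, k < i ∧ g.Reaches g.α w i := by
    intro h
    rw [h] at hle
    rcases hk.other w hw h with ⟨b, i, _, _, hp, hi⟩ | ⟨_, _, i, hs, hi⟩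
    · exact ⟨i, by omega, hp.2.1⟩
    · exact ⟨i, by omega, hs.2.1⟩
  rcases lab_A hc hg hd hm hl hw with ⟨k', hk', h, _, hα, ht⟩ | ⟨h, _⟩ | ⟨h, _⟩
  · rw [h, hk.modulator] at hle
    exact ⟨k', by omega, slot_reaches_A hc hg hd hk' hα ht⟩
  · exact other h
  · exact other h

theorem key_reaches_B {w k : ℕ} (hw : g.InB w) (hne : lab w ≠ g.n + k)
    (hle : 3 * k + 2 ≤ key (lab w)) : ∃ i, k < i ∧ g.Reaches g.β w i := by
  rcases (lab_B hc hg hd hm hl hw).2 with ⟨k', hk', h, hβ, ht⟩ | ⟨a, _, ha, h, hla, hmw, _⟩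
  · rw [h, hk.modulator] at hle
    exact ⟨k', by omega, slot_reaches_B hc hg hd hk' hβ ht⟩
  · obtain ⟨i, hp, hi⟩ := key_pair hm hk ha hla hw hmw
    rw [h] at hle
    exact ⟨i, by omega, hp.2.2.1⟩

/-- A modulator class dominates the later classes. -/
theorem modulator_dominates {t w : ℕ} (ht : g.RCol col t) (hw : w < g.n)
    (hne : lab w ≠ g.n + g.lev col t) (hle : 3 * g.lev col t + 2 ≤ key (lab w)) :
    ∃ u < g.n, lab u = g.n + g.lev col t ∧ g.Aj w u := by
  have hlt := lev_lt ht
  rcases cases w hw with hR | hA | hB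
  · rw [lab_modulator hc hd hl hw hR] at hle hne
    rw [hk.modulator] at hle
    have htw : t < col w := by
      by_contra hcon
      have := lev_mono (g := g) (col := col) (not_lt.1 hcon)
      omega
    obtain ⟨u, hu, rfl, hwu⟩ := hg.nbr w hw t htw
    obtain ⟨j, hj, rfl⟩ := hc.ρ_surj w hw hR
    rcases cases u hu with hR' | hA' | hB'
    · exact ⟨u, hu, lab_modulator hc hd hl hu hR', hwu⟩
    -- The neighbour `u` of `w` may have another label now, but the vertex that fills its place has
    -- the same neighbours in `R`.
    · obtain ⟨a, ha, hla, hta⟩ := slot_A hc hg hd hm hl hlt ((hd.α_iff _ hlt).2 ⟨u, hA', ht, rfl⟩)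
      exact ⟨a, ha.1, hla, (hta j hj).2 ((type_A hc hg hd hA' ht hj).1 hwu)⟩
    · obtain ⟨b, hb, hlb, htb⟩ := slot_B hc hg hd hm hl hlt ((hd.β_iff _ hlt).2 ⟨u, hB', ht, rfl⟩)
      exact ⟨b, hb.1, hlb, (htb j hj).2 ((type_B hc hg hd hB' ht hj).1 hwu)⟩
  · obtain ⟨i, hi, hreach⟩ := key_reaches_A hc hg hd hm hl hk hA hne hle
    rcases hreach _ hlt hi with hα | ⟨j, hj, hW, hjw⟩
    · obtain ⟨a, ha, hla, _⟩ := slot_A hc hg hd hm hl hlt hα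
      exact ⟨a, ha.1, hla, hc.clique_A w a hA ha fun h => hne (h ▸ hla)⟩
    · exact ⟨_, (hc.ρ_mem j hj).1, lab_of_W hc hd hl hlt hj hW,
        hc.symm _ (hc.ρ_mem j hj).1 _ hw hjw⟩
  · obtain ⟨i, hi, hreach⟩ := key_reaches_B hc hg hd hm hl hk hB hne hle
    rcases hreach _ hlt hi with hα | ⟨j, hj, hW, hjw⟩
    · obtain ⟨a, ha, hla, _⟩ := slot_B hc hg hd hm hl hlt hα
      exact ⟨a, ha.1, hla, hc.clique_B w a hB ha fun h => hne (h ▸ hla)⟩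
    · exact ⟨_, (hc.ρ_mem j hj).1, lab_of_W hc hd hl hlt hj hW,
        hc.symm _ (hc.ρ_mem j hj).1 _ hw hjw⟩

/-- A class without modulator vertices dominates the later classes. -/
theorem other_dominates {a w : ℕ} (ha : g.InA a) (hla : lab a = a) (hw : w < g.n)
    (hne : lab w ≠ a) (hle : key a ≤ key (lab w)) : ∃ u < g.n, lab u = a ∧ g.Aj w u := by
  -- A modulator vertex is not early at levels up to that of its own class. So the fitting condition
  -- of an earlier class gives it a neighbour there.
  have hearly : ∀ j < g.r, ∀ i, g.ρ j = w → i ≤ g.lev col (col w) → ¬ g.Early j i := by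
    rintro j hj i rfl hi ⟨k, hk', hki, hW⟩
    have := (hd.W_iff k hk' j hj).1 hW
    omega
  have hkeyR : g.InR w → key (lab w) = 3 * g.lev col (col w) + 2 := fun hR => by
    rw [lab_modulator hc hd hl hw hR, hk.modulator]
  have hA' : g.InA w → ∃ u < g.n, lab u = a ∧ g.Aj w u := fun hA =>
    ⟨a, ha.1, hla, hc.clique_A w a hA ha fun h => hne (by rw [h, hla])⟩
  rcases hk.other a ha hla with ⟨b, i, hb, hmb, hp, hi⟩ | ⟨h0, _, i, hs, hi⟩
  · have hlb : lab b = a := by rw [hl.right b hb, hmb]; rfl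
    rcases cases w hw with hR | hA | hB
    · have := hkeyR hR
      obtain ⟨j, hj, hjw⟩ := hc.ρ_surj w hw hR
      rcases hp.2.2.2 j hj with h | h | h
      · exact absurd h (hearly j hj i hjw (by omega))
      · exact ⟨a, ha.1, hla, hjw ▸ h⟩
      · exact ⟨b, hb.1, hlb, hjw ▸ h⟩
    · exact hA' hA
    · exact ⟨b, hb.1, hlb, hc.clique_B w b hB hb fun h => hne (h ▸ hlb)⟩
  · rcases cases w hw with hR | hA | hB
    · have := hkeyR hR
      obtain ⟨j, hj, hjw⟩ := hc.ρ_surj w hw hR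
      rcases hs.2.2 j hj with h | h
      · exact absurd h (hearly j hj i hjw (by omega))
      · exact ⟨a, ha.1, hla, hjw ▸ h⟩
    · exact hA' hA
    -- No vertex of B comes after a single vertex: places of B are below the threshold, pairs are at
    -- most at it, and single vertices at least.
    · classical
      exfalso
      have hth := hs.1
      rcases (lab_B hc hg hd hm hl hB).2 with ⟨k', hk', h, hβ, _⟩ | ⟨a', _, ha', h, hla', hmw, _⟩
      · rw [h, hk.modulator] at hle
        obtain ⟨b₀, hb₀, hR₀, hlev⟩ := (hd.β_iff k' hk').1 hβ
        -- Positivity of `d` provides a single vertex of the colouring; without one the threshold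
        -- would not bound the places of B.
        obtain ⟨s, hs'⟩ : ∃ s, g.Single col s := by
          by_contra! hcon
          rw [hd.d_eq, Nat.count_eq_card_filter_range] at h0
          obtain ⟨s, hs'⟩ := Finset.card_pos.1 h0
          exact hcon s (Finset.mem_filter.1 hs').2
        have := hd.th_slot s b₀ hs' hb₀ hR₀
        omega
      · obtain ⟨i', hp, hi'⟩ := key_pair hm hk ha' hla' hB hmw
        have := hp.1
        rw [h] at hle
        omega

theorem lab_dominates {v w : ℕ} (hv : v < g.n) (hw : w < g.n) (hne : lab v ≠ lab w)
    (hle : key (lab v) ≤ key (lab w)) : ∃ u < g.n, lab u = lab v ∧ g.Aj w u := by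
  rcases lab_cases hc hg hd hm hl hv with ⟨t, ht, h⟩ | ⟨a, ha, hla, h⟩
  · rw [h] at hne hle ⊢
    rw [hk.modulator] at hle
    exact modulator_dominates hc hg hd hm hl hk ht hw hne.symm hle
  · rw [h] at hne hle ⊢
    exact other_dominates hc hg hd hm hl hk ha hla hw hne.symm hle

end Order

/-- There are at least as many labels as colours. -/
theorem le_card_labels (hc : g.IsTwoCluster) (hg : g.IsGrundy col ℓ) (hd : g.Describes col)
    (hm : Auction.Matched (g.n + g.n + g.n) g.Edge m) (hl : g.IsLabelling m lab) :
    ℓ ≤ ((Finset.range g.n).image lab).card := by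
  classical
  set V := Finset.range g.n
  set A := V.filter g.InA
  set K := (Finset.range g.r).filter g.α
  set C := (Finset.range ℓ).filter (g.RCol col)
  set C' := (Finset.range ℓ).filter fun t => ¬ g.RCol col t
  set AR := A.filter fun a => g.RCol col (col a)
  set AR' := A.filter fun a => ¬ g.RCol col (col a)
  set AF := A.filter fun a => lab a = a
  set AF' := A.filter fun a => ¬ lab a = a
  have hA : ∀ a, a ∈ A ↔ g.InA a := fun a => by
    simp only [A, V, Finset.mem_filter, Finset.mem_range]
    exact ⟨fun h => h.2, fun h => ⟨h.1, h⟩⟩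
  have h1 : C.card + C'.card = ℓ := by
    have := Finset.card_filter_add_card_filter_not (s := Finset.range ℓ) (g.RCol col)
    rwa [Finset.card_range] at this
  have h2 : AR.card + AR'.card = A.card :=
    Finset.card_filter_add_card_filter_not (s := A) _
  have h3 : AF.card + AF'.card = A.card :=
    Finset.card_filter_add_card_filter_not (s := A) _
  have h4 : C'.card ≤ AR'.card := by
    -- By the orientation, A meets every class without modulator vertices.
    have : C' ⊆ AR'.image col := by
      intro t ht
      obtain ⟨htl, htR⟩ := Finset.mem_filter.1 ht
      obtain ⟨v, hv, rfl⟩ := hg.surj t (Finset.mem_range.1 htl)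
      rcases cases v hv with hR | hvA | hvB
      · exact absurd (RCol_of_InR hc hv hR) htR
      · exact Finset.mem_image.2 ⟨v, Finset.mem_filter.2 ⟨(hA v).2 hvA, htR⟩, rfl⟩
      · obtain ⟨a, ha, hac⟩ := hd.oriented v hvB htR
        exact Finset.mem_image.2 ⟨a, Finset.mem_filter.2 ⟨(hA a).2 ha, hac ▸ htR⟩, hac⟩
    exact (Finset.card_le_card this).trans Finset.card_image_le
  have h5 : K.card ≤ AR.card := by
    have : K ⊆ AR.image fun a => g.lev col (col a) := by
      intro k hk
      obtain ⟨hkr, hα⟩ := Finset.mem_filter.1 hk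
      obtain ⟨a, ha, hR, hlev⟩ := (hd.α_iff k (Finset.mem_range.1 hkr)).1 hα
      exact Finset.mem_image.2 ⟨a, Finset.mem_filter.2 ⟨(hA a).2 ha, hR⟩, hlev⟩
    exact (Finset.card_le_card this).trans Finset.card_image_le
  have hslot : ∀ a ∈ AF', ∃ k < g.r, lab a = g.n + k ∧ m (g.n + k) = a + 1 ∧ g.α k := by
    intro a ha
    obtain ⟨haA, hla⟩ := Finset.mem_filter.1 ha
    rcases lab_A hc hg hd hm hl ((hA a).1 haA) with ⟨k, hk, h, h', hα, _⟩ | ⟨h, _⟩ | ⟨h, _⟩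
    · exact ⟨k, hk, h, h', hα⟩
    · exact absurd h hla
    · exact absurd h hla
  have h6 : AF'.card ≤ K.card := by
    refine Finset.card_le_card_of_injOn (fun a => lab a - g.n) ?_ ?_
    · intro a ha
      obtain ⟨k, hk, h, _, hα⟩ := hslot a ha
      simp only [h, Nat.add_sub_cancel_left]
      exact Finset.mem_coe.2 (Finset.mem_filter.2 ⟨Finset.mem_range.2 hk, hα⟩)
    · intro a ha a' ha' heq
      obtain ⟨k, hk, h, hma, hα⟩ := hslot a ha
      obtain ⟨k', hk', h', hma', hα'⟩ := hslot a' ha'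
      simp only [h, h', Nat.add_sub_cancel_left] at heq
      subst heq
      omega
  have h7 : C.card + AF.card ≤ (V.image lab).card := by
    have hdisj : Disjoint (C.image fun t => g.n + g.lev col t) AF := by
      rw [Finset.disjoint_left]
      intro x hx hx'
      obtain ⟨t, _, rfl⟩ := Finset.mem_image.1 hx
      have := ((hA _).1 (Finset.mem_filter.1 hx').1).1
      omega
    have hinj : (C.image fun t => g.n + g.lev col t).card = C.card := by
      refine Finset.card_image_of_injOn fun t ht t' ht' heq => ?_
      have heq' : g.n + g.lev col t = g.n + g.lev col t' := heq
      exact lev_inj (Finset.mem_filter.1 ht).2 (Finset.mem_filter.1 ht').2 (by omega)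
    rw [← hinj, ← Finset.card_union_of_disjoint hdisj]
    refine Finset.card_le_card (Finset.union_subset ?_ ?_)
    · intro x hx
      obtain ⟨t, ht, rfl⟩ := Finset.mem_image.1 hx
      obtain ⟨j, hj, rfl⟩ := (Finset.mem_filter.1 ht).2
      obtain ⟨h8, h9⟩ := hc.ρ_mem j hj
      exact Finset.mem_image.2 ⟨g.ρ j, Finset.mem_range.2 h8, lab_modulator hc hd hl h8 h9⟩
    · intro a ha
      obtain ⟨haA, hla⟩ := Finset.mem_filter.1 ha
      exact Finset.mem_image.2 ⟨a, Finset.mem_range.2 ((hA a).1 haA).1, hla⟩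
  -- Each place of A takes up at most one vertex under the matching and at least one in the
  -- colouring, so `AF.card = A.card - AF'.card ≥ A.card - K.card ≥ A.card - AR.card = AR'.card ≥
  -- C'.card`.
  omega

end Guess

/-! ### Reading the guess from a state; the table of edges -/

namespace RAM

/-- The guess that a state holds. -/
def guessOf (σ : State) : Guess where
  n := σ.reg 0
  r := σ.reg 2
  Aj u w := σ.arr 0 (u * σ.reg 0 + w) ≠ 0
  InR v := σ.arr 1 v ≠ 0
  ρ := σ.arr 3
  W k j := σ.arr 4 ((k * 6 + 0) * σ.reg 2 + j) ≠ 0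
  TA k j := σ.arr 4 ((k * 6 + 1) * σ.reg 2 + j) ≠ 0
  TB k j := σ.arr 4 ((k * 6 + 2) * σ.reg 2 + j) ≠ 0
  α k := σ.arr 4 ((k * 6 + 3) * σ.reg 2 + 0) ≠ 0
  β k := σ.arr 4 ((k * 6 + 4) * σ.reg 2 + 0) ≠ 0
  v₀ := σ.reg 10
  d := σ.reg 11
  th := σ.reg 12

/-- The statement keeps everything that the guess depends on. -/
def Stmt.keepsGuess (p : Stmt) : Bool :=
  !(p.assigns 0 || p.assigns 2 || p.assigns 10 || p.assigns 11 || p.assigns 12 ||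
    p.writes 0 || p.writes 1 || p.writes 3 || p.writes 4)

theorem Stmt.Frame.guessOf_eq {p : Stmt} {σ τ : State} (h : p.Frame σ τ)
    (hp : p.keepsGuess = true) : guessOf τ = guessOf σ := by
  simp only [Stmt.keepsGuess, Bool.not_eq_true', Bool.or_eq_false_iff] at hp
  obtain ⟨⟨⟨⟨⟨⟨⟨⟨h0, h2⟩, h10⟩, h11⟩, h12⟩, a0⟩, a1⟩, a3⟩, a4⟩ := hp
  simp only [guessOf, h.reg _ h0, h.reg _ h2, h.reg _ h10, h.reg _ h11, h.reg _ h12, h.arr _ a0,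
    h.arr _ a1, h.arr _ a3, h.arr _ a4]

theorem Stmt.run_guessOf (p : Stmt) (hp : p.keepsGuess = true) (σ : State) :
    guessOf (p.run σ) = guessOf σ := (p.frame σ).guessOf_eq hp

/-- The constant registers have their values. -/
structure Consts (σ : State) : Prop where
  two_le : 2 ≤ σ.reg 0
  r_le : σ.reg 2 ≤ σ.reg 0
  r3 : σ.reg 3 = σ.reg 2 + 1
  r4 : σ.reg 4 = σ.reg 0 + σ.reg 0 + σ.reg 0
  r5 : σ.reg 5 = σ.reg 4 * σ.reg 4 + 1
  r6 : σ.reg 6 = 6 * (σ.reg 2 * σ.reg 2)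
  r7 : σ.reg 7 = σ.reg 0 + 1

theorem Stmt.Frame.consts {p : Stmt} {σ τ : State} (h : p.Frame σ τ) (hσ : Consts σ)
    (hp : (p.assigns 0 || p.assigns 2 || p.assigns 3 || p.assigns 4 || p.assigns 5 ||
      p.assigns 6 || p.assigns 7) = false) : Consts τ := by
  simp only [Bool.or_eq_false_iff] at hp
  obtain ⟨⟨⟨⟨⟨⟨h0, h2⟩, h3⟩, h4⟩, h5⟩, h6⟩, h7⟩ := hp
  constructor <;> simp only [h.reg _ h0, h.reg _ h2, h.reg _ h3, h.reg _ h4, h.reg _ h5,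
    h.reg _ h6, h.reg _ h7]
  exacts [hσ.two_le, hσ.r_le, hσ.r3, hσ.r4, hσ.r5, hσ.r6, hσ.r7]

/-- Used to show that the guards do not act: the largest constants are `9 n ^ 2 + 1` and `6 r ^ 2`,
and the factor `64 = 2 ^ 6` leaves ample room. -/
theorem sq_lt_pow_eight {n : ℕ} (hn : 2 ≤ n) : 64 * (n * n) ≤ n ^ 8 := by
  have h : 2 ^ 6 ≤ n ^ 6 := Nat.pow_le_pow_left hn 6
  calc 64 * (n * n) ≤ n ^ 6 * (n * n) := Nat.mul_le_mul_right _ h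
    _ = n ^ 8 := by ring

theorem run_set {x : ℕ} {e : Tm} {σ : State} (h : e.eval σ < σ.reg 0 ^ 8) :
    (Stmt.set x e).run σ = σ.setReg x (e.eval σ) := by
  rw [Stmt.run, clamp_of_lt h]

theorem run_put {a : ℕ} {i e : Tm} {σ : State} (h : e.eval σ < σ.reg 0 ^ 8) :
    (Stmt.put a i e).run σ = σ.setArr a (i.eval σ) (e.eval σ) := by
  rw [Stmt.run, clamp_of_lt h]

theorem run_ite_pos {b : Tm} {p q : Stmt} {σ : State} (h : b.Holds σ) :
    (Stmt.ite b p q).run σ = p.run σ := by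
  rw [Stmt.run]; exact if_pos h

theorem run_ite_neg {b : Tm} {p q : Stmt} {σ : State} (h : ¬ b.Holds σ) :
    (Stmt.ite b p q).run σ = q.run σ := by
  rw [Stmt.run]; exact if_neg h

theorem run_seq (p q : Stmt) (σ : State) : (Stmt.seq p q).run σ = q.run (p.run σ) := rfl

theorem Tm.eval_or_le (φ ψ : Tm) (σ : State) : (Tm.or φ ψ).eval σ ≤ 1 := by
  change (if 0 < φ.eval σ + ψ.eval σ then 1 else 0) ≤ 1
  split_ifs <;> omega

namespace Program

open Tm Stmt

@[simp] theorem holds_edge {σ : State} (h3 : σ.reg 3 = σ.reg 2 + 1) :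
    (edge (var 13) (var 14)).Holds σ ↔ (guessOf σ).Edge (σ.reg 13) (σ.reg 14) := by
  simp [edge, inA, inB, reaches, early, adjR, adj, bit, setReg_reg, guessOf, Guess.Edge, Guess.InA,
    Guess.InB, Guess.PairAt, Guess.SingleAt, Guess.Reaches, Guess.Early, h3]

theorem fillEdges_spec {σ : State} (hσ : Consts σ) {x y : ℕ} (hx : x < σ.reg 4) (hy : y < σ.reg 4) :
    (fillEdges.run σ).arr 5 (x * σ.reg 4 + y) ≠ 0 ↔ (guessOf σ).Edge x y := by
  -- Row-major indices determine row and column, so a write does not disturb other entries of the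
  -- table.
  have hidx : ∀ {x y x' y' : ℕ}, y < σ.reg 4 → y' < σ.reg 4 →
      x * σ.reg 4 + y = x' * σ.reg 4 + y' → x = x' ∧ y = y' := by
    intro x y x' y' hy hy' h
    have h1 : (x * σ.reg 4 + y) / σ.reg 4 = x := by
      rw [Nat.add_comm, Nat.add_mul_div_right _ _ (by omega), Nat.div_eq_of_lt hy, Nat.zero_add]
    have h2 : (x' * σ.reg 4 + y') / σ.reg 4 = x' := by
      rw [Nat.add_comm, Nat.add_mul_div_right _ _ (by omega), Nat.div_eq_of_lt hy', Nat.zero_add]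
    have h3 : x = x' := by rw [← h1, ← h2, h]
    subst h3
    exact ⟨rfl, by omega⟩
  refine loop_inv (x := 13) (c := 4) (σ := σ)
    (fun k τ => ∀ x < k, ∀ y < σ.reg 4, τ.arr 5 (x * σ.reg 4 + y) ≠ 0 ↔ (guessOf σ).Edge x y)
    (fun x hx => absurd hx (Nat.not_lt_zero x)) ?_ x hx y hy
  intro k hk τ hτ hI
  have h4 : (τ.setReg 13 k).reg 4 = σ.reg 4 := by
    rw [setReg_reg, if_neg (by norm_num), hτ.reg 4 rfl]
  have := loop_inv (x := 14) (c := 4) (σ := τ.setReg 13 k)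
    (p := put 5 (add (mul (var 13) (var 4)) (var 14)) (edge (var 13) (var 14)))
    (fun j τ' => (∀ x < k, ∀ y < σ.reg 4,
        τ'.arr 5 (x * σ.reg 4 + y) ≠ 0 ↔ (guessOf σ).Edge x y) ∧
      ∀ y < j, τ'.arr 5 (k * σ.reg 4 + y) ≠ 0 ↔ (guessOf σ).Edge k y)
    ⟨hI, fun y hy => absurd hy (Nat.not_lt_zero y)⟩ ?_
  · rw [h4] at this
    intro x hx y hy
    rcases Nat.lt_succ_iff_lt_or_eq.1 hx with h | rfl
    · exact this.1 x h y hy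
    · exact this.2 y hy
  · intro j hj τ' hτ' ⟨hI1, hI2⟩
    rw [h4] at hj
    have hg : guessOf (τ'.setReg 14 j) = guessOf σ := by
      rw [← hτ.guessOf_eq rfl]
      exact hτ'.guessOf_eq rfl
    have hr : ∀ c, c < 8 → c ≠ 1 → (τ'.setReg 14 j).reg c = σ.reg c := by
      intro c hc hc1
      rw [setReg_reg, if_neg (by omega)]
      have h1 : (τ.setReg 13 k).reg c = σ.reg c := by
        rw [setReg_reg, if_neg (by omega)]
        interval_cases c <;> exact hτ.reg _ rfl
      rw [← h1]
      interval_cases c <;> exact hτ'.reg _ rfl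
    have h13 : (τ'.setReg 14 j).reg 13 = k := by
      rw [setReg_reg, if_neg (by norm_num), hτ'.reg 13 rfl]; simp [setReg_reg]
    have h14 : (τ'.setReg 14 j).reg 14 = j := by simp [setReg_reg]
    have hlt : (edge (var 13) (var 14)).eval (τ'.setReg 14 j) < (τ'.setReg 14 j).reg 0 ^ 8 := by
      refine (eval_or_le _ _ _).trans_lt ?_
      rw [hr 0 (by norm_num) (by norm_num)]
      have := hσ.two_le
      exact Nat.one_lt_pow (by norm_num) (by omega)
    have hedge : (edge (var 13) (var 14)).eval (τ'.setReg 14 j) ≠ 0 ↔ (guessOf σ).Edge k j := by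
      have := holds_edge (σ := τ'.setReg 14 j) (by
        rw [hr 3 (by norm_num) (by norm_num), hr 2 (by norm_num) (by norm_num), hσ.r3])
      rw [h13, h14, hg] at this
      exact this
    rw [run_put hlt]
    have harr : ∀ x y, y < σ.reg 4 → ((τ'.setReg 14 j).setArr 5
        ((add (mul (var 13) (var 4)) (var 14)).eval (τ'.setReg 14 j))
        ((edge (var 13) (var 14)).eval (τ'.setReg 14 j))).arr 5 (x * σ.reg 4 + y) =
        if x = k ∧ y = j then (edge (var 13) (var 14)).eval (τ'.setReg 14 j)
        else τ'.arr 5 (x * σ.reg 4 + y) := by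
      intro x y hy
      rw [setArr_arr]
      simp only [eval_add, eval_mul, eval_var, h13, h14, hr 4 (by norm_num) (by norm_num), true_and,
        setReg_arr]
      by_cases h : x = k ∧ y = j
      · rw [if_pos h, if_pos (by rw [h.1, h.2])]
      · rw [if_neg h, if_neg fun h' => h (hidx hy hj h')]
    refine ⟨fun x hx y hy => ?_, fun y hy => ?_⟩
    · rw [harr x y hy, if_neg (by omega)]
      exact hI1 x hx y hy
    · rw [harr k y (by omega)]
      rcases Nat.lt_succ_iff_lt_or_eq.1 hy with h | rfl
      · rw [if_neg (by omega)]
        exact hI2 y h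
      · rw [if_pos ⟨rfl, rfl⟩]
        exact hedge

end Program

end RAM

/-! ### Correctness of the auction and of the labelling -/

namespace RAM

namespace Program

open Tm Stmt

/-- Feasibility enters through `Auction.Inv.exists_cheap`: the cheapest neighbour costs less than
`N`, so the raised price is at most `N` and is not truncated. Without a free node the bid does
nothing to owners and prices. -/
theorem bid_spec {τ : State} {N k : ℕ} {E : ℕ → ℕ → Prop} (hn : 2 ≤ τ.reg 0) (h4 : τ.reg 4 = N)
    (hN : N = τ.reg 0 + τ.reg 0 + τ.reg 0)
    (hE : ∀ x < N, ∀ y < N, τ.arr 5 (x * N + y) ≠ 0 ↔ E x y) (hf : Auction.Feasible N E)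
    (hI : Auction.Inv N E k (τ.arr 6) (τ.arr 7)) :
    Auction.Inv N E (k + 1) ((bid.run τ).arr 6) ((bid.run τ).arr 7) := by
  have hbig := sq_lt_pow_eight hn
  have hN8 : N + 1 < τ.reg 0 ^ 8 := by nlinarith
  set e₁ : Tm := find 20 4 (and (ex 21 4 (edgeAt (var 20) (var 21)))
    (all 21 4 (not (eq (get 6 (var 21)) (add (var 20) (lit 1)))))) with he₁
  set e₂ : Tm := find 21 4 (and (edgeAt (var 13) (var 21)) (all 22 4
    (imp (edgeAt (var 13) (var 22)) (le (get 7 (var 21)) (get 7 (var 22)))))) with he₂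
  have hx : e₁.eval τ = least N fun x => (∃ y < N, τ.arr 5 (x * N + y) ≠ 0) ∧
      ∀ y < N, ¬ τ.arr 6 y = x + 1 := by
    simp [he₁, edgeAt, setReg_reg, h4]
  set x := e₁.eval τ with hxdef
  have hxN : x ≤ N := by rw [hx]; exact least_le _ _
  set τ₁ := τ.setReg 13 x with hτ₁
  have hy : e₂.eval τ₁ = least N fun y => τ.arr 5 (x * N + y) ≠ 0 ∧
      ∀ y' < N, τ.arr 5 (x * N + y') ≠ 0 → τ.arr 7 y ≤ τ.arr 7 y' := by
    simp [he₂, hτ₁, edgeAt, setReg_reg, h4]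
  set y := e₂.eval τ₁ with hydef
  have hyN : y ≤ N := by rw [hy]; exact least_le _ _
  rw [bid, run_seq, run_set (hxdef ▸ by omega), ← hxdef, ← hτ₁]
  have hiff : x < N ↔ ∃ x, Auction.Free N E (τ.arr 6) x := by
    rw [hx, least_lt_iff]
    refine exists_congr fun x => ?_
    unfold Auction.Free
    refine and_congr_right fun hx => and_congr_left fun _ => ?_
    exact exists_congr fun y => and_congr_right fun hy => hE x hx y hy
  by_cases hxlt : x < N
  · have hfree : Auction.Free N E (τ.arr 6) x := by
      have := least_spec (hx ▸ hxlt)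
      rw [← hx] at this
      obtain ⟨⟨y, hy, hxy⟩, h⟩ := this
      exact ⟨hxlt, ⟨y, hy, (hE x hxlt y hy).1 hxy⟩, h⟩
    obtain ⟨y₀, hy₀, hE₀, hp₀⟩ := hI.exists_cheap hf hfree
    have hylt : y < N := by
      rw [hy, least_lt_iff]
      obtain ⟨y₁, hy₁, hmin⟩ := Finset.exists_min_image
        ((Finset.range N).filter fun y => τ.arr 5 (x * N + y) ≠ 0) (τ.arr 7)
        ⟨y₀, Finset.mem_filter.2 ⟨Finset.mem_range.2 hy₀, (hE x hxlt y₀ hy₀).2 hE₀⟩⟩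
      obtain ⟨h1, h2⟩ := Finset.mem_filter.1 hy₁
      exact ⟨y₁, Finset.mem_range.1 h1, h2, fun y' hy' h =>
        hmin y' (Finset.mem_filter.2 ⟨Finset.mem_range.2 hy', h⟩)⟩
    have hyspec := least_spec (hy ▸ hylt)
    rw [← hy] at hyspec
    have hmin : ∀ y' < N, E x y' → τ.arr 7 y ≤ τ.arr 7 y' := fun y' hy' h =>
      hyspec.2 y' hy' ((hE x hxlt y' hy').2 h)
    have hpy : τ.arr 7 y < N := (hmin y₀ hy₀ hE₀).trans_lt hp₀
    have hnew := hI.bid hfree hylt ((hE x hxlt y hylt).1 hyspec.1) hmin hpy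
    have h0 : τ₁.reg 0 = τ.reg 0 := by simp [hτ₁, setReg_reg]
    rw [run_ite_pos (by simp [hτ₁, setReg_reg, h4, hxlt]), run_seq,
      run_set (by rw [← hydef, h0]; omega), ← hydef, run_seq,
      run_put (a := 6) (by simp [setReg_reg, hτ₁]; omega),
      run_put (a := 7) (by simp [setReg_reg, setArr_arr, hτ₁]; omega)]
    have e6 : ∀ z, (((τ₁.setReg 14 y).setArr 6 y (x + 1)).setArr 7 y (τ.arr 7 y + 1)).arr 6 z =
        Function.update (τ.arr 6) y (x + 1) z := by
      intro z
      simp [setArr_arr, Function.update_apply, hτ₁]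
    have e7 : ∀ z, (((τ₁.setReg 14 y).setArr 6 y (x + 1)).setArr 7 y (τ.arr 7 y + 1)).arr 7 z =
        Function.update (τ.arr 7) y (τ.arr 7 y + 1) z := by
      intro z
      simp [setArr_arr, Function.update_apply, hτ₁]
    rw [← funext e6, ← funext e7] at hnew
    simpa [setReg_reg, setArr_arr, hτ₁] using hnew
  · have hnf : ∀ x, ¬ Auction.Free N E (τ.arr 6) x := fun z hz => hxlt (hiff.2 ⟨z, hz⟩)
    rw [run_ite_neg (by simp [hτ₁, setReg_reg, h4, hxlt])]
    exact hI.stable hnf _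

theorem auction_spec {σ : State} (hσ : Consts σ) {E : ℕ → ℕ → Prop}
    (hE : ∀ x < σ.reg 4, ∀ y < σ.reg 4, σ.arr 5 (x * σ.reg 4 + y) ≠ 0 ↔ E x y)
    (hf : Auction.Feasible (σ.reg 4) E) :
    Auction.Matched (σ.reg 4) E ((auction.run σ).arr 6) := by
  refine Auction.Inv.matched (p := (auction.run σ).arr 7) ?_
  rw [auction, run_seq]
  set σ₁ := (loop 14 4 (seq (put 6 (var 14) (lit 0)) (put 7 (var 14) (lit 0)))).run σ with hσ₁
  have hfr : (loop 14 4 (seq (put 6 (var 14) (lit 0)) (put 7 (var 14) (lit 0)))).Frame σ σ₁ :=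
    Stmt.frame _ _
  have hinit : ∀ y < σ.reg 4, σ₁.arr 6 y = 0 ∧ σ₁.arr 7 y = 0 := by
    refine loop_inv (x := 14) (c := 4) (σ := σ)
      (fun k τ => ∀ y < k, τ.arr 6 y = 0 ∧ τ.arr 7 y = 0)
      (fun y hy => absurd hy (Nat.not_lt_zero y)) ?_
    intro k hk τ hτ hI y hy
    have h0 : 0 < (τ.setReg 14 k).reg 0 ^ 8 := by
      rw [setReg_reg, if_neg (by norm_num), hτ.reg 0 rfl]
      have := hσ.two_le
      positivity
    rw [run_seq, run_put (a := 6) (by simpa using h0), run_put (a := 7) (by simpa using h0)]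
    simp only [setArr_arr, setReg_reg, eval_var, eval_lit, setArr_reg, setReg_arr]
    rcases Nat.lt_succ_iff_lt_or_eq.1 hy with h | rfl
    · simp [h.ne, hI y h]
    · simp
  rw [← hσ.r5, ← hfr.reg 5 rfl]
  refine loop_inv (x := 15) (c := 5) (σ := σ₁)
    (fun k τ => Auction.Inv (σ.reg 4) E k (τ.arr 6) (τ.arr 7))
    (Auction.inv_zero (fun y hy => (hinit y hy).1) fun y hy => (hinit y hy).2) ?_
  intro k hk τ hτ hI
  have hr : ∀ c, c = 0 ∨ c = 4 → (τ.setReg 15 k).reg c = σ.reg c := by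
    rintro c (rfl | rfl)
    · rw [setReg_reg, if_neg (by norm_num), hτ.reg 0 rfl, hfr.reg 0 rfl]
    · rw [setReg_reg, if_neg (by norm_num), hτ.reg 4 rfl, hfr.reg 4 rfl]
  refine bid_spec (τ := τ.setReg 15 k) ?_ (hr 4 (Or.inr rfl)) ?_ ?_ hf hI
  · rw [hr 0 (Or.inl rfl)]; exact hσ.two_le
  · rw [hr 0 (Or.inl rfl)]; exact hσ.r4
  · rw [setReg_arr, hτ.arr 5 rfl, hfr.arr 5 rfl]; exact hE

/-- `X` is a label that the matching `m` gives to the vertex `v`. -/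
def LabelOf (g : Guess) (m : ℕ → ℕ) (v X : ℕ) : Prop :=
  (g.InR v → (∃ k < g.r, (∃ j < g.r, g.ρ j = v ∧ g.W k j) ∧ X = g.n + k) ∨
    ∀ k < g.r, ∀ j < g.r, g.ρ j = v → ¬ g.W k j) ∧
  (g.InA v → (∃ k < g.r, m (g.n + k) = v + 1 ∧ X = g.n + k) ∨
    ((∀ k < g.r, m (g.n + k) ≠ v + 1) ∧ X = v)) ∧
  (g.InB v → X = m v - 1)

/-- The bound on the owners serves the vertices of B, whose labels are read off from the owners and
must not be truncated. -/
theorem label_spec {τ : State} (hn : 2 ≤ τ.reg 0) (hr : τ.reg 2 ≤ τ.reg 0)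
    (hl : τ.reg 18 < τ.reg 0)
    (hm : ∀ v < τ.reg 0, τ.arr 6 v ≤ τ.reg 0 + τ.reg 0 + τ.reg 0) :
    ∃ X, LabelOf (guessOf τ) (τ.arr 6) (τ.reg 18) X ∧
      ∀ v, (label.run τ).arr 8 v = if v = τ.reg 18 then X else τ.arr 8 v := by
  have hbig := sq_lt_pow_eight hn
  have hlin : 4 * τ.reg 0 < τ.reg 0 ^ 8 := by nlinarith
  set g := guessOf τ with hg
  set l := τ.reg 18 with hl18
  have hR : (get 1 (var 18)).Holds τ ↔ g.InR l := Iff.rfl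
  have hA : (inA (var 18)).Holds τ ↔ g.InA l := by
    rw [hg, hl18]
    simp [inA, adj, guessOf, Guess.InA]
  have hBA : g.InB l → ¬ g.InR l ∧ ¬ g.InA l := by unfold Guess.InA Guess.InB; tauto
  have hAR : g.InA l → ¬ g.InR l := fun h => h.2.1
  unfold label
  by_cases hRl : g.InR l
  · set e : Tm := find 20 2 (ex 21 2 (and (eq (get 3 (var 21)) (var 18)) (bit 0 (var 20) (var 21))))
      with he
    have hev : e.eval τ = least g.r fun k => ∃ j < g.r, g.ρ j = l ∧ g.W k j := by
      simp [he, bit, setReg_reg, hg, guessOf, hl18]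
    have hle : e.eval τ ≤ τ.reg 2 := by rw [hev]; exact least_le _ _
    rw [run_ite_pos (hR.2 hRl), run_put (by simp only [eval_add, eval_var]; omega)]
    refine ⟨τ.reg 0 + e.eval τ, ⟨fun _ => ?_, fun h => absurd hRl (hAR h),
      fun h => absurd hRl (hBA h).1⟩, fun v => by simp [setArr_arr, hl18]⟩
    by_cases hlt : e.eval τ < g.r
    · refine Or.inl ⟨e.eval τ, hlt, ?_, rfl⟩
      rw [hev] at hlt ⊢
      exact least_spec hlt
    · right
      intro k hk j hj hjl hW
      refine hlt ?_
      rw [hev]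
      exact least_lt_iff.2 ⟨k, hk, j, hj, hjl, hW⟩
  · rw [run_ite_neg fun h => hRl (hR.1 h)]
    by_cases hAl : g.InA l
    · set e : Tm := find 20 2 (eq (get 6 (add (var 0) (var 20))) (add (var 18) (lit 1))) with he
      have hev : e.eval τ = least g.r fun k => τ.arr 6 (g.n + k) = l + 1 := by
        simp [he, setReg_reg, hg, guessOf, hl18]
      have hle : e.eval τ ≤ τ.reg 2 := by rw [hev]; exact least_le _ _
      rw [run_ite_pos (hA.2 hAl), run_seq, run_set (by omega)]
      by_cases hlt : e.eval τ < g.r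
      · have hlt' : e.eval τ < τ.reg 2 := hlt
        rw [run_ite_pos (by simpa [setReg_reg] using hlt'),
          run_put (by simp [setReg_reg]; omega)]
        refine ⟨τ.reg 0 + e.eval τ, ⟨fun h => absurd h hRl,
          fun _ => Or.inl ⟨e.eval τ, hlt, ?_, rfl⟩, fun h => absurd hAl (hBA h).2⟩,
          fun v => by simp [setArr_arr, setReg_reg, hl18]⟩
        rw [hev] at hlt ⊢
        exact least_spec hlt
      · have hlt' : ¬ e.eval τ < τ.reg 2 := hlt
        rw [run_ite_neg (by simpa [setReg_reg] using hlt'),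
          run_put (by simp [setReg_reg]; omega)]
        refine ⟨l, ⟨fun h => absurd h hRl,
          fun _ => Or.inr ⟨fun k hk h => hlt ?_, rfl⟩, fun h => absurd hAl (hBA h).2⟩,
          fun v => by simp [setArr_arr, setReg_reg, hl18]⟩
        rw [hev]
        exact least_lt_iff.2 ⟨k, hk, h⟩
    · have := hm l hl
      rw [run_ite_neg fun h => hAl (hA.1 h),
        run_put (by change τ.arr 6 l - 1 < _; omega)]
      exact ⟨τ.arr 6 l - 1, ⟨fun h => absurd h hRl, fun h => absurd h hAl, fun _ => rfl⟩,
        fun v => by simp [setArr_arr, hl18]⟩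

theorem labels_spec {σ : State} (hσ : Consts σ)
    (hm : Auction.Matched (σ.reg 4) (guessOf σ).Edge (σ.arr 6)) :
    (guessOf σ).IsLabelling (σ.arr 6) ((labels.run σ).arr 8) := by
  have h4 := hσ.r4
  have hm' : ∀ v < σ.reg 0, σ.arr 6 v ≤ σ.reg 0 + σ.reg 0 + σ.reg 0 := by
    intro v hv
    by_contra hcon
    have := (hm.edge v (by omega) (σ.arr 6 v - 1) (by omega)).1
    omega
  have key : ∀ v < σ.reg 0, LabelOf (guessOf σ) (σ.arr 6) v ((labels.run σ).arr 8 v) := by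
    refine loop_inv (x := 18) (c := 0) (σ := σ) (p := label)
      (fun l τ => ∀ v < l, LabelOf (guessOf σ) (σ.arr 6) v (τ.arr 8 v))
      (fun v hv => absurd hv (Nat.not_lt_zero v)) ?_
    intro l hl τ hτ hI
    have hg : guessOf (τ.setReg 18 l) = guessOf σ := hτ.guessOf_eq rfl
    have h0 : (τ.setReg 18 l).reg 0 = σ.reg 0 := by
      rw [setReg_reg, if_neg (by norm_num), hτ.reg 0 rfl]
    have h2 : (τ.setReg 18 l).reg 2 = σ.reg 2 := by
      rw [setReg_reg, if_neg (by norm_num), hτ.reg 2 rfl]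
    have h6 : (τ.setReg 18 l).arr 6 = σ.arr 6 := hτ.arr 6 rfl
    have h18 : (τ.setReg 18 l).reg 18 = l := by simp [setReg_reg]
    obtain ⟨X, hX, h⟩ := label_spec (τ := τ.setReg 18 l) (by rw [h0]; exact hσ.two_le)
      (by rw [h0, h2]; exact hσ.r_le) (by rw [h18, h0]; exact hl) (by rw [h0, h6]; exact hm')
    rw [h18, hg, h6] at hX
    intro v hv
    rw [h v, h18]
    rcases Nat.lt_succ_iff_lt_or_eq.1 hv with h' | rfl
    · rw [if_neg (by omega)]; exact hI v h'
    · rw [if_pos rfl]; exact hX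
  exact ⟨fun v hv h => (key v hv).1 h, fun v h => (key v h.1).2.1 h, fun v h => (key v h.1).2.2 h⟩

end Program

end RAM

/-! ### Ordering the classes greedily -/

namespace Greedy

variable {n cnt X : ℕ} {Aj : ℕ → ℕ → Prop} {lab c key : ℕ → ℕ}

/-- The class with the label `X` may come next. -/
def Eligible (n : ℕ) (Aj : ℕ → ℕ → Prop) (lab c : ℕ → ℕ) (X : ℕ) : Prop :=
  (∃ v < n, c v = 0 ∧ lab v = X) ∧
    ∀ w < n, c w = 0 → ((∃ u < n, lab u = X ∧ Aj w u) ↔ lab w ≠ X)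

/-- The invariant after the colours `1, …, cnt` have been used; uncoloured vertices have the
colour `0`. -/
structure Inv (n : ℕ) (Aj : ℕ → ℕ → Prop) (lab c : ℕ → ℕ) (cnt : ℕ) : Prop where
  le : ∀ v < n, c v ≤ cnt
  surj : ∀ i, 1 ≤ i → i ≤ cnt → ∃ v < n, c v = i
  same : ∀ v < n, ∀ w < n, lab v = lab w → c v = c w
  inj : ∀ v < n, ∀ w < n, c v ≠ 0 → c v = c w → lab v = lab w
  proper : ∀ v < n, ∀ w < n, c v ≠ 0 → c v = c w → ¬ Aj v w
  nbr : ∀ v < n, ∀ i, 1 ≤ i → i ≤ cnt → (i < c v ∨ c v = 0) → ∃ u < n, c u = i ∧ Aj v u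

theorem inv_zero (hc : ∀ v < n, c v = 0) : Inv n Aj lab c 0 where
  le v hv := (hc v hv).le
  surj i h h' := by omega
  same v hv w hw _ := by rw [hc v hv, hc w hw]
  inj v hv w hw h := absurd (hc v hv) h
  proper v hv w hw h := absurd (hc v hv) h
  nbr v hv i h h' := by omega

/-- Equal labels have equal colours, so the chosen class is still entirely uncoloured. Eligibility
makes it independent and gives every other uncoloured vertex a neighbour of the new colour. -/
theorem Inv.step (h : Inv n Aj lab c cnt) (hX : Eligible n Aj lab c X) {c' : ℕ → ℕ}
    (hc' : ∀ v < n, c' v = if lab v = X then cnt + 1 else c v) :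
    Inv n Aj lab c' (cnt + 1) := by
  obtain ⟨⟨v₀, hv₀, hcv₀, hlv₀⟩, hel⟩ := hX
  have hun : ∀ v < n, lab v = X → c v = 0 := fun v hv hl =>
    (h.same v hv v₀ hv₀ (hl.trans hlv₀.symm)).trans hcv₀
  constructor
  · intro v hv
    rw [hc' v hv]
    have := h.le v hv
    split_ifs <;> omega
  · intro i hi hi'
    by_cases hic : i = cnt + 1
    · exact ⟨v₀, hv₀, by rw [hc' v₀ hv₀, if_pos hlv₀, hic]⟩
    · obtain ⟨v, hv, hcv⟩ := h.surj i hi (by omega)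
      refine ⟨v, hv, ?_⟩
      rw [hc' v hv, if_neg, hcv]
      intro hl
      have := hun v hv hl
      omega
  · intro v hv w hw hl
    rw [hc' v hv, hc' w hw, hl, h.same v hv w hw hl]
  · intro v hv w hw h0 heq
    rw [hc' v hv, hc' w hw] at heq
    rw [hc' v hv] at h0
    have h1 := h.le v hv
    have h2 := h.le w hw
    split_ifs at heq h0 with h3 h4 h4
    · rw [h3, h4]
    · omega
    · omega
    · exact h.inj v hv w hw h0 heq
  · intro v hv w hw h0 heq
    rw [hc' v hv, hc' w hw] at heq
    rw [hc' v hv] at h0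
    have h1 := h.le v hv
    have h2 := h.le w hw
    split_ifs at heq h0 with h3 h4 h4
    · intro hvw
      exact (hel v hv (hun v hv h3)).1 ⟨w, hw, h4, hvw⟩ h3
    · omega
    · omega
    · exact h.proper v hv w hw h0 heq
  · intro v hv i hi hi' hiv
    rw [hc' v hv] at hiv
    have h1 := h.le v hv
    by_cases hic : i = cnt + 1
    · have hlv : lab v ≠ X := by
        intro hl
        rw [if_pos hl] at hiv
        omega
      rw [if_neg hlv] at hiv
      obtain ⟨u, hu, hlu, hvu⟩ := (hel v hv (by omega)).2 hlv
      exact ⟨u, hu, by rw [hc' u hu, if_pos hlu, hic], hvu⟩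
    · obtain ⟨u, hu, hcu, hvu⟩ := h.nbr v hv i hi (by omega) (by
        split_ifs at hiv with hl
        · exact Or.inr (hun v hv hl)
        · exact hiv)
      refine ⟨u, hu, ?_, hvu⟩
      rw [hc' u hu, if_neg, hcu]
      intro hl
      have := hun u hu hl
      omega

theorem Inv.cnt_le (h : Inv n Aj lab c cnt) : cnt ≤ n := by
  have : Finset.Icc 1 cnt ⊆ (Finset.range n).image c := by
    intro i hi
    rw [Finset.mem_Icc] at hi
    obtain ⟨v, hv, rfl⟩ := h.surj i hi.1 hi.2
    exact Finset.mem_image_of_mem c (Finset.mem_range.2 hv)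
  simpa using (Finset.card_le_card this).trans Finset.card_image_le

/-- An uncoloured vertex would make `n` vertices take the `n + 1` values `0, …, n`. -/
theorem Inv.coloured (h : Inv n Aj lab c n) : ∀ v < n, c v ≠ 0 := by
  intro v hv h0
  have : insert 0 (Finset.Icc 1 n) ⊆ (Finset.range n).image c := by
    intro i hi
    rw [Finset.mem_insert, Finset.mem_Icc] at hi
    rcases hi with rfl | hi
    · exact Finset.mem_image.2 ⟨v, Finset.mem_range.2 hv, h0⟩
    · obtain ⟨v, hv, rfl⟩ := h.surj i hi.1 hi.2
      exact Finset.mem_image_of_mem c (Finset.mem_range.2 hv)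
  have := (Finset.card_le_card this).trans Finset.card_image_le
  rw [Finset.card_insert_of_notMem (by simp)] at this
  simp at this

theorem Inv.card_labels_le (h : Inv n Aj lab c cnt) (hc : ∀ v < n, c v ≠ 0) :
    ((Finset.range n).image lab).card ≤ cnt := by
  have hex : ∀ i, ∃ X, ∀ v < n, c v = i → lab v = X := by
    intro i
    by_cases hi : ∃ w < n, c w = i
    · obtain ⟨w, hw, rfl⟩ := hi
      exact ⟨lab w, fun v hv hvw => h.inj v hv w hw (hc v hv) hvw⟩
    · exact ⟨0, fun v hv hvi => absurd ⟨v, hv, hvi⟩ hi⟩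
  choose f hf using hex
  have : (Finset.range n).image lab ⊆ (Finset.Icc 1 cnt).image f := by
    intro X hX
    obtain ⟨v, hv, rfl⟩ := Finset.mem_image.1 hX
    rw [Finset.mem_range] at hv
    exact Finset.mem_image.2 ⟨c v, Finset.mem_Icc.2 ⟨Nat.one_le_iff_ne_zero.2 (hc v hv), h.le v hv⟩,
      (hf _ v hv rfl).symm⟩
  simpa using (Finset.card_le_card this).trans Finset.card_image_le

/-- The labels can be ordered so that each label dominates the later ones. -/
structure Orderable (n : ℕ) (Aj : ℕ → ℕ → Prop) (lab : ℕ → ℕ) (key : ℕ → ℕ) : Prop where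
  independent : ∀ v < n, ∀ w < n, lab v = lab w → ¬ Aj v w
  dominates : ∀ v < n, ∀ w < n, lab v ≠ lab w → key (lab v) ≤ key (lab w) →
    ∃ u < n, lab u = lab v ∧ Aj w u

/-- An uncoloured class with the least key dominates all others that remain. The key serves this
existence proof only; the program never computes it. -/
theorem Orderable.exists_eligible (h : Orderable n Aj lab key) {v : ℕ} (hv : v < n) (hcv : c v = 0) :
    ∃ v < n, Eligible n Aj lab c (lab v) := by
  obtain ⟨v₁, hv₁, hmin⟩ := Finset.exists_min_image
    ((Finset.range n).filter fun v => c v = 0) (fun v => key (lab v))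
    ⟨v, Finset.mem_filter.2 ⟨Finset.mem_range.2 hv, hcv⟩⟩
  obtain ⟨h1, h2⟩ := Finset.mem_filter.1 hv₁
  rw [Finset.mem_range] at h1
  refine ⟨v₁, h1, ⟨v₁, h1, h2, rfl⟩, fun w hw hcw => ⟨?_, fun hne => ?_⟩⟩
  · rintro ⟨u, hu, hlu, hwu⟩ hlw
    exact h.independent w hw u hu (hlw.trans hlu.symm) hwu
  · exact h.dominates v₁ h1 w hw hne.symm
      (hmin w (Finset.mem_filter.2 ⟨Finset.mem_range.2 hw, hcw⟩))

end Greedy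

/-! ### Correctness of the greedy colouring -/

namespace RAM

namespace Program

open Tm Stmt

theorem greedyStep_spec {τ : State} (hn : 2 ≤ τ.reg 0)
    (h4 : τ.reg 4 = τ.reg 0 + τ.reg 0 + τ.reg 0)
    (hI : Greedy.Inv (τ.reg 0) (guessOf τ).Aj (τ.arr 8) (τ.arr 9) (τ.reg 17))
    (hcnt : τ.reg 17 < τ.reg 0) :
    Greedy.Inv (τ.reg 0) (guessOf τ).Aj (τ.arr 8) ((greedyStep.run τ).arr 9)
        ((greedyStep.run τ).reg 17) ∧
      (((∃ v < τ.reg 0, τ.arr 9 v = 0) ∧ (greedyStep.run τ).reg 17 = τ.reg 17 + 1) ∨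
        (¬ ∃ X < τ.reg 4, Greedy.Eligible (τ.reg 0) (guessOf τ).Aj (τ.arr 8) (τ.arr 9) X) ∧
        (greedyStep.run τ).reg 17 = τ.reg 17 ∧ (greedyStep.run τ).arr 9 = τ.arr 9) := by
  have hbig := sq_lt_pow_eight hn
  have hlin : 4 * τ.reg 0 < τ.reg 0 ^ 8 := by nlinarith
  set e := find 20 4 eligible with he
  have hX : e.eval τ =
      least (τ.reg 4) (Greedy.Eligible (τ.reg 0) (guessOf τ).Aj (τ.arr 8) (τ.arr 9)) := by
    have : ∀ X, eligible.Holds (τ.setReg 20 X) ↔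
        Greedy.Eligible (τ.reg 0) (guessOf τ).Aj (τ.arr 8) (τ.arr 9) X := by
      intro X
      simp [eligible, adj, setReg_reg, Greedy.Eligible, guessOf]
    rw [he, eval_find]
    simp only [this]
  set X := e.eval τ with hXdef
  have hXle : X ≤ τ.reg 4 := by rw [hX]; exact least_le _ _
  have hstep : greedyStep.run τ = (ite (lt (var 13) (var 4))
    (seq (set 17 (add (var 17) (lit 1)))
      (loop 18 0 (ite (eq (get 8 (var 18)) (var 13)) (put 9 (var 18) (var 17)) (set 14 (lit 0)))))
    (set 14 (lit 0))).run (τ.setReg 13 X) := by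
    rw [greedyStep, run_seq, run_set (x := 13) (by rw [← he, ← hXdef]; omega)]
  rw [hstep]
  by_cases hlt : X < τ.reg 4
  · have hel := least_spec (hX ▸ hlt)
    rw [← hX] at hel
    rw [run_ite_pos (by simpa [setReg_reg] using hlt), run_seq,
      run_set (x := 17) (by simp [setReg_reg]; omega)]
    set τ₁ := (τ.setReg 13 X).setReg 17 ((add (var 17) (lit 1)).eval (τ.setReg 13 X)) with hτ₁
    have h0 : τ₁.reg 0 = τ.reg 0 := by simp [hτ₁, setReg_reg]
    have h17 : τ₁.reg 17 = τ.reg 17 + 1 := by simp [hτ₁, setReg_reg]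
    have h13 : τ₁.reg 13 = X := by simp [hτ₁, setReg_reg]
    set p := loop 18 0 (ite (eq (get 8 (var 18)) (var 13)) (put 9 (var 18) (var 17))
      (set 14 (lit 0))) with hp
    have hloop : ∀ v < τ₁.reg 0, (p.run τ₁).arr 9 v =
        if τ.arr 8 v = X then τ.reg 17 + 1 else τ.arr 9 v := by
      have := loop_inv (x := 18) (c := 0) (σ := τ₁) (p := ite (eq (get 8 (var 18)) (var 13))
        (put 9 (var 18) (var 17)) (set 14 (lit 0)))
        (fun k τ' => ∀ v, τ'.arr 9 v =
          if v < k ∧ τ.arr 8 v = X then τ.reg 17 + 1 else τ.arr 9 v)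
        (fun v => by simp [hτ₁]) ?_
      · intro v hv
        rw [hp, this v]
        simp [hv]
      · intro k hk τ' hτ' hI' v
        have h8 : τ'.arr 8 = τ.arr 8 := hτ'.arr 8 rfl
        have h13' : τ'.reg 13 = X := (hτ'.reg 13 rfl).trans h13
        have h17' : τ'.reg 17 = τ.reg 17 + 1 := (hτ'.reg 17 rfl).trans h17
        have h0' : τ'.reg 0 = τ.reg 0 := (hτ'.reg 0 rfl).trans h0
        by_cases hk' : τ.arr 8 k = X
        · rw [run_ite_pos (by simp [setReg_reg, h8, h13', hk']),
            run_put (by simp [setReg_reg, h17', h0']; omega), setArr_arr]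
          simp only [eval_var, setReg_reg, setReg_arr, true_and]
          by_cases hvk : v = k
          · simp [hvk, hk', h17']
          · have : v < k + 1 ↔ v < k := by omega
            simp [hvk, this, hI' v]
        · rw [run_ite_neg (by simp [setReg_reg, h8, h13', hk'])]
          have : v < k + 1 ∧ τ.arr 8 v = X ↔ v < k ∧ τ.arr 8 v = X := by
            constructor
            · rintro ⟨h1, h2⟩
              refine ⟨?_, h2⟩
              by_contra h3
              obtain rfl : v = k := by omega
              exact hk' h2
            · exact fun h => ⟨by omega, h.2⟩
          change τ'.arr 9 v = _
          rw [hI' v]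
          simp only [this]
    have h17'' : (p.run τ₁).reg 17 = τ.reg 17 + 1 := by
      rw [p.run_reg τ₁ rfl, h17]
    rw [h17'']
    rw [h0] at hloop
    obtain ⟨v, hv, hcv, _⟩ := hel.1
    exact ⟨hI.step hel hloop, Or.inl ⟨⟨v, hv, hcv⟩, rfl⟩⟩
  · rw [run_ite_neg (by simpa [setReg_reg] using hlt)]
    have h9 : ((set 14 (lit 0)).run (τ.setReg 13 X)).arr 9 = τ.arr 9 := rfl
    have h17 : ((set 14 (lit 0)).run (τ.setReg 13 X)).reg 17 = τ.reg 17 := by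
      rw [Stmt.run_reg _ _ rfl]; simp [setReg_reg]
    rw [h9, h17]
    refine ⟨hI, Or.inr ⟨fun h => hlt ?_, rfl, rfl⟩⟩
    rw [hX]
    exact least_lt_iff.2 h

/-- The invariant holds for arbitrary labels. Only completeness needs an order of the labels, and
labels in the range that is searched. -/
theorem greedy_spec {σ : State} (hσ : Consts σ) :
    Greedy.Inv (σ.reg 0) (guessOf σ).Aj (σ.arr 8) ((greedy.run σ).arr 9)
        ((greedy.run σ).reg 17) ∧
      ∀ key, Greedy.Orderable (σ.reg 0) (guessOf σ).Aj (σ.arr 8) key →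
        (∀ v < σ.reg 0, σ.arr 8 v < σ.reg 4) →
        ∀ v < σ.reg 0, (greedy.run σ).arr 9 v ≠ 0 := by
  have hn := hσ.two_le
  have hpos : 0 < σ.reg 0 ^ 8 := by positivity
  set σ₁ := (set 17 (lit 0)).run σ with hσ₁
  set σ₂ := (loop 18 0 (put 9 (var 18) (lit 0))).run σ₁ with hσ₂
  have hrun : greedy.run σ = (loop 15 0 greedyStep).run σ₂ := rfl
  have hf₁ : (set 17 (lit 0)).Frame σ σ₁ := Stmt.frame _ _
  have hf₂ : (loop 18 0 (put 9 (var 18) (lit 0))).Frame σ₁ σ₂ := Stmt.frame _ _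
  have h0 : σ₂.reg 0 = σ.reg 0 := (hf₂.reg 0 rfl).trans (hf₁.reg 0 rfl)
  have h4 : σ₂.reg 4 = σ.reg 4 := (hf₂.reg 4 rfl).trans (hf₁.reg 4 rfl)
  have h8 : σ₂.arr 8 = σ.arr 8 := (hf₂.arr 8 rfl).trans (hf₁.arr 8 rfl)
  have hg : guessOf σ₂ = guessOf σ := (hf₂.guessOf_eq rfl).trans (hf₁.guessOf_eq rfl)
  have h17 : σ₂.reg 17 = 0 := by
    rw [hf₂.reg 17 rfl, hσ₁, run_set (by simpa using hpos)]
    simp [setReg_reg]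
  have h9 : ∀ v < σ₁.reg 0, σ₂.arr 9 v = 0 := by
    refine loop_inv (x := 18) (c := 0) (σ := σ₁) (fun k τ => ∀ v < k, τ.arr 9 v = 0)
      (fun v hv => absurd hv (Nat.not_lt_zero v)) ?_
    intro k hk τ hτ hI v hv
    rw [Stmt.run, setArr_arr]
    rcases Nat.lt_succ_iff_lt_or_eq.1 hv with h | rfl
    · simp [setReg_reg, h.ne, hI v h]
    · simp [setReg_reg, clamp]
  rw [hf₁.reg 0 rfl] at h9
  rw [hrun]
  -- Each round either uses a new colour or finds everything coloured. If all `n` rounds used one,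
  -- no vertex is left by `Greedy.Inv.coloured`.
  have := loop_inv (x := 15) (c := 0) (σ := σ₂) (p := greedyStep)
    (fun k τ => Greedy.Inv (σ.reg 0) (guessOf σ).Aj (σ.arr 8) (τ.arr 9) (τ.reg 17) ∧
      τ.reg 17 ≤ k ∧ ∀ key, Greedy.Orderable (σ.reg 0) (guessOf σ).Aj (σ.arr 8) key →
        (∀ v < σ.reg 0, σ.arr 8 v < σ.reg 4) →
        (∀ v < σ.reg 0, τ.arr 9 v ≠ 0) ∨ τ.reg 17 = k)
    ⟨by rw [h17]; exact Greedy.inv_zero h9, h17.le, fun _ _ _ => Or.inr h17⟩ ?_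
  · rw [h0] at this
    refine ⟨this.1, fun key hkey hlab => ?_⟩
    rcases this.2.2 key hkey hlab with h | h
    · exact h
    · exact (h ▸ this.1).coloured
  · intro k hk τ hτ ⟨hI1, hI2, hI3⟩
    set τ₁ := τ.setReg 15 k with hτ₁
    have e0 : τ₁.reg 0 = σ.reg 0 := by
      rw [hτ₁, setReg_reg, if_neg (by norm_num), hτ.reg 0 rfl, h0]
    have e4 : τ₁.reg 4 = σ.reg 4 := by
      rw [hτ₁, setReg_reg, if_neg (by norm_num), hτ.reg 4 rfl, h4]
    have e17 : τ₁.reg 17 = τ.reg 17 := by rw [hτ₁, setReg_reg, if_neg (by norm_num)]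
    have e8 : τ₁.arr 8 = σ.arr 8 := (hτ.arr 8 rfl).trans h8
    have e9 : τ₁.arr 9 = τ.arr 9 := rfl
    have eg : guessOf τ₁ = guessOf σ := (hτ.guessOf_eq rfl).trans hg
    obtain ⟨h1, h2⟩ := greedyStep_spec (τ := τ₁) (by rw [e0]; exact hn)
      (by rw [e0, e4]; exact hσ.r4) (by rw [e0, e8, e9, eg, e17]; exact hI1)
      (by rw [e0, e17]; omega)
    rw [e0, e8, eg] at h1
    rw [e0, e4, e8, e9, e17, eg] at h2
    refine ⟨h1, by omega, fun key hkey hlab => ?_⟩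
    rcases h2 with ⟨⟨v, hv, hcv⟩, h2⟩ | ⟨h2, h3, h5⟩
    · rcases hI3 key hkey hlab with h | h
      · exact absurd hcv (h v hv)
      · right; omega
    · left
      rw [h5]
      intro v hv hcv
      obtain ⟨w, hw, hel⟩ := hkey.exists_eligible hv hcv
      exact h2 ⟨_, hlab w hw, hel⟩

end Program

end RAM

/-! ### Recording a colouring; the processing of one guess -/

/-- The map `out` is a Grundy colouring with the colours `1, …, ℓ`. -/
structure IsGrundyMap (n : ℕ) (Aj : ℕ → ℕ → Prop) (out : ℕ → ℕ) (ℓ : ℕ) : Prop where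
  range : ∀ v < n, 1 ≤ out v ∧ out v ≤ ℓ
  surj : ∀ i, 1 ≤ i → i ≤ ℓ → ∃ v < n, out v = i
  proper : ∀ v < n, ∀ w < n, out v = out w → ¬ Aj v w
  nbr : ∀ v < n, ∀ i, 1 ≤ i → i < out v → ∃ u < n, out u = i ∧ Aj v u

theorem Greedy.Inv.isGrundyMap {n cnt : ℕ} {Aj : ℕ → ℕ → Prop} {lab c out : ℕ → ℕ}
    (h : Greedy.Inv n Aj lab c cnt) (hc : ∀ v < n, c v ≠ 0) (hout : ∀ v < n, out v = c v) :
    IsGrundyMap n Aj out cnt where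
  range v hv := by
    rw [hout v hv]
    exact ⟨Nat.one_le_iff_ne_zero.2 (hc v hv), h.le v hv⟩
  surj i hi hi' := by
    obtain ⟨v, hv, hcv⟩ := h.surj i hi hi'
    exact ⟨v, hv, by rw [hout v hv, hcv]⟩
  proper v hv w hw heq := by
    rw [hout v hv, hout w hw] at heq
    exact h.proper v hv w hw (hc v hv) heq
  nbr v hv i hi hi' := by
    rw [hout v hv] at hi'
    obtain ⟨u, hu, hcu, hvu⟩ := h.nbr v hv i hi (hi'.le.trans (h.le v hv)) (Or.inl hi')
    exact ⟨u, hu, by rw [hout u hu, hcu], hvu⟩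

namespace RAM

/-- The best colouring found so far is a Grundy colouring. -/
def Best (σ : State) : Prop :=
  σ.reg 1 = 0 ∨ IsGrundyMap (guessOf σ).n (guessOf σ).Aj (σ.arr 2) (σ.reg 1)

namespace Program

open Tm Stmt

theorem record_spec {σ : State} (hσ : Consts σ) {lab : ℕ → ℕ}
    (hI : Greedy.Inv (σ.reg 0) (guessOf σ).Aj lab (σ.arr 9) (σ.reg 17)) (hB : Best σ) :
    Best (record.run σ) ∧ σ.reg 1 ≤ (record.run σ).reg 1 ∧
      ((∀ v < σ.reg 0, σ.arr 9 v ≠ 0) → σ.reg 17 ≤ (record.run σ).reg 1) := by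
  have hn := hσ.two_le
  have hbig := sq_lt_pow_eight hn
  have hlin : 4 * σ.reg 0 < σ.reg 0 ^ 8 := by nlinarith
  have hcnt := hI.cnt_le
  have hg : guessOf (record.run σ) = guessOf σ := record.run_guessOf rfl σ
  unfold Best
  rw [hg]
  have hcond : (and (all 20 0 (get 9 (var 20))) (lt (var 1) (var 17))).Holds σ ↔
      (∀ v < σ.reg 0, σ.arr 9 v ≠ 0) ∧ σ.reg 1 < σ.reg 17 := by
    simp [setReg_reg]
  by_cases h : (∀ v < σ.reg 0, σ.arr 9 v ≠ 0) ∧ σ.reg 1 < σ.reg 17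
  · rw [record, run_ite_pos (hcond.2 h), run_seq, run_set (by simp only [eval_var]; omega)]
    set σ₁ := σ.setReg 1 ((var 17).eval σ) with hσ₁
    have h0 : σ₁.reg 0 = σ.reg 0 := by simp [hσ₁, setReg_reg]
    set p := loop 18 0 (put 2 (var 18) (get 9 (var 18))) with hp
    have h1 : (p.run σ₁).reg 1 = σ.reg 17 := by
      rw [p.run_reg σ₁ rfl, hσ₁]; simp [setReg_reg]
    have h2 : ∀ v < σ₁.reg 0, (p.run σ₁).arr 2 v = σ.arr 9 v := by
      refine loop_inv (x := 18) (c := 0) (σ := σ₁)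
        (fun k τ => ∀ v < k, τ.arr 2 v = σ.arr 9 v)
        (fun v hv => absurd hv (Nat.not_lt_zero v)) ?_
      intro k hk τ hτ hI' v hv
      have h9 : τ.arr 9 = σ.arr 9 := hτ.arr 9 rfl
      have hle := hI.le k (by omega)
      rw [run_put (by simp [setReg_reg, h9, hτ.reg 0 rfl, h0]; omega), setArr_arr]
      rcases Nat.lt_succ_iff_lt_or_eq.1 hv with h' | rfl
      · simp [setReg_reg, h'.ne, hI' v h']
      · simp [setReg_reg, h9]
    rw [h0] at h2
    rw [h1]
    exact ⟨Or.inr (hI.isGrundyMap h.1 h2), h.2.le, fun _ => le_rfl⟩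
  · rw [record, run_ite_neg fun h' => h (hcond.1 h')]
    have h1 : ((set 14 (lit 0)).run σ).reg 1 = σ.reg 1 := Stmt.run_reg _ _ rfl
    have h2 : ((set 14 (lit 0)).run σ).arr 2 = σ.arr 2 := rfl
    rw [h1, h2]
    refine ⟨hB, le_rfl, fun hc => ?_⟩
    by_contra hcon
    exact h ⟨hc, by omega⟩

/-- Soundness does not depend on the guess: only complete greedy colourings are recorded, and these
are Grundy. If the guess describes a colouring, the matching exists, its labels can be ordered, and
the greedy procedure uses at least as many colours as there are labels. -/
theorem process_spec {σ : State} (hσ : Consts σ) (hB : Best σ) :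
    Best (process.run σ) ∧ σ.reg 1 ≤ (process.run σ).reg 1 ∧
      ∀ col ℓ, (guessOf σ).IsTwoCluster → (guessOf σ).IsGrundy col ℓ → (guessOf σ).Describes col →
        ℓ ≤ (process.run σ).reg 1 := by
  set σ₁ := fillEdges.run σ with hσ₁
  set σ₂ := auction.run σ₁ with hσ₂
  set σ₃ := labels.run σ₂ with hσ₃
  set σ₄ := greedy.run σ₃ with hσ₄
  have hrun : process.run σ = record.run σ₄ := rfl
  have f₁ : fillEdges.Frame σ σ₁ := Stmt.frame _ _
  have f₂ : auction.Frame σ₁ σ₂ := Stmt.frame _ _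
  have f₃ : labels.Frame σ₂ σ₃ := Stmt.frame _ _
  have f₄ : greedy.Frame σ₃ σ₄ := Stmt.frame _ _
  have c₁ : Consts σ₁ := f₁.consts hσ rfl
  have c₂ : Consts σ₂ := f₂.consts c₁ rfl
  have c₃ : Consts σ₃ := f₃.consts c₂ rfl
  have c₄ : Consts σ₄ := f₄.consts c₃ rfl
  have g₁ : guessOf σ₁ = guessOf σ := f₁.guessOf_eq rfl
  have g₂ : guessOf σ₂ = guessOf σ := (f₂.guessOf_eq rfl).trans g₁
  have g₃ : guessOf σ₃ = guessOf σ := (f₃.guessOf_eq rfl).trans g₂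
  have g₄ : guessOf σ₄ = guessOf σ := (f₄.guessOf_eq rfl).trans g₃
  have r1 : σ₄.reg 1 = σ.reg 1 := by
    rw [f₄.reg 1 rfl, f₃.reg 1 rfl, f₂.reg 1 rfl, f₁.reg 1 rfl]
  have a2 : σ₄.arr 2 = σ.arr 2 := by
    rw [f₄.arr 2 rfl, f₃.arr 2 rfl, f₂.arr 2 rfl, f₁.arr 2 rfl]
  have e0 : ∀ {τ}, guessOf τ = guessOf σ → τ.reg 0 = σ.reg 0 := fun {τ} h =>
    congrArg Guess.n h
  obtain ⟨hinv, hcomplete⟩ := greedy_spec c₃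
  have hB₄ : Best σ₄ := by
    unfold Best
    rw [r1, a2, g₄]
    exact hB
  obtain ⟨h1, h2, h3⟩ := record_spec c₄ (lab := σ₃.arr 8)
    (by rw [e0 g₄, g₄, ← e0 g₃, ← g₃]; exact hinv) hB₄
  rw [hrun]
  refine ⟨h1, r1 ▸ h2, fun col ℓ hc hg hd => ?_⟩
  have h40 : σ.reg 4 = (guessOf σ).n + (guessOf σ).n + (guessOf σ).n := hσ.r4
  have h4₁ : σ₁.reg 4 = σ.reg 4 := f₁.reg 4 rfl
  have h4₂ : σ₂.reg 4 = σ.reg 4 := (f₂.reg 4 rfl).trans h4₁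
  have h4₃ : σ₃.reg 4 = σ.reg 4 := (f₃.reg 4 rfl).trans h4₂
  have hmatch : Auction.Matched (σ.reg 4) (guessOf σ).Edge (σ₂.arr 6) := by
    have := auction_spec c₁ (E := (guessOf σ).Edge)
      (by rw [h4₁]; exact fun x hx y hy => fillEdges_spec hσ hx hy)
      (by rw [h4₁, h40]; exact Guess.feasible hc hg hd)
    rwa [h4₁] at this
  have hlab : (guessOf σ).IsLabelling (σ₂.arr 6) (σ₃.arr 8) := by
    have := labels_spec c₂ (by rw [g₂, h4₂]; exact hmatch)
    rwa [g₂] at this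
  rw [h40] at hmatch
  obtain ⟨key, hkey⟩ := Guess.exists_key hc hg hd hmatch hlab
  have hord : Greedy.Orderable (σ₃.reg 0) (guessOf σ₃).Aj (σ₃.arr 8) key := by
    rw [e0 g₃, g₃]
    exact ⟨fun v hv w hw h => Guess.lab_independent hc hg hd hmatch hlab hv hw h,
      fun v hv w hw h h' => Guess.lab_dominates hc hg hd hmatch hlab hkey hv hw h h'⟩
  have hlt : ∀ v < σ₃.reg 0, σ₃.arr 8 v < σ₃.reg 4 := by
    intro v hv
    rw [e0 g₃] at hv
    rw [h4₃, h40]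
    have hr := hc.r_le
    rcases Guess.lab_cases hc hg hd hmatch hlab hv with ⟨t, ht, h⟩ | ⟨a, ha, _, h⟩
    · have := Guess.lev_lt ht
      rw [h]; omega
    · have := ha.1
      rw [h]; omega
  have hcol := hcomplete key hord hlt
  have h5 := hinv.card_labels_le hcol
  rw [e0 g₃] at h5
  exact (Guess.le_card_labels hc hg hd hmatch hlab).trans
    (h5.trans (h3 fun v hv => hcol v (by rwa [e0 g₃, ← e0 g₄])))

end Program

end RAM

/-! ### The search over base vertices, numbers of single classes and thresholds -/

/-- No Grundy colouring that the guess describes has more than `m` colours. -/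
def Guess.Bounded (g : Guess) (m : ℕ) : Prop :=
  ∀ col ℓ, g.IsTwoCluster → g.IsGrundy col ℓ → g.Describes col → ℓ ≤ m

theorem Guess.Bounded.mono {g : Guess} {m m' : ℕ} (h : g.Bounded m) (hm : m ≤ m') : g.Bounded m' :=
  fun col ℓ h1 h2 h3 => (h col ℓ h1 h2 h3).trans hm

namespace RAM

theorem Consts.setReg {σ : State} (h : Consts σ) {x : ℕ} (hx : 8 ≤ x) (v : ℕ) :
    Consts (σ.setReg x v) := by
  have e : ∀ y, y < 8 → (σ.setReg x v).reg y = σ.reg y := fun y hy => by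
    rw [setReg_reg, if_neg (by omega)]
  constructor <;> simp only [e 0 (by norm_num), e 2 (by norm_num), e 3 (by norm_num),
    e 4 (by norm_num), e 5 (by norm_num), e 6 (by norm_num), e 7 (by norm_num)]
  exacts [h.two_le, h.r_le, h.r3, h.r4, h.r5, h.r6, h.r7]

theorem Best.setReg {σ : State} (h : Best σ) {x : ℕ} (hx : 8 ≤ x) (v : ℕ) :
    Best (σ.setReg x v) := by
  have e : ∀ y, y < 8 → (σ.setReg x v).reg y = σ.reg y := fun y hy => by
    rw [setReg_reg, if_neg (by omega)]
  simpa only [Best, guessOf, e 0 (by norm_num), e 1 (by norm_num), setReg_arr] using h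

namespace Program

open Tm Stmt

/-- The record never decreases, so a bound `F` that is monotone in the record survives later rounds.
The lemma is applied to three nested loops. -/
theorem search_loop {x c : ℕ} {p : Stmt} {σ : State} (hx : 8 ≤ x) (hσ : Consts σ) (hB : Best σ)
    {F : ℕ → ℕ → Prop} (hF : ∀ k m m', F k m → m ≤ m' → F k m')
    (hc : ((loop x c p).assigns 0 || (loop x c p).assigns 2 || (loop x c p).assigns 3 ||
      (loop x c p).assigns 4 || (loop x c p).assigns 5 || (loop x c p).assigns 6 ||
      (loop x c p).assigns 7) = false)
    (hp : ∀ k < σ.reg c, ∀ τ, (loop x c p).Frame σ τ → ∀ τ', τ' = τ.setReg x k → Consts τ' →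
      Best τ' → Best (p.run τ') ∧ τ'.reg 1 ≤ (p.run τ').reg 1 ∧ F k ((p.run τ').reg 1)) :
    Best ((loop x c p).run σ) ∧ σ.reg 1 ≤ ((loop x c p).run σ).reg 1 ∧
      ∀ k < σ.reg c, F k (((loop x c p).run σ).reg 1) := by
  refine loop_inv (x := x) (c := c) (p := p) (σ := σ)
    (fun k τ => Best τ ∧ σ.reg 1 ≤ τ.reg 1 ∧ ∀ i < k, F i (τ.reg 1))
    ⟨hB, le_rfl, fun i hi => absurd hi (Nat.not_lt_zero i)⟩ ?_
  intro k hk τ hτ ⟨h1, h2, h3⟩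
  obtain ⟨h4, h5, h6⟩ := hp k hk τ hτ _ rfl ((hτ.consts hσ hc).setReg hx k) (h1.setReg hx k)
  rw [setReg_reg, if_neg (by omega)] at h5
  refine ⟨h4, h2.trans h5, fun i hi => ?_⟩
  rcases Nat.lt_succ_iff_lt_or_eq.1 hi with h | rfl
  · exact hF _ _ _ (h3 i h) h5
  · exact h6

theorem processAll_spec {σ : State} (hσ : Consts σ) (hB : Best σ) :
    Best (processAll.run σ) ∧ σ.reg 1 ≤ (processAll.run σ).reg 1 ∧
      ∀ v < σ.reg 0, ∀ d < σ.reg 7, ∀ t < σ.reg 3,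
        ({ guessOf σ with v₀ := v, d := d, th := t } : Guess).Bounded
          ((processAll.run σ).reg 1) := by
  refine search_loop (x := 10) (c := 0) (F := fun v m => ∀ d < σ.reg 7, ∀ t < σ.reg 3,
    ({ guessOf σ with v₀ := v, d := d, th := t } : Guess).Bounded m) (by norm_num) hσ hB
    (fun k m m' h hm d hd t ht => (h d hd t ht).mono hm) rfl ?_
  rintro v hv τ hτ τ' rfl hc hb
  have e7 : (τ.setReg 10 v).reg 7 = σ.reg 7 := hτ.reg 7 rfl
  rw [← e7]
  refine search_loop (x := 11) (c := 7) (F := fun d m => ∀ t < σ.reg 3,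
    ({ guessOf σ with v₀ := v, d := d, th := t } : Guess).Bounded m) (by norm_num) hc hb
    (fun k m m' h hm t ht => (h t ht).mono hm) rfl ?_
  rintro d hd υ hυ υ' rfl hc' hb'
  have e3 : (υ.setReg 11 d).reg 3 = σ.reg 3 := (hυ.reg 3 rfl).trans (hτ.reg 3 rfl)
  rw [← e3]
  refine search_loop (x := 12) (c := 3) (F := fun t m => 
    ({ guessOf σ with v₀ := v, d := d, th := t } : Guess).Bounded m) (by norm_num) hc' hb'
    (fun k m m' h hm => h.mono hm) rfl ?_
  rintro t ht φ hφ φ' rfl hc'' hb''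
  obtain ⟨h1, h2, h3⟩ := process_spec hc'' hb''
  have hg : guessOf (φ.setReg 12 t) = { guessOf σ with v₀ := v, d := d, th := t } := by
    have a0 : φ.arr 0 = σ.arr 0 := (hφ.arr 0 rfl).trans ((hυ.arr 0 rfl).trans (hτ.arr 0 rfl))
    have a1 : φ.arr 1 = σ.arr 1 := (hφ.arr 1 rfl).trans ((hυ.arr 1 rfl).trans (hτ.arr 1 rfl))
    have a3 : φ.arr 3 = σ.arr 3 := (hφ.arr 3 rfl).trans ((hυ.arr 3 rfl).trans (hτ.arr 3 rfl))
    have a4 : φ.arr 4 = σ.arr 4 := (hφ.arr 4 rfl).trans ((hυ.arr 4 rfl).trans (hτ.arr 4 rfl))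
    have r0 : (φ.setReg 12 t).reg 0 = σ.reg 0 :=
      (hφ.reg 0 rfl).trans ((hυ.reg 0 rfl).trans (hτ.reg 0 rfl))
    have r2 : (φ.setReg 12 t).reg 2 = σ.reg 2 :=
      (hφ.reg 2 rfl).trans ((hυ.reg 2 rfl).trans (hτ.reg 2 rfl))
    have r10 : (φ.setReg 12 t).reg 10 = v := (hφ.reg 10 rfl).trans (hυ.reg 10 rfl)
    have r11 : (φ.setReg 12 t).reg 11 = d := hφ.reg 11 rfl
    have r12 : (φ.setReg 12 t).reg 12 = t := by rw [setReg_reg, if_pos rfl]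
    simp only [guessOf, setReg_arr, a0, a1, a3, a4, r0, r2, r10, r11, r12]
  rw [hg] at h3
  exact ⟨h1, h2, h3⟩

end Program

end RAM

/-! ### The binary counter for the bit patterns -/

/-- The number with the binary digits `a 0, …, a (m - 1)`, nonzero entries counting as `1`. -/
def binary (a : ℕ → ℕ) : ℕ → ℕ
  | 0 => 0
  | m + 1 => binary a m + if a m ≠ 0 then 2 ^ m else 0

theorem binary_lt (a : ℕ → ℕ) (m : ℕ) : binary a m < 2 ^ m := by
  induction m with
  | zero => simp [binary]
  | succ m ih =>
      rw [binary, pow_succ]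
      split_ifs <;> omega

theorem binary_congr {a b : ℕ → ℕ} {m : ℕ} (h : ∀ i < m, a i = b i) : binary a m = binary b m := by
  induction m with
  | zero => rfl
  | succ m ih => rw [binary, binary, ih fun i hi => h i (by omega), h m (by omega)]

theorem binary_inj {a b : ℕ → ℕ} {m : ℕ} (h : binary a m = binary b m) :
    ∀ i < m, a i ≠ 0 ↔ b i ≠ 0 := by
  induction m with
  | zero => exact fun i hi => absurd hi (Nat.not_lt_zero i)
  | succ m ih =>
      have ha := binary_lt a m
      have hb := binary_lt b m
      rw [binary, binary] at h
      intro i hi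
      rcases Nat.lt_succ_iff_lt_or_eq.1 hi with h' | rfl
      · refine ih ?_ i h'
        split_ifs at h <;> omega
      · by_cases h1 : a i = 0 <;> by_cases h2 : b i = 0 <;> simp [h1, h2] at h ⊢ <;> omega

namespace RAM

namespace Program

open Tm Stmt

theorem increment_spec {σ : State} (hσ : Consts σ) :
    ((increment.run σ).reg 8 ≠ 0 ∧
      binary ((increment.run σ).arr 4) (σ.reg 6) = binary (σ.arr 4) (σ.reg 6) + 1) ∨
    ((increment.run σ).reg 8 = 0 ∧ binary (σ.arr 4) (σ.reg 6) + 1 = 2 ^ σ.reg 6) := by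
  have hbig : 1 < σ.reg 0 ^ 8 := by
    have := sq_lt_pow_eight hσ.two_le
    have := hσ.two_le
    nlinarith
  set p := ite (var 9) (ite (get 4 (var 18)) (put 4 (var 18) (lit 0))
      (seq (put 4 (var 18) (lit 1)) (set 9 (lit 0)))) (set 14 (lit 0)) with hp
  have hrun : increment.run σ = (set 8 (not (var 9))).run ((loop 18 6 p).run (σ.setReg 9 1)) := by
    have h1 : (set 9 (lit 1)).run σ = σ.setReg 9 1 := run_set hbig
    rw [increment, run_seq, run_seq, h1]
  set σ' := (loop 18 6 p).run (σ.setReg 9 1) with hσ'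
  have h6 : (σ.setReg 9 1).reg 6 = σ.reg 6 := rfl
  -- Register `9` is the carry: after `k` digits the new low part plus the carry times `2 ^ k` is
  -- the old low part plus `1`, and the higher digits are untouched.
  have key : σ'.reg 9 ≤ 1 ∧
      binary (σ'.arr 4) (σ.reg 6) + σ'.reg 9 * 2 ^ σ.reg 6 = binary (σ.arr 4) (σ.reg 6) + 1 ∧
      ∀ i, σ.reg 6 ≤ i → σ'.arr 4 i = σ.arr 4 i := by
    rw [← h6]
    refine loop_inv (x := 18) (c := 6) (p := p) (σ := σ.setReg 9 1)
      (fun k τ => τ.reg 9 ≤ 1 ∧ binary (τ.arr 4) k + τ.reg 9 * 2 ^ k = binary (σ.arr 4) k + 1 ∧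
        ∀ i, k ≤ i → τ.arr 4 i = σ.arr 4 i) ?_ ?_
    · simp [setReg_reg, binary]
    · intro k hk τ hτ ⟨h1, h2, h3⟩
      have r0 : τ.reg 0 = σ.reg 0 := hτ.reg 0 rfl
      have hk' := h3 k le_rfl
      have h18 : (τ.setReg 18 k).reg 18 = k := by rw [setReg_reg, if_pos rfl]
      have h9 : (τ.setReg 18 k).reg 9 = τ.reg 9 := rfl
      have h0 : (τ.setReg 18 k).reg 0 = σ.reg 0 := r0
      set τ' := τ.setReg 18 k with hτ'
      have harr : τ'.arr = τ.arr := rfl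
      by_cases c1 : τ.reg 9 = 0
      · have e : p.run τ' = τ'.setReg 14 0 := by
          rw [hp, run_ite_neg (by simp [Holds, h9, c1]), run_set (by simp [h0]; omega), eval_lit]
        rw [e]
        refine ⟨h1, ?_, fun i hi => h3 i (by omega)⟩
        change binary (τ.arr 4) (k + 1) + τ.reg 9 * 2 ^ (k + 1) = _
        rw [binary, binary, hk']
        rw [c1] at h2 ⊢
        omega
      · have c1' : τ.reg 9 = 1 := by omega
        have hcong : ∀ v, binary (((τ'.setArr 4 k v).arr) 4) k = binary (τ.arr 4) k := fun v =>
          binary_congr fun i hi => by rw [setArr_arr, if_neg (by omega), harr]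
        have hge : ∀ v i, k + 1 ≤ i → (τ'.setArr 4 k v).arr 4 i = σ.arr 4 i := fun v i hi => by
          rw [setArr_arr, if_neg (by omega), harr, h3 i (by omega)]
        have hat : ∀ v, (τ'.setArr 4 k v).arr 4 k = v := fun v => by
          rw [setArr_arr, if_pos ⟨rfl, rfl⟩]
        rw [c1', one_mul] at h2
        by_cases c2 : σ.arr 4 k = 0
        · have e : p.run τ' = (τ'.setArr 4 k 1).setReg 9 0 := by
            rw [hp, run_ite_pos (by simp [Holds, h9, c1]),
              run_ite_neg (by simp [h18, harr, hk', c2]), run_seq,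
              run_put (by simpa [h0] using hbig), run_set (by simp [h0]; omega), eval_var, h18]
            rfl
          rw [e, setReg_arr, setReg_reg, if_pos rfl]
          refine ⟨by norm_num, ?_, hge 1⟩
          rw [binary, binary, hcong, hat, c2]
          simp
          omega
        · have e : p.run τ' = τ'.setArr 4 k 0 := by
            rw [hp, run_ite_pos (by simp [Holds, h9, c1]),
              run_ite_pos (by simp [h18, harr, hk', c2]),
              run_put (by simp [h0]; omega), eval_var, h18]
            rfl
          rw [e, setArr_reg, h9, c1']
          refine ⟨le_rfl, ?_, hge 0⟩
          rw [binary, binary, hcong, hat, pow_succ]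
          simp [c2]
          omega
  obtain ⟨k1, k2, -⟩ := key
  have r0 : σ'.reg 0 = σ.reg 0 := by
    rw [hσ', Stmt.run_reg _ _ rfl]; rfl
  have e8 : (increment.run σ).reg 8 = if σ'.reg 9 = 0 then 1 else 0 := by
    rw [hrun, run_set, setReg_reg, if_pos rfl]
    · rfl
    · change (if σ'.reg 9 = 0 then 1 else 0) < _
      rw [r0]
      split_ifs <;> omega
  have e4 : (increment.run σ).arr 4 = σ'.arr 4 := by rw [hrun]; rfl
  have hlt := binary_lt (σ.arr 4) (σ.reg 6)
  rw [e8, e4]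
  by_cases h : σ'.reg 9 = 0
  · left
    rw [h] at k2
    rw [if_pos h]
    exact ⟨one_ne_zero, by omega⟩
  · right
    have h' : σ'.reg 9 = 1 := by omega
    rw [h'] at k2
    rw [if_neg h]
    exact ⟨rfl, by omega⟩

end Program

end RAM

/-! ### Initialisation -/

namespace RAM

namespace Program

open Tm Stmt

open Classical in
/-- The result of the initialization. -/
structure Initial (σ τ : State) : Prop where
  consts : Consts τ
  reg0 : τ.reg 0 = σ.reg 0
  reg1 : τ.reg 1 = σ.reg 1
  reg2 : τ.reg 2 = Nat.count (fun v => σ.arr 1 v ≠ 0) (σ.reg 0)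
  reg8 : τ.reg 8 = 1
  arr0 : τ.arr 0 = σ.arr 0
  arr1 : τ.arr 1 = σ.arr 1
  arr4 : τ.arr 4 = σ.arr 4
  mem : ∀ j < τ.reg 2, τ.arr 3 j < σ.reg 0 ∧ σ.arr 1 (τ.arr 3 j) ≠ 0
  surj : ∀ v < σ.reg 0, σ.arr 1 v ≠ 0 → ∃ j < τ.reg 2, τ.arr 3 j = v

theorem init_spec {σ : State} (hn : 2 ≤ σ.reg 0) (h2 : σ.reg 2 = 0) : Initial σ (init.run σ) := by
  classical
  have hbig := sq_lt_pow_eight hn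
  set p := ite (get 1 (var 18))
      (seq (put 3 (var 2) (var 18)) (set 2 (add (var 2) (lit 1)))) (set 14 (lit 0)) with hp
  set τ := (loop 18 0 p).run σ with hτ
  have hf : (loop 18 0 p).Frame σ τ := Stmt.frame _ _
  have r0 : τ.reg 0 = σ.reg 0 := hf.reg 0 rfl
  have key : τ.reg 2 = Nat.count (fun v => σ.arr 1 v ≠ 0) (σ.reg 0) ∧
      (∀ j < τ.reg 2, τ.arr 3 j < σ.reg 0 ∧ σ.arr 1 (τ.arr 3 j) ≠ 0) ∧
      (∀ v < σ.reg 0, σ.arr 1 v ≠ 0 → ∃ j < τ.reg 2, τ.arr 3 j = v) := by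
    refine loop_inv (x := 18) (c := 0) (p := p) (σ := σ)
      (fun k τ => τ.reg 2 = Nat.count (fun v => σ.arr 1 v ≠ 0) k ∧
        (∀ j < τ.reg 2, τ.arr 3 j < σ.reg 0 ∧ σ.arr 1 (τ.arr 3 j) ≠ 0) ∧
        (∀ v < k, σ.arr 1 v ≠ 0 → ∃ j < τ.reg 2, τ.arr 3 j = v)) ?_ ?_
    · simp [h2]
    · intro k hk υ hυ ⟨i1, i2, i3⟩
      have a1 : υ.arr 1 = σ.arr 1 := hυ.arr 1 rfl
      have h18 : (υ.setReg 18 k).reg 18 = k := by rw [setReg_reg, if_pos rfl]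
      have h0 : (υ.setReg 18 k).reg 0 = σ.reg 0 := hυ.reg 0 rfl
      have h2' : (υ.setReg 18 k).reg 2 = υ.reg 2 := rfl
      have harr : (υ.setReg 18 k).arr = υ.arr := rfl
      set υ' := υ.setReg 18 k with hυ'
      have hle : υ.reg 2 ≤ k := i1 ▸ Nat.count_le _
      by_cases c : σ.arr 1 k = 0
      · have e : p.run υ' = υ'.setReg 14 0 := by
          rw [hp, run_ite_neg (by simp [h18, harr, a1, c]),
            run_set (by rw [h0]; exact pow_pos (by omega) 8), eval_lit]
        rw [e]
        refine ⟨?_, i2, fun v hv hv' => ?_⟩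
        · rw [Nat.count_succ, if_neg (by simp [c])]
          exact i1
        · rcases Nat.lt_succ_iff_lt_or_eq.1 hv with h | rfl
          · exact i3 v h hv'
          · exact absurd c hv'
      · have e : p.run υ' = (υ'.setArr 3 (υ.reg 2) k).setReg 2 (υ.reg 2 + 1) := by
          have hs : 64 * σ.reg 0 ≤ σ.reg 0 ^ 8 := le_trans (by nlinarith) hbig
          rw [hp, run_ite_pos (by simp [h18, harr, a1, c]), run_seq,
            run_put (by rw [eval_var, h18, h0]; omega),
            run_set (by rw [setArr_reg, h0, eval_add, eval_var, setArr_reg, h2', eval_lit]; omega)]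
          simp [h18, h2']
        have e2 : (p.run υ').reg 2 = υ.reg 2 + 1 := by rw [e, setReg_reg, if_pos rfl]
        have e3 : ∀ j, (p.run υ').arr 3 j = if j = υ.reg 2 then k else υ.arr 3 j := fun j => by
          rw [e, setReg_arr, setArr_arr, harr]
          simp only [true_and]
        rw [e2]
        refine ⟨?_, fun j hj => ?_, fun v hv hv' => ?_⟩
        · rw [Nat.count_succ, if_pos (by simp [c]), i1]
        · rw [e3]
          split_ifs with h
          · exact ⟨hk, c⟩
          · exact i2 j (by omega)
        · rcases Nat.lt_succ_iff_lt_or_eq.1 hv with h | rfl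
          · obtain ⟨j, hj, hjv⟩ := i3 v h hv'
            exact ⟨j, by omega, by rw [e3, if_neg (by omega), hjv]⟩
          · exact ⟨υ.reg 2, by omega, by rw [e3, if_pos rfl]⟩
  obtain ⟨k1, k2, k3⟩ := key
  have hr : τ.reg 2 ≤ σ.reg 0 := k1 ▸ Nat.count_le _
  have e : init.run σ = ((((((τ.setReg 3 (τ.reg 2 + 1)).setReg 4
      (τ.reg 0 + τ.reg 0 + τ.reg 0)).setReg 5
      ((τ.reg 0 + τ.reg 0 + τ.reg 0) * (τ.reg 0 + τ.reg 0 + τ.reg 0) + 1)).setReg 6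
      (6 * (τ.reg 2 * τ.reg 2))).setReg 7 (τ.reg 0 + 1)).setReg 8 1) := by
    have hs : 64 * σ.reg 0 ≤ σ.reg 0 ^ 8 := le_trans (by nlinarith) hbig
    have hrr : τ.reg 2 * τ.reg 2 ≤ σ.reg 0 * σ.reg 0 := Nat.mul_le_mul hr hr
    rw [init, run_seq, ← hτ, run_seq, run_set (by simp [r0]; omega), run_seq,
      run_set (by simp [setReg_reg, r0]; omega), run_seq,
      run_set (by simp [setReg_reg, r0]; nlinarith), run_seq,
      run_set (by simp [setReg_reg, r0]; nlinarith), run_seq,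
      run_set (x := 7) (by simp [setReg_reg, r0]; omega),
      run_set (x := 8) (by simp [setReg_reg, r0]; omega)]
    simp [setReg_reg]
  have hF : init.Frame σ (init.run σ) := Stmt.frame _ _
  have e2 : (init.run σ).reg 2 = τ.reg 2 := by rw [e]; rfl
  have e3 : (init.run σ).arr 3 = τ.arr 3 := by rw [e]; rfl
  refine ⟨?_, hF.reg 0 rfl, hF.reg 1 rfl, e2.trans k1, by rw [e]; rfl, hF.arr 0 rfl,
    hF.arr 1 rfl, hF.arr 4 rfl, ?_, ?_⟩
  · rw [e]
    constructor <;> simp [setReg_reg, r0, hn, hr]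
  · rw [e2, e3]; exact k2
  · rw [e2, e3]; exact k3

end Program

end RAM

/-! ### The main loop -/

namespace RAM

/-- The states agree on the graph and the enumeration of its modulator. -/
structure SameGraph (σ τ : State) : Prop where
  reg0 : τ.reg 0 = σ.reg 0
  reg2 : τ.reg 2 = σ.reg 2
  arr0 : τ.arr 0 = σ.arr 0
  arr1 : τ.arr 1 = σ.arr 1
  arr3 : τ.arr 3 = σ.arr 3

theorem SameGraph.trans {σ τ υ : State} (h : SameGraph σ τ) (h' : SameGraph τ υ) : SameGraph σ υ :=
  ⟨h'.reg0.trans h.reg0, h'.reg2.trans h.reg2, h'.arr0.trans h.arr0, h'.arr1.trans h.arr1,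
    h'.arr3.trans h.arr3⟩

namespace Program

open Tm Stmt

/-- The bits `a` on the graph of `σ` have been processed, and at most `m` colours were found. -/
def Processed (σ : State) (a : ℕ → ℕ) (m : ℕ) : Prop :=
  ∃ τ, SameGraph σ τ ∧ (∀ i < σ.reg 6, τ.arr 4 i ≠ 0 ↔ a i ≠ 0) ∧
    ∀ v < σ.reg 0, ∀ d < σ.reg 7, ∀ t < σ.reg 3,
      ({ guessOf τ with v₀ := v, d := d, th := t } : Guess).Bounded m

theorem Processed.mono {σ : State} {a : ℕ → ℕ} {m m' : ℕ} (h : Processed σ a m) (hm : m ≤ m') :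
    Processed σ a m' :=
  let ⟨τ, h1, h2, h3⟩ := h
  ⟨τ, h1, h2, fun v hv d hd t ht => (h3 v hv d hd t ht).mono hm⟩

/-- The state after some iterations of the main loop, started at `σ`. -/
structure Reached (σ τ : State) : Prop where
  consts : Consts τ
  best : Best τ
  same : SameGraph σ τ
  regs : ∀ x, Program.consts x = true → τ.reg x = σ.reg x

/-- The program looks only at whether a bit is nonzero, and the binary value determines this. So one
iteration deals with every `a` of the current value. -/
theorem Reached.run_body {σ τ : State} (h : Reached σ τ) : Reached σ (body.run τ) ∧
    τ.reg 1 ≤ (body.run τ).reg 1 ∧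
    (∀ a, binary a (σ.reg 6) = binary (τ.arr 4) (σ.reg 6) →
      Processed σ a ((body.run τ).reg 1)) ∧
    (((body.run τ).reg 8 ≠ 0 ∧
        binary ((body.run τ).arr 4) (σ.reg 6) = binary (τ.arr 4) (σ.reg 6) + 1) ∨
      ((body.run τ).reg 8 = 0 ∧ binary (τ.arr 4) (σ.reg 6) + 1 = 2 ^ σ.reg 6)) := by
  have hf : body.Frame τ (body.run τ) := Stmt.frame _ _
  obtain ⟨h1, h2, h3⟩ := processAll_spec h.consts h.best
  have hf' : processAll.Frame τ (processAll.run τ) := Stmt.frame _ _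
  have hf'' : increment.Frame (processAll.run τ) (body.run τ) := Stmt.frame _ _
  have e1 : (body.run τ).reg 1 = (processAll.run τ).reg 1 := hf''.reg 1 rfl
  have hc := hf'.consts h.consts rfl
  have h6 : (processAll.run τ).reg 6 = σ.reg 6 := (hf'.reg 6 rfl).trans (h.regs 6 rfl)
  have h4 : (processAll.run τ).arr 4 = τ.arr 4 := hf'.arr 4 rfl
  have hinc := increment_spec hc
  rw [h6, h4] at hinc
  refine ⟨⟨hf.consts h.consts rfl, ?_, h.same.trans ⟨hf.reg 0 rfl, hf.reg 2 rfl, hf.arr 0 rfl,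
    hf.arr 1 rfl, hf.arr 3 rfl⟩, fun x hx => ?_⟩, ?_, fun a ha => ?_, hinc⟩
  · have a0 : (body.run τ).arr 0 = (processAll.run τ).arr 0 := hf''.arr 0 rfl
    have a2 : (body.run τ).arr 2 = (processAll.run τ).arr 2 := hf''.arr 2 rfl
    have r0 : (body.run τ).reg 0 = (processAll.run τ).reg 0 := hf''.reg 0 rfl
    simpa only [Best, guessOf, a0, a2, r0, e1] using h1
  · rw [body.run_const τ body_ok x hx, h.regs x hx]
  · rw [e1]; exact h2
  · rw [e1]
    rw [h.regs 3 rfl, h.regs 7 rfl, h.regs 0 rfl] at h3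
    exact ⟨τ, h.same, fun i hi => (binary_inj ha i hi).symm, h3⟩

/-- Induction on the number `j` of patterns left. All patterns of smaller value have been processed,
so at the overflow all patterns have. -/
theorem exec_loop {B K T : ℕ} {κ : ℕ → ℕ} {σ : State} (hK : body.names ≤ K) (hK8 : 8 < K)
    (hn : 2 ≤ σ.reg 0) (hB : (σ.reg 0 ^ 8) ^ body.size ≤ B) (hT : body.time κ ≤ T)
    (hκ : ∀ c, consts c = true → σ.reg c ≤ κ c) (j : ℕ) :
    ∀ s τ, Repr K id K s τ → Reached σ τ → τ.Below (σ.reg 0 ^ 8) → τ.reg 8 ≠ 0 →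
      binary (τ.arr 4) (σ.reg 6) + j = 2 ^ σ.reg 6 →
      (∀ a, binary a (σ.reg 6) < binary (τ.arr 4) (σ.reg 6) → Processed σ a (τ.reg 1)) →
      ∃ t s' τ', Exec B (.loop (.reg 8) (body.comp K)) s t s' ∧ t ≤ j * (T + 2) + 2 ∧
        Repr K id K s' τ' ∧ Reached σ τ' ∧ ∀ a, Processed σ a (τ'.reg 1) := by
  have hM : 2 ≤ σ.reg 0 ^ 8 := hn.trans (Nat.le_self_pow (by norm_num) _)
  have hMB : σ.reg 0 ^ 8 ≤ B := (Nat.le_self_pow (by decide) _).trans hB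
  induction j with
  | zero =>
      intro s τ _ _ _ _ hj
      have := binary_lt (τ.arr 4) (σ.reg 6)
      omega
  | succ j ih =>
      intro s τ hs hτ hb h8 hj hproc
      obtain ⟨hR, hle, hnew, hinc⟩ := hτ.run_body
      obtain ⟨t, s', hex, ht, hs', -⟩ := Stmt.comp_simulates hn (κ := κ) (Q := consts) rfl
        (by omega) body K s τ le_rfl hs hτ.same.reg0 hb hK hB body_ok
        fun c hc => (hτ.regs c hc).trans_le (hκ c hc)
      have hb' : (body.run τ).Below (σ.reg 0 ^ 8) := by
        exact Stmt.run_below hn (Q := consts) rfl body τ body_ok hτ.same.reg0 hb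
      have hfit : (Expr.reg 8).Fits B s := by
        change s.reg 8 < B
        rw [show s.reg 8 = τ.reg 8 from hs.reg 8 hK8]
        exact (hb.1 8).trans_le hMB
      have hne : (Expr.reg 8).eval s ≠ 0 := by
        change s.reg 8 ≠ 0
        rwa [show s.reg 8 = τ.reg 8 from hs.reg 8 hK8]
      have hall : ∀ a, binary a (σ.reg 6) < binary (τ.arr 4) (σ.reg 6) + 1 →
          Processed σ a ((body.run τ).reg 1) := by
        intro a ha
        rcases Nat.lt_succ_iff_lt_or_eq.1 ha with h | h
        · exact (hproc a h).mono hle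
        · exact hnew a h
      rcases hinc with ⟨k8, hbin⟩ | ⟨k8, hbin⟩
      · obtain ⟨t', s'', τ', hex', ht', hr⟩ := ih s' _ hs' hR hb' k8 (by omega) (by rwa [hbin])
        refine ⟨_, s'', τ', Exec.loop_true _ _ _ _ _ _ _ hfit hne hex hex', ?_, hr⟩
        simp only [Expr.cost]
        nlinarith
      · have hfit' : (Expr.reg 8).Fits B s' := by
          change s'.reg 8 < B
          rw [show s'.reg 8 = (body.run τ).reg 8 from hs'.reg 8 hK8]
          exact (hb'.1 8).trans_le hMB
        have hz : (Expr.reg 8).eval s' = 0 := (hs'.reg 8 hK8).trans k8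
        refine ⟨_, s', _, Exec.loop_true _ _ _ _ _ _ _ hfit hne hex
          (Exec.loop_false _ _ _ hfit' hz), ?_, hs', hR, fun a => hall a ?_⟩
        · simp only [Expr.cost]
          nlinarith
        · rw [hbin]; exact binary_lt _ _

end Program

end RAM

/-! ### The running time -/

namespace RAM

namespace Program

open Tm Stmt

/-- The most demanding register is `5`, with `9 n ^ 2 + 1`; the factor `20` is generous. Powers of
`r + 1` in place of `r` keep the bounds positive for `r = 0`. -/
theorem Initial.le_deg {σ τ : State} (h : Initial σ τ) (c : ℕ) (hc : Program.consts c = true) :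
    τ.reg c ≤ 20 * (σ.reg 0 ^ degN c * (τ.reg 2 + 1) ^ degR c) := by
  have hn := h.consts.two_le
  have h0 := h.reg0
  have hlt : c < 8 ∧ c ≠ 1 := by simpa [Program.consts] using hc
  obtain ⟨h8, h1⟩ := hlt
  have c3 := h.consts.r3
  have c4 := h.consts.r4
  have c5 := h.consts.r5
  have c6 := h.consts.r6
  have c7 := h.consts.r7
  rw [c4] at c5
  rw [h0] at c4 c5 c7 hn
  interval_cases c
  · simp [degN, degR, h0]; omega
  · exact absurd rfl h1
  · simp [degN, degR]; omega
  · simp [degN, degR]; omega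
  · simp [degN, degR]; omega
  · simp only [degN, degR]; rw [c5]; nlinarith
  · simp only [degN, degR]; rw [c6]; nlinarith
  · simp [degN, degR]; omega

/-- A factor polynomial in `r` disappears in the exponential: `(r + 1) ^ e ≤ 2 ^ (r e) ≤ 2 ^ (e r ^
2)`. So the exponent `e` need not be known. -/
theorem steps_le {n r e t T C₀ C₁ : ℕ} (hn : 2 ≤ n)
    (ht : t ≤ C₀ * n + (2 ^ (6 * (r * r)) * (T + 2) + 2))
    (hT : T ≤ C₁ * (n ^ 6 * (r + 1) ^ e)) :
    t ≤ (C₀ + C₁ + 4) * 2 ^ ((6 + e) * r ^ 2) * n ^ 6 := by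
  have h1 : (r + 1) ^ e ≤ 2 ^ (e * r ^ 2) := by
    calc (r + 1) ^ e ≤ (2 ^ r) ^ e := Nat.pow_le_pow_left Nat.lt_two_pow_self e
      _ = 2 ^ (r * e) := (pow_mul _ _ _).symm
      _ ≤ 2 ^ (e * r ^ 2) := Nat.pow_le_pow_right (by norm_num) (by
          rw [mul_comm]; exact Nat.mul_le_mul_left _ (Nat.le_self_pow (by norm_num) r))
  have h2 : 2 ^ ((6 + e) * r ^ 2) = 2 ^ (6 * (r * r)) * 2 ^ (e * r ^ 2) := by
    rw [← pow_add]; ring_nf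
  set X := 2 ^ (6 * (r * r)) with hX
  set Y := 2 ^ (e * r ^ 2) with hY
  have hX1 : 1 ≤ X := Nat.one_le_two_pow
  have hY1 : 1 ≤ Y := Nat.one_le_two_pow
  have hn6 : n ≤ n ^ 6 := Nat.le_self_pow (by norm_num) n
  set N := n ^ 6 with hN
  have hN1 : 1 ≤ N := by omega
  have hXY : 1 ≤ X * Y := Nat.mul_pos hX1 hY1
  rw [h2]
  have e1 : C₀ * n ≤ C₀ * (X * Y) * N := by
    calc C₀ * n ≤ C₀ * 1 * N := by rw [mul_one]; exact Nat.mul_le_mul_left _ hn6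
      _ ≤ _ := Nat.mul_le_mul_right _ (Nat.mul_le_mul_left _ hXY)
  have e2 : X * T ≤ C₁ * (X * Y) * N := by
    calc X * T ≤ X * (C₁ * (N * Y)) :=
          Nat.mul_le_mul_left _ (hT.trans (Nat.mul_le_mul_left _ (Nat.mul_le_mul_left _ h1)))
      _ = _ := by ring
  have e3 : X ≤ (X * Y) * N := by
    calc X = X * 1 * 1 := by ring
      _ ≤ _ := Nat.mul_le_mul (Nat.mul_le_mul_left _ hY1) hN1
  have e4 : 1 ≤ X * Y * N := Nat.mul_pos hXY hN1
  calc t ≤ C₀ * n + (X * (T + 2) + 2) := ht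
    _ = C₀ * n + X * T + 2 * X + 2 * 1 := by ring
    _ ≤ C₀ * (X * Y) * N + C₁ * (X * Y) * N + 2 * (X * Y * N) + 2 * (X * Y * N) := by
        gcongr
    _ = _ := by ring

theorem exec_main : ∃ (P : Prog) (c : ℕ), ∀ σ : State, 2 ≤ σ.reg 0 → (∀ x, x ≠ 0 → σ.reg x = 0) →
    (∀ i, σ.arr 4 i = 0) → σ.Below (σ.reg 0 ^ 8) →
    ∃ t s τ, Exec (σ.reg 0 ^ c) P σ t s ∧
      t ≤ c * 2 ^ (c * (init.run σ).reg 2 ^ 2) * σ.reg 0 ^ 6 ∧ s.reg 1 = τ.reg 1 ∧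
      s.arr = τ.arr ∧ Reached (init.run σ) τ ∧ ∀ a, Processed (init.run σ) a (τ.reg 1) := by
  obtain ⟨C₀, hC₀⟩ := init.time_polyBound (k := 20) (Q := (· == 0)) (a := degN) (b := degR) init_ok
  obtain ⟨C₁, hC₁⟩ := body.time_polyBound (k := 20) (Q := consts) (a := degN) (b := degR) body_ok
  set K := max init.names (max body.names 9) with hK
  have hKi : init.names ≤ K := le_max_left _ _
  have hKb : body.names ≤ K := (le_max_left _ _).trans (le_max_right _ _)
  have hK9 : 9 ≤ K := (le_max_right _ _).trans (le_max_right _ _)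
  set e := body.deg degR with he
  -- The constant must dominate the leading factor, the factor in the exponent of `2`, and the
  -- exponent of the word bound; the last summand is for `(n ^ 8) ^ size`.
  set c := (C₀ + C₁ + 4) + (6 + e) + 8 * (init.size + body.size) with hc
  refine ⟨main K, c, fun σ hn hreg h4 hb => ?_⟩
  have hI := init_spec hn (hreg 2 (by norm_num))
  set σ₁ := init.run σ with hσ₁
  have hpow : ∀ k, 8 * k ≤ c → (σ.reg 0 ^ 8) ^ k ≤ σ.reg 0 ^ c := fun k hk => by
    rw [← pow_mul]
    exact Nat.pow_le_pow_right (by omega) hk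
  have hrep : Repr K id K σ σ := ⟨fun x hx => hx, fun x _ => rfl, rfl⟩
  obtain ⟨t₁, s₁, hex₁, ht₁, hs₁, -⟩ := Stmt.comp_simulates hn (κ := σ.reg) (Q := (· == 0)) rfl
    (by omega) init K σ σ le_rfl hrep rfl hb hKi (hpow _ (by omega)) init_ok fun c _ => le_rfl
  have hb₁ : σ₁.Below (σ.reg 0 ^ 8) := Stmt.run_below hn (Q := (· == 0)) rfl init σ init_ok rfl hb
  have hbin : binary (σ₁.arr 4) (σ₁.reg 6) = 0 := by
    have : ∀ m, binary (σ₁.arr 4) m = 0 := fun m => by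
      induction m with
      | zero => rfl
      | succ m ih => rw [binary, ih, hI.arr4, h4, if_neg (by simp)]
    exact this _
  have hR : Reached σ₁ σ₁ := ⟨hI.consts, Or.inl (by rw [hI.reg1, hreg 1 one_ne_zero]),
    ⟨rfl, rfl, rfl, rfl, rfl⟩, fun _ _ => rfl⟩
  have e0 : σ₁.reg 0 = σ.reg 0 := hI.reg0
  obtain ⟨t₂, s₂, τ, hex₂, ht₂, hs₂, hRτ, hall⟩ := exec_loop (B := σ.reg 0 ^ c) (κ := σ₁.reg)
    (T := body.time σ₁.reg) (σ := σ₁) hKb hK9 (by rwa [e0]) (by rw [e0]; exact hpow _ (by omega))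
    le_rfl (fun _ _ => le_rfl) (2 ^ σ₁.reg 6) s₁ σ₁ hs₁ hR (by rwa [e0])
    (by rw [hI.reg8]; exact one_ne_zero) (by rw [hbin, zero_add])
    (fun a ha => by rw [hbin] at ha; exact absurd ha (Nat.not_lt_zero _))
  refine ⟨_, s₂, τ, Exec.seq _ _ _ _ _ _ _ hex₁ hex₂, ?_, hs₂.reg 1 (by omega), hs₂.arr, hRτ, hall⟩
  have hT := hC₁ (σ.reg 0) (σ₁.reg 2 + 1) σ₁.reg (by omega) (by omega) fun c hc => hI.le_deg c hc
  have ht₀ := hC₀ (σ.reg 0) 1 σ.reg (by omega) (by omega) fun c hc => by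
    have : c = 0 := by simpa using hc
    subst this
    simp only [degN, degR, pow_zero, pow_one, mul_one]
    omega
  rw [body_degN] at hT
  rw [init_degN, one_pow, mul_one, pow_one] at ht₀
  rw [hI.consts.r6] at ht₂
  have := steps_le (r := σ₁.reg 2) (e := e) hn
    (Nat.add_le_add (ht₁.trans ht₀) ht₂) hT
  refine this.trans (Nat.mul_le_mul_right _ (Nat.mul_le_mul (by omega)
    (Nat.pow_le_pow_right (by norm_num) (Nat.mul_le_mul_right _ (by omega)))))

end Program

end RAM

/-! ### A guess that describes a colouring -/

namespace Guess

variable {g : Guess} {col : ℕ → ℕ} {ℓ : ℕ}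

/-- A vertex of B coloured after `a` would need a neighbour in the class of `a`, which is `a` alone,
in the other clique. -/
theorem lt_single (hc : g.IsTwoCluster) (hg : g.IsGrundy col ℓ) {a b : ℕ} (ha : g.Single col a)
    (hb : g.InB b) : col b < col a := by
  by_contra hlt
  obtain ⟨u, hu, huc, hbu⟩ := hg.nbr b hb.1 (col a)
    (lt_of_le_of_ne (not_lt.1 hlt) (ha.2.2 b hb).symm)
  rcases cases u hu with h | h | h
  · exact ha.2.1 (huc ▸ RCol_of_InR hc hu h)
  · exact hc.cross u b h hb (hc.symm _ hb.1 _ hu hbu)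
  · exact ha.2.2 u h huc

variable (g col) in
/-- The clique `InA` meets every class without modulator vertices that meets `InB`. -/
def Oriented : Prop :=
  ∀ b, g.InB b → ¬ g.RCol col (col b) → ∃ a, g.InA a ∧ col a = col b

open Classical in
variable (g col) in
/-- The guess that describes a colouring, with the threshold `t`. -/
noncomputable def describe (t : ℕ) : Guess where
  n := g.n
  r := g.r
  Aj := g.Aj
  InR := g.InR
  ρ := g.ρ
  W k j := g.lev col (col (g.ρ j)) = k
  TA k j := ∃ a, g.InA a ∧ g.RCol col (col a) ∧ g.lev col (col a) = k ∧ g.Aj (g.ρ j) a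
  TB k j := ∃ a, g.InB a ∧ g.RCol col (col a) ∧ g.lev col (col a) = k ∧ g.Aj (g.ρ j) a
  α k := ∃ a, g.InA a ∧ g.RCol col (col a) ∧ g.lev col (col a) = k
  β k := ∃ a, g.InB a ∧ g.RCol col (col a) ∧ g.lev col (col a) = k
  v₀ := g.v₀
  d := Nat.count (g.Single col) g.n
  th := t

/-- The threshold is the least level of a single vertex. As B is coloured before that vertex, pairs
have at most this level and the modulator classes that meet B have a smaller one. Without single
vertices the threshold `r` excludes nothing. -/
theorem exists_describes (hc : g.IsTwoCluster) (hg : g.IsGrundy col ℓ) (ho : g.Oriented col) :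
    ∃ t ≤ g.r, (g.describe col t).Describes col := by
  classical
  by_cases hS : ∃ k a, g.Single col a ∧ g.lev col (col a) = k
  · obtain ⟨a, ha, hak⟩ := Nat.find_spec hS
    refine ⟨Nat.find hS, hak ▸ lev_le _, fun _ _ _ _ => Iff.rfl, fun _ _ => Iff.rfl,
      fun _ _ => Iff.rfl, fun _ _ _ _ => Iff.rfl, fun _ _ _ _ => Iff.rfl, rfl,
      fun b hb => Nat.find_min' hS ⟨b, hb, rfl⟩, fun b hb _ => ?_, fun _ b _ hb hR => ?_, ho⟩
    · change g.lev col (col b) ≤ Nat.find hS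
      rw [← hak]
      exact lev_mono (lt_single hc hg ha hb).le
    · change g.lev col (col b) < Nat.find hS
      rw [← hak]
      exact lev_strict hR (lt_single hc hg ha hb)
  · exact ⟨g.r, le_rfl, fun _ _ _ _ => Iff.rfl, fun _ _ => Iff.rfl,
      fun _ _ => Iff.rfl, fun _ _ _ _ => Iff.rfl, fun _ _ _ _ => Iff.rfl, rfl,
      fun b hb => absurd ⟨_, b, hb, rfl⟩ hS, fun b _ _ => lev_le _,
      fun a _ ha _ _ => absurd ⟨_, a, ha, rfl⟩ hS, ho⟩

/-- One of the two cliques is a proper choice for `InA`. -/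
theorem exists_oriented {v : ℕ} (hv : v < g.n) (hvR : ¬ g.InR v)
    (hc : ∀ v < g.n, ¬ g.InR v → ({ g with v₀ := v } : Guess).IsTwoCluster)
    (hg : g.IsGrundy col ℓ) :
    ∃ v < g.n, ¬ g.InR v ∧ ({ g with v₀ := v } : Guess).Oriented col := by
  by_cases ho : ({ g with v₀ := v } : Guess).Oriented col
  · exact ⟨v, hv, hvR, ho⟩
  have hcv := hc v hv hvR
  set g₁ : Guess := { g with v₀ := v } with hg₁
  unfold Oriented at ho
  push Not at ho
  obtain ⟨b, hb, hbR, hba⟩ := ho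
  -- A class that meets B but neither A nor `R` shows that the roles of the cliques must be
  -- exchanged, with `b` as the new base vertex.
  refine ⟨b, hb.1, hb.2.1, fun a ha haR => ?_⟩
  set g₂ : Guess := { g with v₀ := b } with hg₂
  have hB : ∀ x, g₁.InB x → g₂.InA x := fun x hx => by
    refine ⟨hx.1, hx.2.1, ?_⟩
    by_cases h : x = b
    · exact Or.inl h
    · exact Or.inr (hcv.clique_B b x hb hx (Ne.symm h))
  have hA : g₁.InA a := by
    rcases cases (g := g₁) a ha.1 with h | h | h
    · exact absurd h ha.2.1
    · exact h
    · exact absurd (hB a h).2.2 ha.2.2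
  by_contra hne
  push Not at hne
  -- If both orientations failed, the later of `a` and `b` would need a neighbour in the class of
  -- the earlier, which lies in the other clique only.
  rcases lt_trichotomy (col a) (col b) with h | h | h
  · obtain ⟨u, hu, huc, hbu⟩ := hg.nbr b hb.1 (col a) h
    rcases cases (g := g₁) u hu with hR | hA' | hB'
    · exact haR (huc ▸ RCol_of_InR hcv hu hR)
    · exact hcv.cross u b hA' hb (hcv.symm b hb.1 u hu hbu)
    · exact hne u (hB u hB') huc
  · exact hba a hA h
  · obtain ⟨u, hu, huc, hau⟩ := hg.nbr a ha.1 (col b) h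
    rcases cases (g := g₁) u hu with hR | hA' | hB'
    · exact hbR (huc ▸ RCol_of_InR hcv hu hR)
    · exact hba u hA' huc
    · exact hcv.cross a u hA hB' hau

end Guess

/-! ### Encoding a guess by bits -/

namespace RAM

open Classical in
/-- The encoding of a guess by bits. -/
noncomputable def encode (g : Guess) (i : ℕ) : ℕ :=
  if (i / g.r % 6 = 0 ∧ g.W (i / g.r / 6) (i % g.r)) ∨
    (i / g.r % 6 = 1 ∧ g.TA (i / g.r / 6) (i % g.r)) ∨
    (i / g.r % 6 = 2 ∧ g.TB (i / g.r / 6) (i % g.r)) ∨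
    (i / g.r % 6 = 3 ∧ g.α (i / g.r / 6)) ∨ (i / g.r % 6 = 4 ∧ g.β (i / g.r / 6)) then 1 else 0

theorem encode_ne_zero {g : Guess} {k q j : ℕ} (hq : q < 6) (hj : j < g.r) :
    encode g ((k * 6 + q) * g.r + j) ≠ 0 ↔ (q = 0 ∧ g.W k j) ∨ (q = 1 ∧ g.TA k j) ∨
      (q = 2 ∧ g.TB k j) ∨ (q = 3 ∧ g.α k) ∨ (q = 4 ∧ g.β k) := by
  have h1 : ((k * 6 + q) * g.r + j) / g.r = k * 6 + q := by
    rw [Nat.add_comm, Nat.add_mul_div_right _ _ (by omega), Nat.div_eq_of_lt hj, Nat.zero_add]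
  have h2 : ((k * 6 + q) * g.r + j) % g.r = j := by
    rw [Nat.add_comm, Nat.add_mul_mod_self_right, Nat.mod_eq_of_lt hj]
  have h3 : (k * 6 + q) % 6 = q := by omega
  have h4 : (k * 6 + q) / 6 = k := by omega
  rw [encode, h1, h2, h3, h4]
  exact ⟨fun h => by_contra fun h' => h (if_neg h'), fun h => by rw [if_pos h]; exact one_ne_zero⟩

/-- A description restricts a guess only at indices below `r`, and all the bits for these lie among
the first `6 r ^ 2`. So agreement there suffices, even if the guesses differ elsewhere. -/
theorem describes_of_encode {g : Guess} {τ : State} {col : ℕ → ℕ} (hd : g.Describes col)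
    (hn : τ.reg 0 = g.n) (hr : τ.reg 2 = g.r) (hAj : (guessOf τ).Aj = g.Aj)
    (hInR : (guessOf τ).InR = g.InR) (hρ : (guessOf τ).ρ = g.ρ)
    (h4 : ∀ i < 6 * (g.r * g.r), τ.arr 4 i ≠ 0 ↔ encode g i ≠ 0) :
    ({ guessOf τ with v₀ := g.v₀, d := g.d, th := g.th } : Guess).Describes col := by
  have key : ∀ q < 6, ∀ k < g.r, ∀ j < g.r,
      τ.arr 4 ((k * 6 + q) * τ.reg 2 + j) ≠ 0 ↔ (q = 0 ∧ g.W k j) ∨ (q = 1 ∧ g.TA k j) ∨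
        (q = 2 ∧ g.TB k j) ∨ (q = 3 ∧ g.α k) ∨ (q = 4 ∧ g.β k) := by
    intro q hq k hk j hj
    rw [hr, ← encode_ne_zero hq hj]
    refine h4 _ ?_
    calc (k * 6 + q) * g.r + j < (k * 6 + q) * g.r + g.r := by omega
      _ = (k * 6 + q + 1) * g.r := by ring
      _ ≤ (6 * g.r) * g.r := Nat.mul_le_mul_right _ (by omega)
      _ = _ := by ring
  have hW : ∀ k < g.r, ∀ j < g.r, (guessOf τ).W k j ↔ g.W k j := fun k hk j hj =>
    (key 0 (by norm_num) k hk j hj).trans (by simp)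
  have hTA : ∀ k < g.r, ∀ j < g.r, (guessOf τ).TA k j ↔ g.TA k j := fun k hk j hj =>
    (key 1 (by norm_num) k hk j hj).trans (by simp)
  have hTB : ∀ k < g.r, ∀ j < g.r, (guessOf τ).TB k j ↔ g.TB k j := fun k hk j hj =>
    (key 2 (by norm_num) k hk j hj).trans (by simp)
  have hα : ∀ k < g.r, (guessOf τ).α k ↔ g.α k := fun k hk =>
    (key 3 (by norm_num) k hk 0 (by omega)).trans (by simp)
  have hβ : ∀ k < g.r, (guessOf τ).β k ↔ g.β k := fun k hk =>
    (key 4 (by norm_num) k hk 0 (by omega)).trans (by simp)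
  have hn' : (guessOf τ).n = g.n := hn
  have hr' : (guessOf τ).r = g.r := hr
  generalize guessOf τ = g' at *
  obtain ⟨n, r, Aj, InR, ρ, W, TA, TB, α, β, v₀, d, th⟩ := g
  obtain ⟨n', r', Aj', InR', ρ', W', TA', TB', α', β', v₀', d', th'⟩ := g'
  simp only at hn' hr' hAj hInR hρ hW hTA hTB hα hβ ⊢
  subst hn' hr' hAj hInR hρ
  exact ⟨fun k hk j hj => (hW k hk j hj).trans (hd.W_iff k hk j hj),
    fun k hk => (hα k hk).trans (hd.α_iff k hk), fun k hk => (hβ k hk).trans (hd.β_iff k hk),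
    fun k hk j hj => (hTA k hk j hj).trans (hd.TA_iff k hk j hj),
    fun k hk j hj => (hTB k hk j hj).trans (hd.TB_iff k hk j hj),
    hd.d_eq, hd.th_single, hd.th_pair, hd.th_slot, hd.oriented⟩

end RAM

/-! ### Graphs and guesses -/

/-- A proper colouring with the least sum of colours is Grundy, since a vertex without a neighbour
in an earlier class could move there. It serves to show that the final record is not `0`. -/
theorem SimpleGraph.exists_isGrundyColoring {n : ℕ} (hn : 0 < n) (G : SimpleGraph (Fin n)) :
    ∃ ℓ, 0 < ℓ ∧ ∃ C : Fin ℓ → Set (Fin n), G.IsGrundyColoring C := by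
  classical
  have hex : ∃ s, ∃ f : Fin n → ℕ, (∀ u v, G.Adj u v → f u ≠ f v) ∧ ∑ v, f v = s :=
    ⟨_, fun v => v, fun u v h h' => G.ne_of_adj h (Fin.ext h'), rfl⟩
  obtain ⟨f, hf, hs⟩ := Nat.find_spec hex
  have hnbr : ∀ v, ∀ t < f v, ∃ u, f u = t ∧ G.Adj v u := by
    intro v t ht
    by_contra hcon
    push Not at hcon
    refine Nat.find_min hex (m := ∑ w, Function.update f v t w) ?_
      ⟨Function.update f v t, fun u w huw => ?_, rfl⟩
    · rw [← hs]
      refine Finset.sum_lt_sum (fun w _ => ?_) ⟨v, Finset.mem_univ v, by simpa using ht⟩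
      rw [Function.update_apply]
      split_ifs with h
      · exact h ▸ ht.le
      · exact le_rfl
    · rw [Function.update_apply, Function.update_apply]
      split_ifs with h1 h2 h2
      · exact absurd (h1.trans h2.symm) (G.ne_of_adj huw)
      · exact fun h => hcon w h.symm (h1 ▸ huw)
      · exact fun h => hcon u h (h2 ▸ huw.symm)
      · exact hf u w huw
  have : Nonempty (Fin n) := ⟨⟨0, hn⟩⟩
  obtain ⟨w, hw⟩ := Finite.exists_max f
  refine ⟨f w + 1, Nat.succ_pos _, fun i => {v | f v = i}, ⟨fun i => ?_, fun i j hij => ?_,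
    fun v => ?_, fun i u hu v hv _ huv => ?_, fun i v hv j hj => ?_⟩⟩
  · rcases Nat.lt_succ_iff_lt_or_eq.1 i.2 with h | h
    · obtain ⟨u, hu, -⟩ := hnbr w i h
      exact ⟨u, hu⟩
    · exact ⟨w, h.symm⟩
  · refine Set.disjoint_left.2 fun v hv hv' => hij (Fin.ext ?_)
    exact (show f v = i from hv).symm.trans hv'
  · exact ⟨⟨f v, Nat.lt_succ_of_le (hw v)⟩, rfl⟩
  · exact hf u v huv ((show f u = i from hu).trans (show f v = i from hv).symm)
  · obtain ⟨u, hu, hvu⟩ := hnbr v j ((show f v = i from hv) ▸ hj)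
    exact ⟨u, hu, hvu⟩

/-- The guess is about the graph `G` and the modulator `R`. -/
structure Guess.IsAbout {n : ℕ} (g : Guess) (G : SimpleGraph (Fin n)) (R : Finset (Fin n)) :
    Prop where
  n_eq : g.n = n
  adj_iff : ∀ u v : Fin n, g.Aj u v ↔ G.Adj u v
  mem_iff : ∀ v : Fin n, g.InR v ↔ v ∈ R
  ρ_mem : ∀ j < g.r, g.ρ j < g.n ∧ g.InR (g.ρ j)
  ρ_surj : ∀ v < g.n, g.InR v → ∃ j < g.r, g.ρ j = v
  r_le : g.r ≤ g.n

namespace SimpleGraph.IsKClusterModulator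

variable {n : ℕ} {G : SimpleGraph (Fin n)} {R : Finset (Fin n)}

/-- Words below a power of `n` are useful only for `n ≥ 2`; the two components supply two vertices.
-/
theorem two_le (h : G.IsKClusterModulator 2 (R : Set (Fin n))) : 2 ≤ n := by
  obtain ⟨K, K', hK, -⟩ := Nat.card_eq_two_iff.1 h.2.2
  obtain ⟨v, rfl⟩ := K.exists_rep
  obtain ⟨w, rfl⟩ := K'.exists_rep
  have hvw : v.1 ≠ w.1 := fun h => hK (by rw [Subtype.ext h])
  have := v.1.2
  have := w.1.2
  have : v.1.1 ≠ w.1.1 := fun h => hvw (Fin.ext h)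
  omega

theorem exists_notMem (h : G.IsKClusterModulator 2 (R : Set (Fin n))) : ∃ v, v ∉ R := by
  obtain ⟨K, -, -, -⟩ := Nat.card_eq_two_iff.1 h.2.2
  obtain ⟨v, rfl⟩ := K.exists_rep
  exact ⟨v.1, v.2⟩

theorem isTwoCluster (h : G.IsKClusterModulator 2 (R : Set (Fin n))) {g : Guess}
    (hg : g.IsAbout G R) {v : ℕ} (hv : v < g.n) (hvR : ¬ g.InR v) :
    ({ g with v₀ := v } : Guess).IsTwoCluster := by
  obtain ⟨gn, r, Aj, InR, ρ, W, TA, TB, α, β, v₀, d, th⟩ := g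
  obtain ⟨hn, hadj, hmem, hρ, hρ', hr⟩ := hg
  simp only at hn hadj hmem hρ hρ' hr hv hvR ⊢
  subst hn
  have hv' : (⟨v, hv⟩ : Fin gn) ∈ (R : Set (Fin gn))ᶜ := fun h' => hvR ((hmem ⟨v, hv⟩).2 h')
  set H := G.induce (R : Set (Fin gn))ᶜ with hH
  set K := H.connectedComponentMk ⟨⟨v, hv⟩, hv'⟩ with hK
  have hmemc : ∀ {x : Fin gn}, ¬ InR x → x ∈ (R : Set (Fin gn))ᶜ :=
    fun {x} hx h' => hx ((hmem x).2 h')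
  have hclique : ∀ {x y : Fin gn} (hx : x ∈ (R : Set (Fin gn))ᶜ) (hy : y ∈ (R : Set (Fin gn))ᶜ),
      H.connectedComponentMk ⟨x, hx⟩ = H.connectedComponentMk ⟨y, hy⟩ → x ≠ y → G.Adj x y := by
    intro x y hx hy heq hne
    exact h.1 (H.connectedComponentMk ⟨y, hy⟩) (x := ⟨x, hx⟩) heq (y := ⟨y, hy⟩) rfl
      (fun h' => hne (congrArg Subtype.val h'))
  have hcomp : ∀ {x y : Fin gn} (hx : x ∈ (R : Set (Fin gn))ᶜ) (hy : y ∈ (R : Set (Fin gn))ᶜ),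
      G.Adj x y → H.connectedComponentMk ⟨x, hx⟩ = H.connectedComponentMk ⟨y, hy⟩ := by
    intro x y hx hy hxy
    exact ConnectedComponent.connectedComponentMk_eq_of_adj (G := H)
      (v := ⟨x, hx⟩) (w := ⟨y, hy⟩) hxy
  have hiff : ∀ (x : ℕ) (hx : x < gn) (hxR : ¬ InR x), (x = v ∨ Aj v x) ↔
      H.connectedComponentMk ⟨⟨x, hx⟩, hmemc hxR⟩ = K := by
    intro x hx hxR
    constructor
    · rintro (rfl | h')
      · rfl
      · exact (hcomp hv' (hmemc hxR) ((hadj ⟨v, hv⟩ ⟨x, hx⟩).1 h')).symm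
    · intro h'
      by_cases hxv : x = v
      · exact Or.inl hxv
      · exact Or.inr ((hadj ⟨v, hv⟩ ⟨x, hx⟩).2 (hclique hv' (hmemc hxR) h'.symm
          fun h'' => hxv (congrArg Fin.val h'').symm))
  -- As there are exactly two components, all vertices outside `R` and outside the component of `v`
  -- lie in one component, hence form a clique.
  obtain ⟨K', -, hK'⟩ := (Nat.card_eq_two_iff' K).1 h.2.2
  refine ⟨fun u hu w hw => ?_, fun w hw => ?_, ?_, ?_, ?_, hρ, hρ', hr⟩
  · intro h'
    exact (hadj ⟨w, hw⟩ ⟨u, hu⟩).2 ((hadj ⟨u, hu⟩ ⟨w, hw⟩).1 h').symm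
  · intro h'
    exact G.irrefl ((hadj ⟨w, hw⟩ ⟨w, hw⟩).1 h')
  · rintro u w ⟨hu, huR, huA⟩ ⟨hw, hwR, hwA⟩ hne
    exact (hadj ⟨u, hu⟩ ⟨w, hw⟩).2 (hclique (hmemc huR) (hmemc hwR)
      (((hiff u hu huR).1 huA).trans ((hiff w hw hwR).1 hwA).symm)
      fun h'' => hne (congrArg Fin.val h''))
  · rintro u w ⟨hu, huR, huA⟩ ⟨hw, hwR, hwA⟩ hne
    exact (hadj ⟨u, hu⟩ ⟨w, hw⟩).2 (hclique (hmemc huR) (hmemc hwR)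
      ((hK' _ fun h' => huA ((hiff u hu huR).2 h')).trans
        (hK' _ fun h' => hwA ((hiff w hw hwR).2 h')).symm)
      fun h'' => hne (congrArg Fin.val h''))
  · rintro u w ⟨hu, huR, huA⟩ ⟨hw, hwR, hwA⟩ hadj'
    refine hwA ((hiff w hw hwR).2 ?_)
    rw [← (hiff u hu huR).1 huA]
    exact (hcomp (hmemc huR) (hmemc hwR) ((hadj ⟨u, hu⟩ ⟨w, hw⟩).1 hadj')).symm

end SimpleGraph.IsKClusterModulator

namespace Guess.IsAbout

variable {n : ℕ} {g : Guess} {G : SimpleGraph (Fin n)} {R : Finset (Fin n)}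

theorem exists_isGrundy (hg : g.IsAbout G R) {m : ℕ} {D : Fin m → Set (Fin n)}
    (hD : G.IsGrundyColoring D) : ∃ col, g.IsGrundy col m := by
  classical
  choose c hc using hD.cover
  have huniq : ∀ v i, v ∈ D i → c v = i := fun v i hi => by
    by_contra hne
    exact Set.disjoint_left.1 (hD.disjoint _ _ hne) (hc v) hi
  have hn := hg.n_eq
  refine ⟨fun v => if h : v < n then c ⟨v, h⟩ else 0, ⟨fun v hv => ?_, fun t ht => ?_,
    fun u hu v hv huv => ?_, fun v hv t ht => ?_⟩⟩
  · rw [hn] at hv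
    rw [dif_pos hv]
    exact (c _).2
  · obtain ⟨v, hv⟩ := hD.nonempty ⟨t, ht⟩
    exact ⟨v, hn ▸ v.2, by rw [dif_pos v.2]; exact congrArg Fin.val (huniq v _ hv)⟩
  · rw [hn] at hu hv
    rw [dif_pos hu, dif_pos hv]
    have h1 : G.Adj ⟨u, hu⟩ ⟨v, hv⟩ := (hg.adj_iff ⟨u, hu⟩ ⟨v, hv⟩).1 huv
    intro heq
    exact hD.independent (c ⟨u, hu⟩) (hc _) (Fin.ext heq ▸ hc _) (G.ne_of_adj h1) h1
  · rw [hn] at hv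
    rw [dif_pos hv] at ht
    obtain ⟨u, hu, hvu⟩ := hD.neighbor _ _ (hc ⟨v, hv⟩) ⟨t, ht.trans (c _).2⟩ ht
    exact ⟨u, hn ▸ u.2, by rw [dif_pos u.2]; exact congrArg Fin.val (huniq u _ hu),
      (hg.adj_iff ⟨v, hv⟩ u).2 hvu⟩

theorem isGrundyColoring (hg : g.IsAbout G R) {s : RAM.State}
    (h : IsGrundyMap g.n g.Aj (s.arr 2) (s.reg 1)) :
    G.IsGrundyColoring (RAM.outputClasses n s) := by
  rw [hg.n_eq] at h
  refine ⟨fun i => ?_, fun i j hij => ?_, fun v => ?_, fun i u hu v hv _ huv => ?_,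
    fun i v hv j hj => ?_⟩
  · obtain ⟨v, hv, hvi⟩ := h.surj (i + 1) (by omega) i.2
    exact ⟨⟨v, hv⟩, hvi⟩
  · refine Set.disjoint_left.2 fun v hv hv' => hij (Fin.ext ?_)
    have h1 : s.arr 2 v = i + 1 := hv
    have h2 : s.arr 2 v = j + 1 := hv'
    omega
  · have := h.range v v.2
    refine ⟨⟨s.arr 2 v - 1, by omega⟩, ?_⟩
    change s.arr 2 v = s.arr 2 v - 1 + 1
    omega
  · exact h.proper u u.2 v v.2 ((show s.arr 2 u = i + 1 from hu).trans
      (show s.arr 2 v = i + 1 from hv).symm) ((hg.adj_iff u v).2 huv)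
  · have h1 : s.arr 2 v = i + 1 := hv
    obtain ⟨u, hu, huj, hvu⟩ := h.nbr v v.2 (j + 1) (by omega) (by omega)
    exact ⟨⟨u, hu⟩, huj, (hg.adj_iff v ⟨u, hu⟩).1 hvu⟩

end Guess.IsAbout

/-! ### Every Grundy colouring is covered by some guess -/

namespace Guess

theorem IsTwoCluster.congr {g g' : Guess} (h : g.IsTwoCluster) (hn : g'.n = g.n) (hr : g'.r = g.r)
    (hAj : g'.Aj = g.Aj) (hInR : g'.InR = g.InR) (hρ : g'.ρ = g.ρ) (hv : g'.v₀ = g.v₀) :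
    g'.IsTwoCluster := by
  obtain ⟨n, r, Aj, InR, ρ, W, TA, TB, α, β, v₀, d, th⟩ := g
  obtain ⟨n', r', Aj', InR', ρ', W', TA', TB', α', β', v₀', d', th'⟩ := g'
  simp only at hn hr hAj hInR hρ hv
  subst hn hr hAj hInR hρ hv
  exact ⟨h.symm, h.irrefl, h.clique_A, h.clique_B, h.cross, h.ρ_mem, h.ρ_surj, h.r_le⟩

theorem IsGrundy.congr {g g' : Guess} {col : ℕ → ℕ} {ℓ : ℕ} (h : g.IsGrundy col ℓ)
    (hn : g'.n = g.n) (hAj : g'.Aj = g.Aj) : g'.IsGrundy col ℓ := by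
  refine ⟨?_, ?_, ?_, ?_⟩ <;> rw [hn]
  · exact h.lt
  · exact h.surj
  · rw [hAj]; exact h.proper
  · rw [hAj]; exact h.nbr

end Guess

namespace RAM

theorem SameGraph.guess {σ τ : State} (h : SameGraph σ τ) :
    (guessOf τ).n = (guessOf σ).n ∧ (guessOf τ).r = (guessOf σ).r ∧
      (guessOf τ).Aj = (guessOf σ).Aj ∧ (guessOf τ).InR = (guessOf σ).InR ∧
      (guessOf τ).ρ = (guessOf σ).ρ := by
  simp only [guessOf, h.reg0, h.reg2, h.arr0, h.arr1, h.arr3, and_self]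

theorem SameGraph.isAbout {n : ℕ} {G : SimpleGraph (Fin n)} {R : Finset (Fin n)} {σ τ : State}
    (h : SameGraph σ τ) (hσ : (guessOf σ).IsAbout G R) : (guessOf τ).IsAbout G R := by
  obtain ⟨e1, e2, e3, e4, e5⟩ := h.guess
  refine ⟨?_, ?_, ?_, ?_, ?_, ?_⟩ <;> simp only [e1, e2, e3, e4, e5]
  exacts [hσ.n_eq, hσ.adj_iff, hσ.mem_iff, hσ.ρ_mem, hσ.ρ_surj, hσ.r_le]

namespace Program

open Tm Stmt

/-- After all guesses have been processed no larger Grundy colouring is left. -/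
theorem le_of_processed {n m k : ℕ} {G : SimpleGraph (Fin n)} {R : Finset (Fin n)}
    (hR : G.IsKClusterModulator 2 (R : Set (Fin n))) {σ : State} (hσ : Consts σ)
    (hg : (guessOf σ).IsAbout G R) (hp : ∀ a, Processed σ a m) {D : Fin k → Set (Fin n)}
    (hD : G.IsGrundyColoring D) : k ≤ m := by
  obtain ⟨col, hcol⟩ := hg.exists_isGrundy hD
  obtain ⟨v, hv⟩ := hR.exists_notMem
  have hvn : (v : ℕ) < (guessOf σ).n := by rw [hg.n_eq]; exact v.2
  obtain ⟨w, hw, hwR, ho⟩ := Guess.exists_oriented hvn (fun h => hv ((hg.mem_iff v).1 h))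
    (fun v hv hvR => hR.isTwoCluster hg hv hvR) hcol
  have hc := hR.isTwoCluster hg hw hwR
  have hcol' := hcol.congr (g' := { guessOf σ with v₀ := w }) rfl rfl
  obtain ⟨t, ht, hd⟩ := Guess.exists_describes hc hcol' ho
  set g := ({ guessOf σ with v₀ := w } : Guess).describe col t with hgdef
  -- The describing guess has been tried: all bit patterns were processed, and the base vertex, `d ≤
  -- n` and the threshold `t ≤ r` are in the ranges of the loops.
  obtain ⟨τ, hs, hbits, hb⟩ := hp (encode g)
  obtain ⟨e1, e2, e3, e4, e5⟩ := hs.guess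
  have hdn : g.d ≤ σ.reg 0 := by
    classical
    exact Nat.count_le _
  refine hb w hw g.d (by rw [hσ.r7]; omega) t (by rw [hσ.r3]; exact Nat.lt_succ_of_le ht) col k
    (hc.congr e1 e2 e3 e4 e5 rfl) (hcol.congr e1 e3) ?_
  refine describes_of_encode hd e1 e2 e3 e4 e5 fun i hi => hbits i ?_
  rw [hσ.r6]
  exact hi

section Input

variable {n : ℕ} {G : SimpleGraph (Fin n)} {R : Finset (Fin n)}

theorem inputState_adj (u v : Fin n) :
    (inputState G R).arr 0 (u * n + v) ≠ 0 ↔ G.Adj u v := by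
  classical
  have h : (inputState G R).arr 0 (u * n + v) =
      if ∃ u' v' : Fin n, (u : ℕ) * n + v = u' * n + v' ∧ G.Adj u' v' then 1 else 0 := by
    simp only [inputState, if_pos]
  rw [h]
  constructor
  · intro h
    split_ifs at h with h'
    · obtain ⟨u', v', heq, hadj⟩ := h'
      have hdiv : ∀ a b : Fin n, ((a : ℕ) * n + b) / n = a := fun a b => by
        rw [Nat.add_comm, Nat.add_mul_div_right _ _ (Fin.pos a), Nat.div_eq_of_lt b.2, Nat.zero_add]
      have h1 : u = u' := Fin.ext (by rw [← hdiv u v, ← hdiv u' v', heq])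
      subst h1
      have h2 : v = v' := Fin.ext (by omega)
      subst h2
      exact hadj
    · exact absurd rfl h
  · intro hadj
    rw [if_pos ⟨u, v, rfl, hadj⟩]
    exact one_ne_zero

theorem inputState_mem (k : ℕ) :
    (inputState G R).arr 1 k ≠ 0 ↔ ∃ v ∈ R, k = (v : Fin n) := by
  classical
  have h : (inputState G R).arr 1 k = if ∃ v ∈ R, k = (v : Fin n) then 1 else 0 := by
    simp [inputState]
  rw [h]
  split_ifs with h' <;> simp [h']

theorem inputState_below (hn : 2 ≤ n) : (inputState G R).Below (n ^ 8) := by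
  have h1 : n < n ^ 8 := lt_self_pow₀ (by omega) (by norm_num)
  refine ⟨fun x => ?_, fun a i => ?_⟩
  · simp only [inputState]
    split_ifs <;> omega
  · simp only [inputState]
    split_ifs <;> omega

theorem count_inputState [DecidablePred fun v => (inputState G R).arr 1 v ≠ 0] :
    Nat.count (fun v => (inputState G R).arr 1 v ≠ 0) n = R.card := by
  rw [Nat.count_eq_card_filter_range, ← Finset.card_map Fin.valEmbedding]
  congr 1
  ext k
  simp only [Finset.mem_filter, Finset.mem_range, Finset.mem_map, Fin.valEmbedding_apply,
    inputState_mem]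
  constructor
  · rintro ⟨-, v, hv, rfl⟩
    exact ⟨v, hv, rfl⟩
  · rintro ⟨v, hv, rfl⟩
    exact ⟨v.2, v, hv, rfl⟩

theorem Initial.isAbout {τ : State} (h : Initial (inputState G R) τ) :
    (guessOf τ).IsAbout G R := by
  have e0 : τ.reg 0 = n := h.reg0
  refine ⟨e0, fun u v => ?_, fun v => ?_, fun j hj => ?_, fun v hv hvR => ?_, ?_⟩
  · change τ.arr 0 (u * τ.reg 0 + v) ≠ 0 ↔ _
    rw [h.arr0, e0]
    exact inputState_adj u v
  · change τ.arr 1 v ≠ 0 ↔ _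
    rw [h.arr1, inputState_mem]
    exact ⟨fun ⟨w, hw, hvw⟩ => Fin.ext hvw ▸ hw, fun hv => ⟨v, hv, rfl⟩⟩
  · obtain ⟨h1, h2⟩ := h.mem j hj
    refine ⟨?_, ?_⟩
    · change τ.arr 3 j < τ.reg 0
      rw [e0]; exact h1
    · change τ.arr 1 (τ.arr 3 j) ≠ 0
      rw [h.arr1]; exact h2
  · refine h.surj v ?_ ?_
    · rw [← h.reg0]; exact hv
    · rw [← h.arr1]; exact hvR
  · exact h.consts.r_le

end Input

end Program

end RAM

/-- One program and one constant `c` serve all inputs; the machine works with words of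
`O(log n)` bits, that is, with numbers smaller than `n ^ c`. -/
theorem mainTheorem3 :
    ∃ (P : RAM.Prog) (c : ℕ),
      ∀ (n : ℕ) (G : SimpleGraph (Fin n)) (R : Finset (Fin n)),
        G.IsKClusterModulator 2 (R : Set (Fin n)) →
          ∃ (t : ℕ) (s : RAM.State),
            RAM.Exec (n ^ c) P (RAM.inputState G R) t s ∧
            t ≤ c * 2 ^ (c * R.card ^ 2) * n ^ 6 ∧
            G.IsMaximumGrundyColoring (RAM.outputClasses n s) := by
  obtain ⟨P, c, hP⟩ := RAM.Program.exec_main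
  refine ⟨P, c, fun n G R hR => ?_⟩
  have hn := hR.two_le
  obtain ⟨t, s, τ, hex, ht, hs1, hsa, hτ, hp⟩ := hP (RAM.inputState G R) hn
    (fun x hx => if_neg hx) (fun i => rfl) (RAM.Program.inputState_below hn)
  have hI := RAM.Program.init_spec (σ := RAM.inputState G R) hn rfl
  have hr : (RAM.Program.init.run (RAM.inputState G R)).reg 2 = R.card := by
    classical
    exact hI.reg2.trans RAM.Program.count_inputState
  rw [hr] at ht
  have hmax : ∀ (m : ℕ) (D : Fin m → Set (Fin n)), G.IsGrundyColoring D → m ≤ s.reg 1 :=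
    fun m D hD => by
      rw [hs1]
      exact RAM.Program.le_of_processed hR hI.consts hI.isAbout hp hD
  refine ⟨t, s, hex, ht, ?_, hmax⟩
  -- The invariant allows the record `0` for "nothing found yet", which the existence of some Grundy
  -- colouring with a positive number of colours excludes.
  have hpos : s.reg 1 ≠ 0 := by
    obtain ⟨ℓ, hℓ, C, hC⟩ := G.exists_isGrundyColoring (by omega)
    have := hmax ℓ C hC
    omega
  have hbest : RAM.Best τ := hτ.best
  refine (hτ.same.isAbout hI.isAbout).isGrundyColoring ?_
  rw [hs1, hsa]
  exact hbest.resolve_left (hs1 ▸ hpos)
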